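/- Let $\mathcal H$ be a finite-dimensional complex Hilbert space, $\|\cdot\|$ the operator norm, $p\ge 0$ an integer and $t>0$. Let $H(\tau)=\sum_{\gamma=1}^{\Gamma}H_\gamma(\tau)$, where each $H_\gamma(\tau)$ is a Hermitian operator on $\mathcal H$ for $\tau\in[0,t]$ and is of class $C^{p+2}$ on $[0,t]$ (one-sided derivatives at the ends). Let $U(b,a)=\mathcal T\exp\bigl(-i\int_a^b H(s)\,ds\bigr)$ and $U_\gamma(b,a)=\mathcal T\exp\bigl(-i\int_a^b H_\gamma(s)\,ds\bigr)$ be the evolution operators, where $U_\gamma(b,a)=U_\gamma(a,b)^\dagger$ for $b<a$. Let $K\ge 1$, $\gamma_k\in\{1,\dots,\Gamma\}$, $\alpha_k\in[-1,1]$ and $\beta_k\in[0,1]$ ($k=1,\dots,K$) satisfy $\sum_{k:\gamma_k=\gamma}\alpha_k=1$ for every $\gamma$, $\beta_1=0$, $\beta_K+\alpha_K=1$ and $0\le\beta_k+\alpha_k\le1$ for every $k$. Products are ordered with larger $k$ to the left. The time-dependent product formula is $$S(t,0)=\prod_{k=1,\dots,K}^{\leftarrow}U_{\gamma_k}(\beta_kt+\alpha_kt,\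 \beta_kt).$$ Suppose that the coefficients satisfy the following order condition: for all Hermitian operators $A_0,A_1,\dots,A_\Gamma$ on any finite-dimensional complex Hilbert space, the time-independent product formula $$T(s)=e^{-iA_{\gamma_K}\alpha_Ks}\prod_{k\le K-1}^{\leftarrow}\Bigl(e^{-iA_0(\beta_k+\alpha_k-\beta_{k+1})s}\,e^{-iA_{\gamma_k}\alpha_ks}\Bigr)$$ satisfies $T(s)=e^{-iAs}+O(s^{p+1})$ as $s\to0$, where $A=(\Gamma-1)A_0+\sum_{\gamma=1}^{\Gamma}A_\gamma$. For $1\le k'\le 2K-1$ put $\tilde\alpha_{2k-1}=\alpha_k$ and $\tilde H_{2k-1}(\tau)=H_{\gamma_k}(\tau)$, $\tilde\alpha_{2k}=\beta_{k+1}-\beta_k-\alpha_k$ and $\tilde H_{2k}(\tau)=0$, and let $D_{k'}(\tau)=\mathrm{ad}_{\tilde H_{k'}(\tau)}-i\,\frac{d}{d\tau}$, acting on operator-valued functions of $\tau\in[0,t]$, with $\mathrm{ad}_XY=XY-YX$. Then $$\|U(t,0)-S(t,0)\|\ \le\ 3\,t^{p+1}\max_{\tau\in[0,t]}\ \sum_{k=1}^{K}\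 \sum_{k'_1,\dots,k'_p=1}^{2K-1}\Bigl\|\bigl(|\tilde\alpha_{k'_1}|D_{k'_1}(\tau)\bigr)\cdots\bigl(|\tilde\alpha_{k'_p}|D_{k'_p}(\tau)\bigr)H_{\gamma_k}(\tau)\Bigr\|,$$ and the maximum is attained. -/

import Mathlib

open scoped Topology

noncomputable section

namespace ProductFormula

/-- Bounded operators on a complex Hilbert space, with the operator norm. -/
abbrev Op (E : Type*) [NormedAddCommGroup E] [InnerProductSpace ℂ E] : Type _ := E →L[ℂ] E

/-- The ordered product `f (m-1) * ⋯ * f 1 * f 0`, later factors standing on the left. -/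
def leftProd {M : Type*} [Monoid M] {m : ℕ} (f : Fin m → M) : M :=
  (List.ofFn f).reverse.prod

/-- The coefficients of a product formula with `K = n + 1` factors built from `Γ` terms.
The factors are numbered `0, …, n`. -/
structure Coeffs (Γ : ℕ) where
  /-- the number of factors minus one -/
  n : ℕ
  /-- the term used in each factor -/
  γ : Fin (n + 1) → Fin Γ
  /-- the (signed) durations -/
  α : Fin (n + 1) → ℝ
  /-- the time origins -/
  β : Fin (n + 1) → ℝ
  α_mem : ∀ k, α k ∈ Set.Icc (-1 : ℝ) 1
  sum_α : ∀ g : Fin Γ, ∑ k with γ k = g, α k = 1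
  β_zero : β 0 = 0
  β_add_α_last : β (Fin.last n) + α (Fin.last n) = 1
  β_mem : ∀ k, β k ∈ Set.Icc (0 : ℝ) 1
  β_add_α_mem : ∀ k, β k + α k ∈ Set.Icc (0 : ℝ) 1

section TimeIndependent

variable {E : Type*} [NormedAddCommGroup E] [InnerProductSpace ℂ E]

/-- `e^{-i A s}`. -/
def expEvol (A : Op E) (s : ℝ) : Op E :=
  NormedSpace.exp ((-(Complex.I * (s : ℂ))) • A)

/-- The time-independent product formula with the extra term `H₀` interleaved,
`T(t) = e^{-i H_{γ_K} α_K t} ∏_{k<K} (e^{-i H₀ (β_k + α_k - β_{k+1}) t} e^{-i H_{γ_k} α_k t})`. -/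
def Coeffs.timeIndep {Γ : ℕ} (c : Coeffs Γ) (H₀ : Op E) (H : Fin Γ → Op E) (t : ℝ) : Op E :=
  expEvol (H (c.γ (Fin.last c.n))) (c.α (Fin.last c.n) * t) *
    leftProd fun k : Fin c.n =>
      expEvol H₀ ((c.β k.castSucc + c.α k.castSucc - c.β k.succ) * t) *
        expEvol (H (c.γ k.castSucc)) (c.α k.castSucc * t)

end TimeIndependent

/-- The order condition of order `p`: for all Hermitian `H₀, H₁, …, H_Γ` on a finite-dimensional
Hilbert space, `T(t) = e^{-i H t} + O(t^{p+1})` as `t → 0`, where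
`H = (Γ - 1) H₀ + H₁ + ⋯ + H_Γ`. (The durations of `H₀` in `T(t)` add up to `(Γ - 1) t`.) -/
def Coeffs.OrderCondition {Γ : ℕ} (c : Coeffs Γ) (p : ℕ) : Prop :=
  ∀ (d : ℕ) (H₀ : Op (EuclideanSpace ℂ (Fin d))) (H : Fin Γ → Op (EuclideanSpace ℂ (Fin d))),
    IsSelfAdjoint H₀ → (∀ g, IsSelfAdjoint (H g)) →
      (fun t : ℝ => c.timeIndep H₀ H t - expEvol (((Γ : ℂ) - 1) • H₀ + ∑ g, H g) t)
        =O[𝓝 0] fun t : ℝ => t ^ (p + 1)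

section TimeDependent

variable {E : Type*} [NormedAddCommGroup E] [InnerProductSpace ℂ E]

/-- The `m`-th term of the Dyson series from `a` to `b`,
`(-i)^m ∫_a^b ds_1 ∫_a^{s_1} ds_2 ⋯ ∫_a^{s_{m-1}} ds_m H(s_1) ⋯ H(s_m)`. -/
def dyson (H : ℝ → Op E) (a : ℝ) : ℕ → ℝ → Op E
  | 0, _ => 1
  | m + 1, b => ∫ s in a..b, (-Complex.I) • (H s * dyson H a m s)

/-- The evolution operator `U(b, a) = 𝓣 exp (-i ∫_a^b H(s) ds)`, as the sum of the Dyson series.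
For `b < a` the oriented integrals give the backward evolution
`U(b, a) = U(a, b)⁻¹`, which is `U(a, b)†` for Hermitian `H`. -/
def evol (H : ℝ → Op E) (b a : ℝ) : Op E :=
  ∑' m : ℕ, dyson H a m b

/-- The time-dependent product formula `S(t, 0) = ∏_k U_{γ_k}(β_k t + α_k t, β_k t)`,
later factors standing on the left. -/
def Coeffs.timeDep {Γ : ℕ} (c : Coeffs Γ) (H : Fin Γ → ℝ → Op E) (t : ℝ) : Op E :=
  leftProd fun k : Fin (c.n + 1) =>
    evol (H (c.γ k)) (c.β k * t + c.α k * t) (c.β k * t)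

/-- The `2K - 1` steps of the interleaved formula: `Sum.inl k` is the step number `2k - 1`, which
uses `H_{γ_k}`, and `Sum.inr k` is the step number `2k`, between the factors `k` and `k + 1`. -/
abbrev Coeffs.Step {Γ : ℕ} (c : Coeffs Γ) : Type := Fin (c.n + 1) ⊕ Fin c.n

/-- The coefficient `α̃` of a step. -/
def Coeffs.stepCoeff {Γ : ℕ} (c : Coeffs Γ) : c.Step → ℝ
  | Sum.inl k => c.α k
  | Sum.inr k => c.β k.succ - c.β k.castSucc - c.α k.castSucc

/-- The Hamiltonian `H̃(τ)` of a step. -/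
def Coeffs.stepHam {Γ : ℕ} (c : Coeffs Γ) (H : Fin Γ → ℝ → Op E) : c.Step → ℝ → Op E
  | Sum.inl k => H (c.γ k)
  | Sum.inr _ => fun _ => 0

/-- The operation `D = ad_{G(τ)} - i d/dτ` on operator-valued functions on `[0, t]`
(one-sided derivatives at the two ends). -/
def covDeriv (t : ℝ) (G f : ℝ → Op E) : ℝ → Op E :=
  fun τ => (G τ * f τ - f τ * G τ) - Complex.I • derivWithin f (Set.Icc 0 t) τ

/-- `(|α̃_{κ₁}| D_{κ₁}) ⋯ (|α̃_{κ_p}| D_{κ_p}) B`, the last operation being applied first. -/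
def Coeffs.nested {Γ : ℕ} (c : Coeffs Γ) (H : Fin Γ → ℝ → Op E) (t : ℝ) {p : ℕ}
    (κ : Fin p → c.Step) (B : ℝ → Op E) : ℝ → Op E :=
  (List.ofFn κ).foldr
    (fun j f τ => ((|c.stepCoeff j| : ℝ) : ℂ) • covDeriv t (c.stepHam H j) f τ) B

/-- The commutator factor
`∑_k ∑_{κ₁, …, κ_p} ‖(|α̃_{κ₁}| D_{κ₁}) ⋯ (|α̃_{κ_p}| D_{κ_p}) H_{γ_k}(τ)‖`. -/
def Coeffs.commFactor {Γ : ℕ} (c : Coeffs Γ) (H : Fin Γ → ℝ → Op E) (t : ℝ) (p : ℕ)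
    (τ : ℝ) : ℝ :=
  ∑ k : Fin (c.n + 1), ∑ κ : Fin p → c.Step, ‖c.nested H t κ (H (c.γ k)) τ‖

end TimeDependent

end ProductFormula

end

/-! On operator-valued functions of τ, -i d/dτ generates time translation. Evolving with H_γ
therefore behaves like exponentiating D_γ = H_γ - i d/dτ, and moving the clock between two factors
like exponentiating -i d/dτ alone. With A_0 = i d/dτ and A_γ = D_γ the time-dependent formula
becomes formally a time-independent one, and (Γ-1)A_0 + ∑A_γ = ∑H_γ - i d/dτ. The proof uses only
finite words in the D's, so no exponential of an unbounded operator occurs.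

The 2K-1 steps are run through along one path x ∈ [0, 2K-1], on a time scale s; the evolution P(s,x)
ends at S(s,0). Its generator in s, given by ∂_s P = -iGP, solves ∂_x G = -i[h, G] + ∂_s h, where h
is the Hamiltonian along the path. Iterating this equation gives the Lie series G ~ ∑ (-is)^n Y_n,
where Y_n comes from iterated integrals of (n+1)-fold nested commutators of the D's. At the end of
the path Y_0 is ∑H_γ.

The order condition makes Y_1, …, Y_{p-1} vanish at the end of the path. For constant matrices this
follows by comparing small-s expansions (`lieTerm_eq_zero_of_isBigO`). Tridiagonal matrices separate
words, so the scalar coefficient of each word vanishes (`sum_lieCoeff_eq_zero`), and the conclusion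
passes to time-dependent Hamiltonians (`Coeffs.lieTerm_eq_zero`).

Hence G - ∑H_γ is the remainder after p levels, and it solves the same commutator equation with
source (-is)^p ∑ r_l [D_l, Z_{p-1}], where Z_n is Y_n together with the time shift for n = 0
(`hasDerivAt_pathRemainder`). Reversing the commutator (`lieBracket_eq`) gives words of length p
acting on H_l, plus the derivative of Y_{p-1}, which is the same for all l. Averaging over l bounds
that common part by 3B and the words contribute B, where B is the maximum of the commutator factor.
Thus ‖G - ∑H_γ‖ ≤ 4B s^p, and integration in s gives 4B t^{p+1}/(p+1) ≤ 2B t^{p+1} for p ≥ 1. For p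
= 0 the distances of U and S from 1 give 2Bt directly. -/

noncomputable section

namespace ProductFormula

/-! ### Evolution operators: differential equation, unitarity, uniqueness, Duhamel bound. -/

section Evolution

variable {E : Type*} [NormedAddCommGroup E] [InnerProductSpace ℂ E]

theorem dyson_self_succ (G : ℝ → Op E) (a : ℝ) (m : ℕ) : dyson G a (m + 1) a = 0 := by
  simp [dyson]

theorem evol_self (G : ℝ → Op E) (a : ℝ) : evol G a a = 1 := by
  unfold evol
  rw [tsum_eq_single 0]
  · rfl
  · intro m hm
    obtain ⟨k, rfl⟩ := Nat.exists_eq_succ_of_ne_zero hm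
    exact dyson_self_succ G a k

theorem norm_one_op_le : ‖(1 : Op E)‖ ≤ 1 := ContinuousLinearMap.norm_id_le

/-- Finite dimension enters here: it turns the isometry `evol` into a unitary. -/
theorem op_mul_eq_one_symm [FiniteDimensional ℂ E] {A B : Op E} (h : A * B = 1) : B * A = 1 := by
  have h' : (A : E →ₗ[ℂ] E) * (B : E →ₗ[ℂ] E) = 1 := by
    ext x; simpa using congrArg (fun T : Op E => T x) h
  have h2 : (B : E →ₗ[ℂ] E) * (A : E →ₗ[ℂ] E) = 1 := mul_eq_one_symm h'
  ext x
  simpa using congrArg (fun T : E →ₗ[ℂ] E => T x) h2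

variable [CompleteSpace E]

theorem continuous_dyson {G : ℝ → Op E} (hG : Continuous G) (a : ℝ) (m : ℕ) :
    Continuous (dyson G a m) := by
  induction m with
  | zero => exact continuous_const
  | succ m ih =>
    have hc : Continuous fun s => (-Complex.I) • (G s * dyson G a m s) := by fun_prop
    exact intervalIntegral.continuous_primitive (fun _ _ => hc.intervalIntegrable _ _) a

theorem hasDerivAt_dyson_succ {G : ℝ → Op E} (hG : Continuous G) (a : ℝ) (m : ℕ) (b : ℝ) :
    HasDerivAt (dyson G a (m + 1)) ((-Complex.I) • (G b * dyson G a m b)) b := by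
  have hc : Continuous fun s => (-Complex.I) • (G s * dyson G a m s) := by
    have := continuous_dyson hG a m
    fun_prop
  exact intervalIntegral.integral_hasDerivAt_right (hc.intervalIntegrable _ _)
    hc.aestronglyMeasurable.stronglyMeasurableAtFilter hc.continuousAt

/-- The factorial is the volume of the time-ordered simplex. Only a local bound `M` is assumed,
because a continuous Hamiltonian need not be bounded on the line; absolute values cover backward
evolution. -/
theorem norm_dyson_le {G : ℝ → Op E} (hG : Continuous G) {a M R : ℝ} (hM : 0 ≤ M)
    (hGM : ∀ s, |s - a| ≤ R → ‖G s‖ ≤ M) (m : ℕ) (b : ℝ) (hb : |b - a| ≤ R) :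
    ‖dyson G a m b‖ ≤ M ^ m * |b - a| ^ m / m.factorial := by
  induction m generalizing b with
  | zero => simpa [dyson] using norm_one_op_le (E := E)
  | succ m ih =>
    have hint : MeasureTheory.IntegrableOn (fun s => M ^ (m + 1) / m.factorial * |s - a| ^ m)
        (Set.uIoc a b) := by
      have hc : Continuous fun s : ℝ => M ^ (m + 1) / m.factorial * |s - a| ^ m := by fun_prop
      exact (hc.intervalIntegrable a b).def'
    have hle : ∀ s ∈ Set.uIoc a b, ‖(-Complex.I) • (G s * dyson G a m s)‖ ≤
        M ^ (m + 1) / m.factorial * |s - a| ^ m := by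
      intro s hs
      have hsR : |s - a| ≤ R := by
        refine le_trans ?_ hb
        exact Set.abs_sub_left_of_mem_uIcc (Set.uIoc_subset_uIcc hs)
      have h1 := ih s hsR
      have h2 := hGM s hsR
      calc ‖(-Complex.I) • (G s * dyson G a m s)‖ = ‖G s * dyson G a m s‖ := by
            rw [norm_smul]; simp
        _ ≤ ‖G s‖ * ‖dyson G a m s‖ := norm_mul_le _ _
        _ ≤ M * (M ^ m * |s - a| ^ m / m.factorial) := by gcongr
        _ = _ := by ring
    calc ‖dyson G a (m + 1) b‖
        ≤ ∫ s in Set.uIoc a b, ‖(-Complex.I) • (G s * dyson G a m s)‖ :=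
          intervalIntegral.norm_integral_le_integral_norm_uIoc
      _ ≤ ∫ s in Set.uIoc a b, M ^ (m + 1) / m.factorial * |s - a| ^ m := by
          refine MeasureTheory.setIntegral_mono_on ?_ hint measurableSet_uIoc hle
          have hd := continuous_dyson hG a m
          have hc : Continuous fun s : ℝ => ‖(-Complex.I) • (G s * dyson G a m s)‖ := by fun_prop
          exact (hc.intervalIntegrable a b).def'
      _ = M ^ (m + 1) / m.factorial * (|b - a| ^ (m + 1) / (m + 1)) := by
          rw [MeasureTheory.integral_const_mul, integral_pow_abs_sub_uIoc]
      _ = _ := by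
          rw [Nat.factorial_succ]; push_cast; field_simp

/-- Termwise differentiation shifts the Dyson series by one index, and an exponential series
dominates the derivatives on a bounded interval. -/
theorem hasDerivAt_evol {G : ℝ → Op E} (hG : Continuous G) (a b : ℝ) :
    HasDerivAt (fun b => evol G b a) ((-Complex.I) • (G b * evol G b a)) b := by
  -- The extra 1 makes `b` an interior point of the interval of domination.
  set R : ℝ := |b - a| + 1 with hR
  obtain ⟨M, hM⟩ : ∃ M, ∀ s ∈ Set.Icc (a - R) (a + R), ‖G s‖ ≤ M :=
    isCompact_Icc.exists_bound_of_continuousOn hG.continuousOn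
  have hM0 : 0 ≤ M := le_trans (norm_nonneg _) (hM a ⟨by linarith [abs_nonneg (b - a)],
    by linarith [abs_nonneg (b - a)]⟩)
  have hGM : ∀ s, |s - a| ≤ R → ‖G s‖ ≤ M := fun s hs => by
    rw [abs_le] at hs; exact hM s ⟨by linarith [hs.1], by linarith [hs.2]⟩
  have hbd : ∀ m s, |s - a| ≤ R → ‖dyson G a m s‖ ≤ (M * R) ^ m / m.factorial := by
    intro m s hs
    refine (norm_dyson_le hG hM0 hGM m s hs).trans ?_
    rw [mul_pow]; gcongr
  let g' : ℕ → ℝ → Op E := fun m s => match m with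
    | 0 => 0
    | m + 1 => (-Complex.I) • (G s * dyson G a m s)
  let u : ℕ → ℝ := fun m => match m with
    | 0 => 0
    | m + 1 => M * ((M * R) ^ m / m.factorial)
  have hu : Summable u := by
    rw [← summable_nat_add_iff 1]
    exact (Real.summable_pow_div_factorial (M * R)).mul_left M
  have hsum : ∀ s, |s - a| ≤ R → Summable fun m => dyson G a m s := fun s hs =>
    Summable.of_norm_bounded (Real.summable_pow_div_factorial (M * R)) fun m => hbd m s hs
  have hmem : ∀ s ∈ Set.Ioo (a - R) (a + R), |s - a| ≤ R := fun s hs => by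
    rw [abs_le]; exact ⟨by linarith [hs.1], by linarith [hs.2]⟩
  have hbR : |b - a| < R := by linarith
  have hb : b ∈ Set.Ioo (a - R) (a + R) := by
    rw [abs_lt] at hbR; exact ⟨by linarith [hbR.1], by linarith [hbR.2]⟩
  have key := hasDerivAt_tsum_of_isPreconnected (g := fun m s => dyson G a m s) (g' := g') hu
    isOpen_Ioo isPreconnected_Ioo (t := Set.Ioo (a - R) (a + R)) (y₀ := b) (y := b)
    (by
      intro m s hs
      cases m with
      | zero => exact hasDerivAt_const s (1 : Op E)
      | succ m => exact hasDerivAt_dyson_succ hG a m s)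
    (by
      intro m s hs
      cases m with
      | zero => simp [g', u]
      | succ m =>
        calc ‖(-Complex.I) • (G s * dyson G a m s)‖ = ‖G s * dyson G a m s‖ := by
              rw [norm_smul]; simp
          _ ≤ ‖G s‖ * ‖dyson G a m s‖ := norm_mul_le _ _
          _ ≤ M * ((M * R) ^ m / m.factorial) := by
              have := hGM s (hmem s hs); have := hbd m s (hmem s hs); gcongr)
    hb (hsum b hbR.le) hb
  have hsum' : Summable fun m => (-Complex.I) • (G b * dyson G a m b) :=
    ((hsum b hbR.le).mul_left _).const_smul _
  have e : ∑' m, g' m b = (-Complex.I) • (G b * evol G b a) := by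
    have hs : Summable fun m => g' m b := by
      rw [← summable_nat_add_iff 1]; exact hsum'
    rw [hs.tsum_eq_zero_add]
    simp only [g', zero_add]
    rw [((hsum b hbR.le).mul_left _).tsum_const_smul, (hsum b hbR.le).tsum_mul_left]
    rfl
  rw [e] at key
  exact key

theorem continuous_evol {G : ℝ → Op E} (hG : Continuous G) (a : ℝ) :
    Continuous fun b => evol G b a :=
  continuous_iff_continuousAt.2 fun b => (hasDerivAt_evol hG a b).continuousAt

/-- The pairing of the evolution with a solution of the inhomogeneous equation. -/
theorem hasDerivAt_star_evol_mul {G : ℝ → Op E} (hG : Continuous G) (a : ℝ) {b : ℝ}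
    (hsa : IsSelfAdjoint (G b)) {Z : ℝ → Op E} {F : Op E}
    (hZ : HasDerivAt Z ((-Complex.I) • (G b * Z b) + F) b) :
    HasDerivAt (fun b => star (evol G b a) * Z b) (star (evol G b a) * F) b := by
  have h := (hasDerivAt_evol hG a b).star.mul hZ
  refine h.congr_deriv ?_
  rw [star_smul, star_mul, hsa.star_eq]
  simp only [star_neg, Complex.star_def, Complex.conj_I, neg_neg, mul_add, mul_smul_comm,
    smul_mul_assoc, neg_smul, mul_neg, mul_assoc]
  abel

theorem star_evol_mul_evol {G : ℝ → Op E} (hG : Continuous G) (hsa : ∀ s, IsSelfAdjoint (G s))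
    (a b : ℝ) : star (evol G b a) * evol G b a = 1 := by
  have h : ∀ b, HasDerivAt (fun b => star (evol G b a) * evol G b a) 0 b := fun b => by
    have := hasDerivAt_star_evol_mul hG a (hsa b) (F := 0)
      (by simpa using hasDerivAt_evol hG a b)
    simpa using this
  have := is_const_of_deriv_eq_zero (fun b => (h b).differentiableAt) (fun b => (h b).deriv) b a
  simpa [evol_self] using this

theorem norm_evol_le {G : ℝ → Op E} (hG : Continuous G) (hsa : ∀ s, IsSelfAdjoint (G s))
    (a b : ℝ) : ‖evol G b a‖ ≤ 1 := by
  have h := CStarRing.norm_star_mul_self (x := evol G b a)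
  rw [star_evol_mul_evol hG hsa] at h
  have := norm_one_op_le (E := E)
  nlinarith [norm_nonneg (evol G b a)]

variable [FiniteDimensional ℂ E]

theorem evol_mul_star_evol {G : ℝ → Op E} (hG : Continuous G) (hsa : ∀ s, IsSelfAdjoint (G s))
    (a b : ℝ) : evol G b a * star (evol G b a) = 1 :=
  op_mul_eq_one_symm (star_evol_mul_evol hG hsa a b)

/-- Uniqueness of solutions of the homogeneous equation on an interval. -/
theorem eq_evol_mul {G : ℝ → Op E} (hG : Continuous G) (hsa : ∀ s, IsSelfAdjoint (G s))
    {a b : ℝ} (hab : a ≤ b) {Z : ℝ → Op E}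
    (hZ : ∀ x ∈ Set.Icc a b, HasDerivAt Z ((-Complex.I) • (G x * Z x)) x) :
    Z b = evol G b a * Z a := by
  have h : ∀ x ∈ Set.Icc a b, HasDerivAt (fun x => star (evol G x a) * Z x) 0 x := fun x hx => by
    have := hasDerivAt_star_evol_mul hG a (hsa x) (F := 0) (by simpa using hZ x hx)
    simpa using this
  have h2 := constant_of_has_deriv_right_zero
    (fun x hx => (h x hx).continuousAt.continuousWithinAt)
    (fun x hx => (h x ⟨hx.1, hx.2.le⟩).hasDerivWithinAt) b ⟨hab, le_rfl⟩
  simp only [evol_self, star_one, one_mul] at h2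
  rw [← h2, ← mul_assoc, evol_mul_star_evol hG hsa, one_mul]

theorem evol_mul_evol {G : ℝ → Op E} (hG : Continuous G) (hsa : ∀ s, IsSelfAdjoint (G s))
    (a b c : ℝ) : evol G c b * evol G b a = evol G c a := by
  have h : ∀ x, HasDerivAt (fun x => star (evol G x b) * evol G x a) 0 x := fun x => by
    have := hasDerivAt_star_evol_mul hG b (hsa x) (F := 0)
      (by simpa using hasDerivAt_evol hG a x)
    simpa using this
  have := is_const_of_deriv_eq_zero (fun b => (h b).differentiableAt) (fun b => (h b).deriv) c b
  simp only [evol_self, star_one, one_mul] at this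
  rw [← this, ← mul_assoc, evol_mul_star_evol hG hsa, one_mul]

/-- A solution of `Z' = -i (G Z - Z G) + F` vanishing at the start is at most the integral of
the norm of `F`. -/
theorem norm_le_integral_of_commutator_ode {G : ℝ → Op E} (hG : Continuous G)
    (hsa : ∀ s, IsSelfAdjoint (G s)) {b : ℝ} (hb : 0 ≤ b) {Z F : ℝ → Op E} {φ : ℝ → ℝ}
    (hφ : Continuous φ) (hF : ∀ x ∈ Set.Icc 0 b, ‖F x‖ ≤ φ x) (h0 : Z 0 = 0)
    (hZ : ∀ x, HasDerivAt Z ((-Complex.I) • (G x * Z x - Z x * G x) + F x) x) :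
    ‖Z b‖ ≤ ∫ x in (0 : ℝ)..b, φ x := by
  have h1 : ∀ x, HasDerivAt (fun x => star (evol G x 0) * (Z x * evol G x 0))
      (star (evol G x 0) * (F x * evol G x 0)) x := fun x => by
    refine hasDerivAt_star_evol_mul hG 0 (hsa x) ?_
    refine ((hZ x).mul (hasDerivAt_evol hG 0 x)).congr_deriv ?_
    simp only [smul_sub, sub_mul, add_mul, smul_mul_assoc, mul_smul_comm, mul_assoc]
    abel
  have hle : ∀ x ∈ Set.Icc 0 b, ‖star (evol G x 0) * (F x * evol G x 0)‖ ≤ φ x := fun x hx => by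
    have hU := norm_evol_le hG hsa 0 x
    calc ‖star (evol G x 0) * (F x * evol G x 0)‖ ≤ ‖star (evol G x 0)‖ * (‖F x‖ * ‖evol G x 0‖) :=
          (norm_mul_le _ _).trans (by gcongr; exact norm_mul_le _ _)
      _ ≤ 1 * (‖F x‖ * 1) := by rw [norm_star]; gcongr
      _ ≤ φ x := by simpa using hF x hx
  have h2 : ‖star (evol G b 0) * (Z b * evol G b 0)‖ ≤ ∫ x in (0 : ℝ)..b, φ x := by
    refine image_norm_le_of_norm_deriv_right_le_deriv_boundary
      (f := fun x => star (evol G x 0) * (Z x * evol G x 0))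
      (B := fun x => ∫ y in (0 : ℝ)..x, φ y) (a := 0) (b := b) (B' := φ)
      (fun x hx => (h1 x).continuousAt.continuousWithinAt)
      (fun x hx => (h1 x).hasDerivWithinAt) ?_ ?_ ?_ ⟨hb, le_rfl⟩
    · simp [h0]
    · intro x
      exact intervalIntegral.integral_hasDerivAt_right (hφ.intervalIntegrable _ _)
        hφ.aestronglyMeasurable.stronglyMeasurableAtFilter hφ.continuousAt
    · intro x hx; exact hle x ⟨hx.1, hx.2.le⟩
  have h3 : Z b = evol G b 0 * (star (evol G b 0) * (Z b * evol G b 0)) * star (evol G b 0) := by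
    rw [← mul_assoc, evol_mul_star_evol hG hsa, one_mul, mul_assoc, evol_mul_star_evol hG hsa,
      mul_one]
  rw [h3]
  have hU := norm_evol_le hG hsa 0 b
  refine le_trans ?_ h2
  calc _ ≤ ‖evol G b 0‖ * ‖star (evol G b 0) * (Z b * evol G b 0)‖ * ‖star (evol G b 0)‖ :=
        (norm_mul_le _ _).trans (by gcongr; exact norm_mul_le _ _)
    _ ≤ 1 * ‖star (evol G b 0) * (Z b * evol G b 0)‖ * 1 := by rw [norm_star (evol G b 0)]; gcongr
    _ = _ := by ring

end Evolution

/-! ### Words in the operators h - i d/dτ and the Lie series of a path. -/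

section Words

variable {A : Type*} [NormedRing A] [NormedAlgebra ℂ A] {ι : Type*}

/-- The operation `π(g) - i d/dτ` on functions, for a bilinear action `π`. -/
def covAct (π : A →L[ℂ] A →L[ℂ] A) (g ψ : ℝ → A) : ℝ → A :=
  fun τ => π (g τ) (ψ τ) - Complex.I • deriv ψ τ

/-- A composition of operations `covAct π (h l)`, the head of the list being applied last. -/
def covWord (π : A →L[ℂ] A →L[ℂ] A) (h : ι → ℝ → A) (L : List ι) (ψ : ℝ → A) : ℝ → A :=
  L.foldr (fun l f => covAct π (h l) f) ψ

/-- The adjoint action of an algebra on itself. -/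
def adAct (A : Type*) [NormedRing A] [NormedAlgebra ℂ A] : A →L[ℂ] A →L[ℂ] A :=
  ContinuousLinearMap.mul ℂ A - (ContinuousLinearMap.mul ℂ A).flip

theorem adAct_apply (a b : A) : adAct A a b = a * b - b * a := by simp [adAct]

/-- The action respects commutators. -/
def IsLieAction (π : A →L[ℂ] A →L[ℂ] A) : Prop :=
  ∀ a b c, π (a * b - b * a) c = π a (π b c) - π b (π a c)

theorem isLieAction_mul : IsLieAction (ContinuousLinearMap.mul ℂ A) := fun a b c => by
  simp [mul_assoc]

theorem isLieAction_adAct : IsLieAction (adAct A) := fun a b c => by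
  simp only [adAct_apply, mul_sub, sub_mul, mul_assoc]; abel

theorem covWord_cons (π : A →L[ℂ] A →L[ℂ] A) (h : ι → ℝ → A) (l : ι) (L : List ι) (ψ : ℝ → A) :
    covWord π h (l :: L) ψ = covAct π (h l) (covWord π h L ψ) := rfl

theorem covWord_append (π : A →L[ℂ] A →L[ℂ] A) (h : ι → ℝ → A) (L L' : List ι) (ψ : ℝ → A) :
    covWord π h (L ++ L') ψ = covWord π h L (covWord π h L' ψ) := by
  simp [covWord, List.foldr_append]

theorem action_real_smul (π : A →L[ℂ] A →L[ℂ] A) (c : ℝ) (a b : A) :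
    π (c • a) b = c • π a b := by
  rw [← Complex.coe_smul, map_smul, smul_apply, Complex.coe_smul]

theorem action_real_smul_right (π : A →L[ℂ] A →L[ℂ] A) (c : ℝ) (a b : A) :
    π a (c • b) = c • π a b := by
  rw [← Complex.coe_smul, map_smul, Complex.coe_smul]

theorem isBoundedBilinearMap_action (π : A →L[ℂ] A →L[ℂ] A) :
    IsBoundedBilinearMap ℝ fun q : A × A => π q.1 q.2 where
  add_left := π.isBoundedBilinearMap.add_left
  smul_left := fun c x y => action_real_smul π c x y
  add_right := π.isBoundedBilinearMap.add_right
  smul_right := fun c x y => action_real_smul_right π c x y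
  bound := π.isBoundedBilinearMap.bound

theorem contDiff_action (π : A →L[ℂ] A →L[ℂ] A) {k : ℕ} {g ψ : ℝ → A} (hg : ContDiff ℝ k g)
    (hψ : ContDiff ℝ k ψ) : ContDiff ℝ k fun τ => π (g τ) (ψ τ) := by
  exact (isBoundedBilinearMap_action π).contDiff.comp (hg.prodMk hψ)

theorem hasDerivAt_action (π : A →L[ℂ] A →L[ℂ] A) {g ψ : ℝ → A} {g' ψ' : A} {x : ℝ}
    (hg : HasDerivAt g g' x) (hψ : HasDerivAt ψ ψ' x) :
    HasDerivAt (fun τ => π (g τ) (ψ τ)) (π (g x) ψ' + π g' (ψ x)) x := by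
  exact ((isBoundedBilinearMap_action π).hasFDerivAt (g x, ψ x)).comp_hasDerivAt x (hg.prodMk hψ)

theorem contDiff_covAct (π : A →L[ℂ] A →L[ℂ] A) {k : ℕ} {g ψ : ℝ → A} (hg : ContDiff ℝ k g)
    (hψ : ContDiff ℝ (k + 1 : ℕ) ψ) : ContDiff ℝ k (covAct π g ψ) := by
  have h1 : ContDiff ℝ k (deriv ψ) := by
    have : ContDiff ℝ ((k : WithTop ℕ∞) + 1) ψ := by exact_mod_cast hψ
    exact (contDiff_succ_iff_deriv.1 this).2.2
  have h2 : ContDiff ℝ k ψ := hψ.of_le (by exact_mod_cast Nat.le_succ k)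
  exact (contDiff_action π hg h2).sub (h1.const_smul Complex.I)

theorem contDiff_covWord (π : A →L[ℂ] A →L[ℂ] A) {h : ι → ℝ → A} {M : ℕ}
    (hh : ∀ l, ContDiff ℝ M (h l)) (L : List ι) {k : ℕ} (hk : L.length + k ≤ M) {ψ : ℝ → A}
    (hψ : ContDiff ℝ (L.length + k : ℕ) ψ) : ContDiff ℝ k (covWord π h L ψ) := by
  induction L generalizing k with
  | nil => simpa [covWord] using hψ
  | cons l L ih =>
    rw [covWord_cons]
    simp only [List.length_cons] at hk hψ
    refine contDiff_covAct π ((hh l).of_le (by exact_mod_cast (by omega : k ≤ M))) (ih ?_ ?_)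
    · omega
    · rwa [show L.length + (k + 1) = L.length + 1 + k by ring]

theorem covAct_sum (π : A →L[ℂ] A →L[ℂ] A) (g : ℝ → A) {α : Type*} (s : Finset α) (c : α → ℝ)
    (f : α → ℝ → A) {τ : ℝ} (hf : ∀ i ∈ s, DifferentiableAt ℝ (f i) τ) :
    covAct π g (fun τ => ∑ i ∈ s, c i • f i τ) τ = ∑ i ∈ s, c i • covAct π g (f i) τ := by
  have hd : deriv (fun τ => ∑ i ∈ s, c i • f i τ) τ = ∑ i ∈ s, c i • deriv (f i) τ :=
    (HasDerivAt.fun_sum fun i hi => (hf i hi).hasDerivAt.const_smul (c i)).deriv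
  simp only [covAct, hd, map_sum, action_real_smul_right, Finset.smul_sum, smul_sub,
    Finset.sum_sub_distrib]
  congr 1
  exact Finset.sum_congr rfl fun i _ => smul_comm _ _ _

theorem ofFn_cons' {n : ℕ} (l : ι) (κ : Fin n → ι) :
    List.ofFn (Fin.cons l κ : Fin (n + 1) → ι) = l :: List.ofFn κ := by simp

theorem ofFn_snoc' {n : ℕ} (κ : Fin n → ι) (l : ι) :
    List.ofFn (Fin.snoc κ l : Fin (n + 1) → ι) = List.ofFn κ ++ [l] := by
  rw [List.ofFn_succ']; simp [List.concat_eq_append]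

/-- Coefficients of the Lie series of a path with rates `r`: the coefficient of a word of length
`n + 1` at the path position `x`. -/
def lieCoeff (r : ι → ℝ → ℝ) : (n : ℕ) → (Fin (n + 1) → ι) → ℝ → ℝ
  | 0, κ, x => ∫ y in (0 : ℝ)..x, r (κ 0) y
  | n + 1, κ, x => ∫ y in (0 : ℝ)..x, (r (κ 0) y * lieCoeff r n (Fin.tail κ) y -
      r (κ (Fin.last _)) y * lieCoeff r n (Fin.init κ) y)

theorem lieCoeff_zero_right (r : ι → ℝ → ℝ) (n : ℕ) (κ : Fin (n + 1) → ι) :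
    lieCoeff r n κ 0 = 0 := by
  cases n <;> simp [lieCoeff]

theorem hasDerivAt_primitive {F : Type*} [NormedAddCommGroup F] [NormedSpace ℝ F]
    [CompleteSpace F] {f : ℝ → F} (hf : Continuous f) (a x : ℝ) :
    HasDerivAt (fun x => ∫ y in a..x, f y) (f x) x :=
  intervalIntegral.integral_hasDerivAt_right (hf.intervalIntegrable _ _)
    hf.aestronglyMeasurable.stronglyMeasurableAtFilter hf.continuousAt

theorem continuous_lieCoeff {r : ι → ℝ → ℝ} (hr : ∀ l, Continuous (r l)) (n : ℕ)
    (κ : Fin (n + 1) → ι) : Continuous (lieCoeff r n κ) := by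
  induction n with
  | zero => exact continuous_iff_continuousAt.2 fun x =>
      (hasDerivAt_primitive (hr (κ 0)) 0 x).continuousAt
  | succ n ih => exact continuous_iff_continuousAt.2 fun x =>
      (hasDerivAt_primitive (((hr (κ 0)).mul (ih (Fin.tail κ))).sub
        ((hr (κ (Fin.last _))).mul (ih (Fin.init κ)))) 0 x).continuousAt

theorem hasDerivAt_lieCoeff_zero {r : ι → ℝ → ℝ} (hr : ∀ l, Continuous (r l))
    (κ : Fin 1 → ι) (x : ℝ) : HasDerivAt (lieCoeff r 0 κ) (r (κ 0) x) x :=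
  hasDerivAt_primitive (hr _) 0 x

theorem hasDerivAt_lieCoeff_succ {r : ι → ℝ → ℝ} (hr : ∀ l, Continuous (r l)) (n : ℕ)
    (κ : Fin (n + 2) → ι) (x : ℝ) :
    HasDerivAt (lieCoeff r (n + 1) κ) (r (κ 0) x * lieCoeff r n (Fin.tail κ) x -
      r (κ (Fin.last _)) x * lieCoeff r n (Fin.init κ) x) x :=
  hasDerivAt_primitive (((hr _).mul (continuous_lieCoeff hr n _)).sub
    ((hr _).mul (continuous_lieCoeff hr n _))) 0 x

variable [Fintype ι]

theorem sum_fin_cons {M : Type*} [AddCommMonoid M] {n : ℕ} (F : (Fin (n + 1) → ι) → M) :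
    ∑ κ, F κ = ∑ l, ∑ κ : Fin n → ι, F (Fin.cons l κ) := by
  rw [← Fintype.sum_prod_type']
  exact (Fintype.sum_equiv (Fin.consEquiv fun _ => ι) _ _ fun _ => rfl).symm

theorem sum_fin_snoc {M : Type*} [AddCommMonoid M] {n : ℕ} (F : (Fin (n + 1) → ι) → M) :
    ∑ κ, F κ = ∑ l, ∑ κ : Fin n → ι, F (Fin.snoc κ l) := by
  rw [← Fintype.sum_prod_type']
  exact (Fintype.sum_equiv (Fin.snocEquiv fun _ => ι) _ _ fun _ => rfl).symm

/-- The time reached at the path position `x`. -/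
def pathTime (r : ι → ℝ → ℝ) (x : ℝ) : ℝ := ∑ l, ∫ y in (0 : ℝ)..x, r l y

/-- The term of level `n + 1` of the Lie series, as a function of time. -/
def lieTerm (r : ι → ℝ → ℝ) (h : ι → ℝ → A) (n : ℕ) (x τ : ℝ) : A :=
  ∑ κ : Fin (n + 1) → ι, lieCoeff r n κ x •
    covWord (ContinuousLinearMap.mul ℂ A) h (List.ofFn κ) 1 τ

/-- The time displacement, present in the first level only. -/
def lieShift (r : ι → ℝ → ℝ) (n : ℕ) (x : ℝ) : ℝ := if n = 0 then pathTime r x else 0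

/-- The commutator of `h l - i d/dτ` with the term of level `n + 1` of the Lie series. -/
def lieBracket (r : ι → ℝ → ℝ) (h : ι → ℝ → A) (n : ℕ) (l : ι) (x τ : ℝ) : A :=
  h l τ * lieTerm r h n x τ - lieTerm r h n x τ * h l τ -
    Complex.I • deriv (lieTerm r h n x) τ + lieShift r n x • Complex.I • deriv (h l) τ

theorem contDiff_lieTerm {h : ι → ℝ → A} {M : ℕ} (hh : ∀ l, ContDiff ℝ M (h l))
    (r : ι → ℝ → ℝ) {n k : ℕ} (hk : n + 1 + k ≤ M) (x : ℝ) :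
    ContDiff ℝ k (lieTerm r h n x) := by
  refine ContDiff.sum fun κ _ => ContDiff.const_smul _ ?_
  exact contDiff_covWord _ hh _ (by simpa using hk) contDiff_const

/-- The derivative along the path of the level `n + 2` part of the action of the Lie series. -/
theorem hasDerivAt_sum_lieCoeff_succ {r : ι → ℝ → ℝ} (hr : ∀ l, Continuous (r l))
    (π : A →L[ℂ] A →L[ℂ] A) {h : ι → ℝ → A} {M n : ℕ} (hM : n + 2 ≤ M)
    (hh : ∀ l, ContDiff ℝ M (h l)) {ψ : ℝ → A} (hψ : ContDiff ℝ (n + 2 : ℕ) ψ) (x τ : ℝ) :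
    HasDerivAt (fun x => ∑ κ : Fin (n + 2) → ι, lieCoeff r (n + 1) κ x •
        covWord π h (List.ofFn κ) ψ τ)
      (∑ l, r l x • (covAct π (h l) (fun τ => ∑ κ : Fin (n + 1) → ι, lieCoeff r n κ x •
          covWord π h (List.ofFn κ) ψ τ) τ -
        ∑ κ : Fin (n + 1) → ι, lieCoeff r n κ x •
          covWord π h (List.ofFn κ) (covAct π (h l) ψ) τ)) x := by
  have h1 := HasDerivAt.fun_sum (u := Finset.univ) fun (κ : Fin (n + 2) → ι) _ =>
    (hasDerivAt_lieCoeff_succ hr n κ x).smul_const (covWord π h (List.ofFn κ) ψ τ)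
  refine h1.congr_deriv ?_
  simp only [sub_smul, Finset.sum_sub_distrib, smul_sub]
  congr 1
  · rw [sum_fin_cons]
    refine Finset.sum_congr rfl fun l _ => ?_
    rw [covAct_sum, Finset.smul_sum]
    · refine Finset.sum_congr rfl fun κ _ => ?_
      rw [ofFn_cons', covWord_cons, Fin.cons_zero, Fin.tail_cons, mul_smul]
    · intro κ _
      have := contDiff_covWord π hh (List.ofFn κ) (k := 1) (by rw [List.length_ofFn]; exact hM)
        (by rw [List.length_ofFn]; exact hψ)
      exact (this.differentiable (by simp)).differentiableAt
  · rw [sum_fin_snoc]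
    refine Finset.sum_congr rfl fun l _ => ?_
    rw [Finset.smul_sum]
    refine Finset.sum_congr rfl fun κ _ => ?_
    rw [ofFn_snoc', covWord_append, Fin.snoc_last, Fin.init_snoc, mul_smul]
    rfl

/-- This is the commutator of the first-order operators g - i d/dτ and Y - c i d/dτ. The derivatives
of ψ cancel, so it acts through π by a function, without differentiating ψ. -/
theorem covAct_lie_sub {π : A →L[ℂ] A →L[ℂ] A} (hπ : IsLieAction π) {g Y ψ : ℝ → A} (c : ℝ)
    (hg : ContDiff ℝ (1 : ℕ) g) (hY : ContDiff ℝ (1 : ℕ) Y) (hψ : ContDiff ℝ (2 : ℕ) ψ) (τ : ℝ) :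
    covAct π g (fun τ => π (Y τ) (ψ τ) - c • Complex.I • deriv ψ τ) τ -
      (π (Y τ) (covAct π g ψ τ) - c • Complex.I • deriv (covAct π g ψ) τ) =
    π (g τ * Y τ - Y τ * g τ - Complex.I • deriv Y τ + c • Complex.I • deriv g τ) (ψ τ) := by
  have hg1 := (hg.differentiable (by simp) τ).hasDerivAt
  have hY1 := (hY.differentiable (by simp) τ).hasDerivAt
  have hψ1 := (hψ.differentiable (by simp) τ).hasDerivAt
  have hψ2 : HasDerivAt (deriv ψ) (deriv (deriv ψ) τ) τ := by
    have : ContDiff ℝ ((1 : WithTop ℕ∞) + 1) ψ := by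
      have e : ((1 : WithTop ℕ∞) + 1) = ((2 : ℕ) : WithTop ℕ∞) := by norm_num
      rw [e]; exact hψ
    exact ((contDiff_succ_iff_deriv.1 this).2.2.differentiable (by simp) τ).hasDerivAt
  have d1 : deriv (fun τ => π (Y τ) (ψ τ) - c • Complex.I • deriv ψ τ) τ =
      π (Y τ) (deriv ψ τ) + π (deriv Y τ) (ψ τ) - c • Complex.I • deriv (deriv ψ) τ :=
    ((hasDerivAt_action π hY1 hψ1).sub ((hψ2.const_smul Complex.I).const_smul c)).deriv
  have d2 : deriv (covAct π g ψ) τ =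
      π (g τ) (deriv ψ τ) + π (deriv g τ) (ψ τ) - Complex.I • deriv (deriv ψ) τ :=
    ((hasDerivAt_action π hg1 hψ1).sub (hψ2.const_smul Complex.I)).deriv
  rw [covAct, d1, d2, covAct]
  have e : π (g τ * Y τ - Y τ * g τ - Complex.I • deriv Y τ + c • Complex.I • deriv g τ) (ψ τ) =
      π (g τ) (π (Y τ) (ψ τ)) - π (Y τ) (π (g τ) (ψ τ)) - Complex.I • π (deriv Y τ) (ψ τ) +
        c • Complex.I • π (deriv g τ) (ψ τ) := by
    rw [map_add, map_sub (π) (g τ * Y τ - Y τ * g τ), add_apply, sub_apply, hπ,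
      action_real_smul, map_smul, map_smul, smul_apply, smul_apply]
  rw [e]
  simp only [map_sub, map_smul, action_real_smul_right, smul_sub, smul_add]
  simp only [smul_comm Complex.I c]
  abel

/-- A combination of words with these coefficients is a Lie element, so from the second level on it
contains no derivative of ψ and is determined by its value on ψ = 1 under left multiplication. The
same function `lieTerm` therefore serves every Lie action, in particular multiplication and ad. In
the induction both sides have the same derivative along the path and vanish at its start. The
statement ranges over all ψ because the step also uses it for `covAct π (h l) ψ`. -/
theorem sum_lieCoeff_covWord {r : ι → ℝ → ℝ} (hr : ∀ l, Continuous (r l))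
    {h : ι → ℝ → A} {M : ℕ} (hh : ∀ l, ContDiff ℝ M (h l)) (n : ℕ) (hM : n + 2 ≤ M) :
    ∀ {π : A →L[ℂ] A →L[ℂ] A}, IsLieAction π → ∀ {ψ : ℝ → A}, ContDiff ℝ (n + 1 : ℕ) ψ →
      ∀ x τ, ∑ κ : Fin (n + 1) → ι, lieCoeff r n κ x • covWord π h (List.ofFn κ) ψ τ =
        π (lieTerm r h n x τ) (ψ τ) - lieShift r n x • Complex.I • deriv ψ τ := by
  induction n with
  | zero =>
    intro π hπ ψ hψ x τ
    rw [lieTerm, sum_fin_cons]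
    simp only [sum_fin_cons (n := 0), ofFn_cons', covWord_cons, lieShift, if_true, pathTime,
      lieCoeff, Fin.cons_zero, Finset.univ_unique, Finset.sum_singleton, List.ofFn_zero,
      Finset.sum_smul, map_sum, sum_apply, action_real_smul]
    simp [covWord, covAct, smul_sub, Finset.sum_sub_distrib]
  | succ n ih =>
    have ih := @ih (by omega)
    have key : ∀ {π : A →L[ℂ] A →L[ℂ] A}, IsLieAction π → ∀ {ψ : ℝ → A},
        ContDiff ℝ (n + 2 : ℕ) ψ → ∀ x τ,
        HasDerivAt (fun x => ∑ κ : Fin (n + 2) → ι, lieCoeff r (n + 1) κ x •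
          covWord π h (List.ofFn κ) ψ τ) (π (∑ l, r l x • lieBracket r h n l x τ) (ψ τ)) x := by
      intro π hπ ψ hψ x τ
      refine (hasDerivAt_sum_lieCoeff_succ hr π (by omega) hh hψ x τ).congr_deriv ?_
      simp only [map_sum, sum_apply, action_real_smul]
      refine Finset.sum_congr rfl fun l _ => ?_
      congr 1
      have hl : ContDiff ℝ (n + 1 : ℕ) (h l) := (hh l).of_le (by exact_mod_cast (by omega))
      have hψ1 : ContDiff ℝ (n + 1 : ℕ) ψ := hψ.of_le (by exact_mod_cast (by omega))
      simp_rw [ih hπ hψ1]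
      rw [ih hπ (contDiff_covAct π hl hψ)]
      exact covAct_lie_sub hπ _ ((hh l).of_le (by exact_mod_cast (by omega)))
        (contDiff_lieTerm hh r (by omega) x) (hψ.of_le (by exact_mod_cast (by omega))) τ
    intro π hπ ψ hψ x τ
    have hY : ∀ x, HasDerivAt (fun x => lieTerm r h (n + 1) x τ)
        (∑ l, r l x • lieBracket r h n l x τ) x := fun x => by
      -- Under left multiplication on the constant function 1 the word sum is the Lie term itself.
      refine (key isLieAction_mul (ψ := 1) contDiff_const x τ).congr_deriv ?_
      simp
    have hd : ∀ x, HasDerivAt (fun x => ∑ κ : Fin (n + 2) → ι, lieCoeff r (n + 1) κ x •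
          covWord π h (List.ofFn κ) ψ τ - π (lieTerm r h (n + 1) x τ) (ψ τ)) 0 x := fun x => by
      refine ((key hπ hψ x τ).sub
        (hasDerivAt_action π (hY x) (hasDerivAt_const x (ψ τ)))).congr_deriv ?_
      simp
    have := is_const_of_deriv_eq_zero (fun x => (hd x).differentiableAt) (fun x => (hd x).deriv)
      x 0
    simp only [lieTerm, lieCoeff_zero_right, zero_smul, Finset.sum_const_zero, map_zero,
      zero_apply, sub_zero] at this
    rw [sub_eq_zero] at this
    rw [this]
    simp [lieShift, lieTerm]

theorem hasDerivAt_lieTerm_succ {r : ι → ℝ → ℝ} (hr : ∀ l, Continuous (r l))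
    {h : ι → ℝ → A} {M : ℕ} (hh : ∀ l, ContDiff ℝ M (h l)) (n : ℕ) (hM : n + 2 ≤ M) (x τ : ℝ) :
    HasDerivAt (fun x => lieTerm r h (n + 1) x τ) (∑ l, r l x • lieBracket r h n l x τ) x := by
  refine (hasDerivAt_sum_lieCoeff_succ hr (ContinuousLinearMap.mul ℂ A) hM hh
    (ψ := 1) contDiff_const x τ).congr_deriv ?_
  refine Finset.sum_congr rfl fun l _ => ?_
  congr 1
  have hl : ContDiff ℝ (n + 1 : ℕ) (h l) := (hh l).of_le (by exact_mod_cast (by omega))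
  simp_rw [sum_lieCoeff_covWord hr hh n hM isLieAction_mul (ψ := 1) contDiff_const]
  rw [sum_lieCoeff_covWord hr hh n hM isLieAction_mul
    (ψ := covAct _ (h l) 1) (contDiff_covAct _ hl contDiff_const)]
  refine (covAct_lie_sub isLieAction_mul _ ((hh l).of_le (by exact_mod_cast (by omega)))
    (contDiff_lieTerm hh r (by omega) x) (ψ := 1) contDiff_const τ).trans ?_
  simp [lieBracket]

/-- The commutator of a Hamiltonian with the Lie series, expanded in words acting on it. -/
theorem lieBracket_eq {r : ι → ℝ → ℝ} (hr : ∀ l, Continuous (r l))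
    {h : ι → ℝ → A} {M : ℕ} (hh : ∀ l, ContDiff ℝ M (h l)) (n : ℕ) (hM : n + 2 ≤ M)
    (l : ι) (x τ : ℝ) :
    lieBracket r h n l x τ = -(Complex.I • deriv (lieTerm r h n x) τ) -
      ∑ κ : Fin (n + 1) → ι, lieCoeff r n κ x • covWord (adAct A) h (List.ofFn κ) (h l) τ := by
  -- Under the adjoint action the word sum is the reversed commutator, apart from the derivative of
  -- the Lie term, which h l - i d/dτ contributes through its second part.
  rw [sum_lieCoeff_covWord hr hh n hM isLieAction_adAct
    ((hh l).of_le (by exact_mod_cast (by omega))), adAct_apply, lieBracket]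
  abel

end Words

/-! ### Norm bounds for the Lie series by nested commutators. -/

section Bounds

variable {A : Type*} [NormedRing A] [NormedAlgebra ℂ A] {ι : Type*}

theorem covWord_sum (π : A →L[ℂ] A →L[ℂ] A) {h : ι → ℝ → A} {M : ℕ}
    (hh : ∀ l, ContDiff ℝ M (h l)) (L : List ι) (hL : L.length ≤ M) {α : Type*} (s : Finset α)
    (c : α → ℝ) (f : α → ℝ → A) (hf : ∀ i ∈ s, ContDiff ℝ L.length (f i)) :
    covWord π h L (fun τ => ∑ i ∈ s, c i • f i τ) =
      fun τ => ∑ i ∈ s, c i • covWord π h L (f i) τ := by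
  induction L with
  | nil => rfl
  | cons l L ih =>
    simp only [List.length_cons] at hL hf
    have hf' : ∀ i ∈ s, ContDiff ℝ L.length (f i) := fun i hi =>
      (hf i hi).of_le (by exact_mod_cast Nat.le_succ _)
    rw [covWord_cons, ih (by omega) hf']
    funext τ
    refine covAct_sum π (h l) s c _ fun i hi => ?_
    have := contDiff_covWord π hh L (k := 1) hL (hf i hi)
    exact (this.differentiable (by simp)).differentiableAt

theorem covWord_add_smul (π : A →L[ℂ] A →L[ℂ] A) {h : ι → ℝ → A} {M : ℕ}
    (hh : ∀ l, ContDiff ℝ M (h l)) (L : List ι) (hL : L.length ≤ M) (c : ℝ) {f g : ℝ → A}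
    (hf : ContDiff ℝ L.length f) (hg : ContDiff ℝ L.length g) (τ : ℝ) :
    covWord π h L (fun τ => f τ + c • g τ) τ = covWord π h L f τ + c • covWord π h L g τ := by
  have := covWord_sum π hh L hL (Finset.univ : Finset (Fin 2)) ![1, c] ![f, g] (by
    intro i _; fin_cases i
    · exact hf
    · exact hg)
  simpa using congrFun this τ

theorem exists_hasDerivAt_prod_nonneg {α : Type*} (s : Finset α) {f f' : α → ℝ → ℝ} {x : ℝ}
    (hf : ∀ i, HasDerivAt (f i) (f' i x) x) (h0 : ∀ i, 0 ≤ f i x) (h1 : ∀ i, 0 ≤ f' i x) :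
    ∃ q, 0 ≤ q ∧ HasDerivAt (fun x => ∏ i ∈ s, f i x) q x := by
  classical
  refine ⟨_, ?_, HasDerivAt.fun_finsetProd fun i _ => hf i⟩
  exact Finset.sum_nonneg fun i _ => mul_nonneg (Finset.prod_nonneg fun j _ => h0 j) (h1 i)

theorem integral_abs_nonneg (f : ℝ → ℝ) {x : ℝ} (hx : 0 ≤ x) : 0 ≤ ∫ y in (0 : ℝ)..x, |f y| :=
  intervalIntegral.integral_nonneg hx fun _ _ => abs_nonneg _

/-- No combinatorial factor is lost. Differentiating the product of the integrals gives one
nonnegative term per letter; the terms of the first and last letters dominate the two parts of the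
recursion for `lieCoeff`, and those of the middle letters are dropped. -/
theorem abs_lieCoeff_le {r : ι → ℝ → ℝ} (hr : ∀ l, Continuous (r l)) (n : ℕ)
    (κ : Fin (n + 1) → ι) {x : ℝ} (hx : 0 ≤ x) :
    |lieCoeff r n κ x| ≤ ∏ i, ∫ y in (0 : ℝ)..x, |r (κ i) y| := by
  induction n generalizing x with
  | zero =>
    simpa [lieCoeff] using intervalIntegral.abs_integral_le_integral_abs hx (f := r (κ 0))
  | succ n ih =>
    have hR : ∀ l x, HasDerivAt (fun x => ∫ y in (0 : ℝ)..x, |r l y|) |r l x| x := fun l x =>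
      hasDerivAt_primitive (hr l).abs 0 x
    have key : ∀ y ∈ Set.Icc 0 x, ∃ q, HasDerivAt
        (fun x => ∏ i, ∫ y in (0 : ℝ)..x, |r (κ i) y|) q y ∧
        |r (κ 0) y * lieCoeff r n (Fin.tail κ) y -
          r (κ (Fin.last _)) y * lieCoeff r n (Fin.init κ) y| ≤ q := by
      intro y hy
      obtain ⟨q, hq0, hq⟩ := exists_hasDerivAt_prod_nonneg (Finset.univ : Finset (Fin n))
        (f := fun i x => ∫ y in (0 : ℝ)..x, |r (κ i.castSucc.succ) y|)
        (f' := fun i x => |r (κ i.castSucc.succ) x|) (x := y)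
        (fun i => hR _ y) (fun i => integral_abs_nonneg _ hy.1) (fun i => abs_nonneg _)
      refine ⟨_, (((hR (κ 0) y).mul (hq.mul (hR (κ (Fin.last _)) y))).congr_of_eventuallyEq
        (Filter.Eventually.of_forall fun x => ?_)), ?_⟩
      · simp only [Pi.mul_apply]
        rw [Fin.prod_univ_succ, Fin.prod_univ_castSucc]
        rfl
      · have h1 := ih (Fin.tail κ) hy.1
        have h2 := ih (Fin.init κ) hy.1
        rw [Fin.prod_univ_castSucc] at h1
        rw [Fin.prod_univ_succ] at h2
        have h1' : |lieCoeff r n (Fin.tail κ) y| ≤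
            (∏ i : Fin n, ∫ y in (0 : ℝ)..y, |r (κ i.castSucc.succ) y|) *
              ∫ y in (0 : ℝ)..y, |r (κ (Fin.last _)) y| := h1
        have h2' : |lieCoeff r n (Fin.init κ) y| ≤ (∫ y in (0 : ℝ)..y, |r (κ 0) y|) *
            ∏ i : Fin n, ∫ y in (0 : ℝ)..y, |r (κ i.castSucc.succ) y| := h2
        have h3 : 0 ≤ (∫ y in (0 : ℝ)..y, |r (κ 0) y|) *
            (q * ∫ y in (0 : ℝ)..y, |r (κ (Fin.last _)) y|) :=
          mul_nonneg (integral_abs_nonneg _ hy.1) (mul_nonneg hq0 (integral_abs_nonneg _ hy.1))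
        have h4 := mul_le_mul_of_nonneg_left h1' (abs_nonneg (r (κ 0) y))
        have h5 := mul_le_mul_of_nonneg_left h2' (abs_nonneg (r (κ (Fin.last _)) y))
        refine (abs_sub _ _).trans ?_
        rw [abs_mul, abs_mul]
        simp only [Pi.mul_apply]
        nlinarith
    choose! q hq hle using key
    have := image_norm_le_of_norm_deriv_right_le_deriv_boundary'
      (f := lieCoeff r (n + 1) κ) (a := 0) (b := x)
      (B := fun x => ∏ i, ∫ y in (0 : ℝ)..x, |r (κ i) y|) (B' := q)
      (continuous_lieCoeff hr _ _).continuousOn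
      (fun y hy => (hasDerivAt_lieCoeff_succ hr n κ y).hasDerivWithinAt)
      (by rw [lieCoeff_zero_right, norm_zero]
          exact Finset.prod_nonneg fun i _ => integral_abs_nonneg _ le_rfl)
      (fun y hy => (hq y hy).continuousAt.continuousWithinAt)
      (fun y hy => (hq y ⟨hy.1, hy.2.le⟩).hasDerivWithinAt)
      (fun y hy => hle y ⟨hy.1, hy.2.le⟩) ⟨hx, le_rfl⟩
    simpa using this

variable [Fintype ι]

/-- The commutator factor of one term: words of length `n` acting on `h k`. -/
def wordNorm (a : ι → ℝ) (h : ι → ℝ → A) (n : ℕ) (L : List ι) (k : ι) (τ : ℝ) : ℝ :=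
  ∑ κ : Fin n → ι, (∏ i, |a (κ i)|) * ‖covWord (adAct A) h (L ++ List.ofFn κ) (h k) τ‖

/-- The weighted sum of the commutator factors of all terms. -/
def wordNormSum (a : ι → ℝ) (h : ι → ℝ → A) (n : ℕ) (L : List ι) (τ : ℝ) : ℝ :=
  ∑ k, |a k| * wordNorm a h n L k τ

theorem wordNorm_nonneg (a : ι → ℝ) (h : ι → ℝ → A) (n : ℕ) (L : List ι) (k : ι) (τ : ℝ) :
    0 ≤ wordNorm a h n L k τ :=
  Finset.sum_nonneg fun _ _ => mul_nonneg (Finset.prod_nonneg fun _ _ => abs_nonneg _)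
    (norm_nonneg _)

theorem wordNorm_succ (a : ι → ℝ) (h : ι → ℝ → A) (n : ℕ) (L : List ι) (k : ι) (τ : ℝ) :
    wordNorm a h (n + 1) L k τ = ∑ l, |a l| * wordNorm a h n (L ++ [l]) k τ := by
  rw [wordNorm, sum_fin_cons]
  refine Finset.sum_congr rfl fun l _ => ?_
  rw [wordNorm, Finset.mul_sum]
  refine Finset.sum_congr rfl fun κ _ => ?_
  rw [Fin.prod_univ_succ, ofFn_cons']
  simp [mul_assoc]

/-- The list `L` is a prefix of operations applied last. Moving the outermost free letter into it is
what drives the induction on the level. -/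
theorem wordNormSum_succ (a : ι → ℝ) (h : ι → ℝ → A) (n : ℕ) (L : List ι) (τ : ℝ) :
    wordNormSum a h (n + 1) L τ = ∑ l, |a l| * wordNormSum a h n (L ++ [l]) τ := by
  simp only [wordNormSum, wordNorm_succ, Finset.mul_sum]
  rw [Finset.sum_comm]
  exact Finset.sum_congr rfl fun _ _ => Finset.sum_congr rfl fun _ _ => by ring

theorem lieTerm_zero (r : ι → ℝ → ℝ) (h : ι → ℝ → A) (x : ℝ) :
    lieTerm r h 0 x = fun τ => ∑ l, (∫ y in (0 : ℝ)..x, r l y) • h l τ := by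
  funext τ
  rw [lieTerm, sum_fin_cons]
  simp [lieCoeff, covWord, covAct]

theorem lieTerm_zero_right (r : ι → ℝ → ℝ) (h : ι → ℝ → A) (n : ℕ) :
    lieTerm r h n 0 = fun _ => 0 := by
  funext τ; simp [lieTerm, lieCoeff_zero_right]

theorem lieBracket_eq_covAct (r : ι → ℝ → ℝ) (h : ι → ℝ → A) (n : ℕ) (l : ι) (x : ℝ) :
    lieBracket r h n l x = fun τ => covAct (adAct A) (h l) (lieTerm r h n x) τ +
      lieShift r n x • Complex.I • deriv (h l) τ := by
  funext τ; rw [lieBracket, covAct, adAct_apply]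

/-- Differentiation along the path passes through operations in τ, since a Lie term is a finite
combination of fixed functions of τ with coefficients depending on `x` alone. -/
theorem hasDerivAt_covWord_lieTerm_succ (π : A →L[ℂ] A →L[ℂ] A) {r : ι → ℝ → ℝ}
    (hr : ∀ l, Continuous (r l))
    {h : ι → ℝ → A} {M : ℕ} (hh : ∀ l, ContDiff ℝ M (h l)) (n : ℕ) (L : List ι)
    (hM : L.length + n + 2 ≤ M) (x τ : ℝ) :
    HasDerivAt (fun x => covWord π h L (lieTerm r h (n + 1) x) τ)
      (∑ l, r l x • covWord π h L (lieBracket r h n l x) τ) x := by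
  have hw : ∀ κ : Fin (n + 2) → ι, ContDiff ℝ L.length
      (covWord (ContinuousLinearMap.mul ℂ A) h (List.ofFn κ) 1) := fun κ =>
    contDiff_covWord _ hh _ (by rw [List.length_ofFn]; omega) contDiff_const
  have h1 : ∀ x, covWord π h L (lieTerm r h (n + 1) x) τ = ∑ κ : Fin (n + 2) → ι,
      lieCoeff r (n + 1) κ x •
        covWord π h L (covWord (ContinuousLinearMap.mul ℂ A) h (List.ofFn κ) 1) τ := fun x =>
    congrFun (covWord_sum π hh L (by omega) Finset.univ (fun κ => lieCoeff r (n + 1) κ x) _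
      fun κ _ => hw κ) τ
  simp_rw [h1]
  refine (HasDerivAt.fun_sum (u := Finset.univ) fun (κ : Fin (n + 2) → ι) _ =>
    (hasDerivAt_lieCoeff_succ hr n κ x).smul_const _).congr_deriv ?_
  have hb : ∀ l ∈ Finset.univ, ContDiff ℝ L.length (lieBracket r h n l x) := by
    intro l _
    rw [lieBracket_eq_covAct]
    have hl : ContDiff ℝ L.length (h l) := (hh l).of_le (by exact_mod_cast (by omega))
    have hl' : ContDiff ℝ L.length (deriv (h l)) := by
      have : ContDiff ℝ ((L.length : WithTop ℕ∞) + 1) (h l) :=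
        (hh l).of_le (by exact_mod_cast (by omega))
      exact (contDiff_succ_iff_deriv.1 this).2.2
    exact (contDiff_covAct _ hl (contDiff_lieTerm hh r (by omega) x)).add
      ((hl'.const_smul Complex.I).const_smul _)
  rw [← congrFun (covWord_sum π hh L (by omega) Finset.univ (fun κ => _) _ fun κ _ => hw κ) τ,
    ← congrFun (covWord_sum π hh L (by omega) Finset.univ (fun l => r l x) _ hb) τ]
  congr 1
  funext σ
  have e1 := HasDerivAt.fun_sum (u := Finset.univ) fun (κ : Fin (n + 2) → ι) _ =>
    (hasDerivAt_lieCoeff_succ hr n κ x).smul_const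
      (covWord (ContinuousLinearMap.mul ℂ A) h (List.ofFn κ) 1 σ)
  exact e1.unique (hasDerivAt_lieTerm_succ hr hh n (by omega) x σ)

variable {r : ι → ℝ → ℝ} {h : ι → ℝ → A} {M : ℕ} {a : ι → ℝ} {X : ℝ}

theorem norm_covWord_lieTerm_zero_le
    (hh : ∀ l, ContDiff ℝ M (h l))
    (ha : ∀ l, ∀ x ∈ Set.Icc 0 X, ∫ y in (0 : ℝ)..x, |r l y| ≤ |a l|) (L : List ι)
    (hL : L.length ≤ M) (τ : ℝ) {x : ℝ} (hx : x ∈ Set.Icc 0 X) :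
    ‖covWord (adAct A) h L (lieTerm r h 0 x) τ‖ ≤ wordNormSum a h 0 L τ := by
  rw [lieTerm_zero, covWord_sum _ hh L hL _ _ _
    (fun i _ => (hh i).of_le (by exact_mod_cast hL))]
  refine (norm_sum_le _ _).trans (Finset.sum_le_sum fun l _ => ?_)
  rw [norm_smul]
  have : ‖∫ y in (0 : ℝ)..x, r l y‖ ≤ |a l| :=
    (intervalIntegral.abs_integral_le_integral_abs hx.1).trans (ha l x hx)
  have e : wordNorm a h 0 L l τ = ‖covWord (adAct A) h L (h l) τ‖ := by simp [wordNorm]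
  rw [e]
  gcongr

/-- The factor 2 has two sources. The operation `h l - i d/dτ` on the first Lie term gives one
commutator factor. The time shift leaves the derivative of `h l`; since `h l` commutes with itself,
this derivative is, up to a factor i, any operation with Hamiltonian `h l` applied to `h l`. By
`hown` the weights of those operations add up to at least 1, so a second commutator factor covers
it. -/
theorem exists_norm_covWord_lieBracket_zero_le
    (hh : ∀ l, ContDiff ℝ M (h l))
    (ha : ∀ l, ∀ x ∈ Set.Icc 0 X, ∫ y in (0 : ℝ)..x, |r l y| ≤ |a l|)
    (hρ : ∀ x ∈ Set.Icc 0 X, |pathTime r x| ≤ 1)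
    (hown : ∀ l, h l = 0 ∨ ∃ s : Finset ι, (∀ k ∈ s, h k = h l) ∧ 1 ≤ ∑ k ∈ s, |a k|)
    (L : List ι) (hM : L.length + 2 ≤ M) (τ : ℝ) :
    ∃ C : ι → ℝ, (∀ l, ∀ x ∈ Set.Icc 0 X,
        ‖covWord (adAct A) h L (lieBracket r h 0 l x) τ‖ ≤ C l) ∧
      ∑ l, |a l| * C l ≤ 2 * wordNormSum a h 1 L τ := by
  refine ⟨fun l => wordNormSum a h 0 (L ++ [l]) τ + wordNorm a h 1 L l τ, ?_, ?_⟩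
  · intro l x hx
    have hl : ∀ l, ContDiff ℝ L.length (h l) := fun l =>
      (hh l).of_le (by exact_mod_cast (by omega))
    have hl' : ∀ l, ContDiff ℝ (L.length + 1 : ℕ) (h l) := fun l =>
      (hh l).of_le (by exact_mod_cast (by omega))
    have hD : ContDiff ℝ L.length (covAct (adAct A) (h l) (lieTerm r h 0 x)) :=
      contDiff_covAct _ (hl l) (contDiff_lieTerm hh r (by omega) x)
    have b1 := norm_covWord_lieTerm_zero_le (r := r) (a := a) hh ha (L ++ [l])
      (by simp; omega) τ hx
    rw [covWord_append] at b1
    have b1' : ‖covWord (adAct A) h L (covAct (adAct A) (h l) (lieTerm r h 0 x)) τ‖ ≤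
      wordNormSum a h 0 (L ++ [l]) τ := b1
    rcases hown l with h0 | ⟨s, hs, hs1⟩
    · have e : lieBracket r h 0 l x = covAct (adAct A) (h l) (lieTerm r h 0 x) := by
        rw [lieBracket_eq_covAct, h0]
        funext τ
        have : deriv (0 : ℝ → A) τ = 0 := by
          rw [show (0 : ℝ → A) = fun _ => 0 from rfl, deriv_const]
        simp [this]
      rw [e]
      linarith [wordNorm_nonneg a h 1 L l τ]
    · obtain ⟨k, hk⟩ : s.Nonempty := by
        rw [Finset.nonempty_iff_ne_empty]; rintro rfl; norm_num at hs1
      have e : lieBracket r h 0 l x = fun τ => covAct (adAct A) (h l) (lieTerm r h 0 x) τ +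
          (-pathTime r x) • covAct (adAct A) (h k) (h l) τ := by
        rw [lieBracket_eq_covAct]
        funext τ
        rw [lieShift, if_pos rfl]
        congr 1
        rw [covAct, hs k hk, adAct_apply]
        simp
      rw [e, covWord_add_smul _ hh L (by omega) _ hD (contDiff_covAct _ (hl k) (hl' l))]
      refine (norm_add_le _ _).trans (add_le_add b1' ?_)
      rw [norm_smul, norm_neg]
      have b2 : ‖covWord (adAct A) h L (covAct (adAct A) (h k) (h l)) τ‖ ≤
          wordNorm a h 1 L l τ := by
        calc ‖covWord (adAct A) h L (covAct (adAct A) (h k) (h l)) τ‖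
            ≤ (∑ k ∈ s, |a k|) * ‖covWord (adAct A) h L (covAct (adAct A) (h k) (h l)) τ‖ :=
              le_mul_of_one_le_left (norm_nonneg _) hs1
          _ = ∑ j ∈ s, |a j| * ‖covWord (adAct A) h (L ++ [j]) (h l) τ‖ := by
              rw [Finset.sum_mul]
              refine Finset.sum_congr rfl fun j hj => ?_
              rw [hs k hk, ← hs j hj, covWord_append]
              rfl
          _ ≤ ∑ j, |a j| * ‖covWord (adAct A) h (L ++ [j]) (h l) τ‖ :=
              Finset.sum_le_sum_of_subset_of_nonneg (Finset.subset_univ _)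
                fun j _ _ => mul_nonneg (abs_nonneg _) (norm_nonneg _)
          _ = wordNorm a h 1 L l τ := by
              rw [wordNorm_succ]; simp [wordNorm]
      calc ‖pathTime r x‖ * ‖covWord (adAct A) h L (covAct (adAct A) (h k) (h l)) τ‖
          ≤ 1 * ‖covWord (adAct A) h L (covAct (adAct A) (h k) (h l)) τ‖ := by
            gcongr; exact hρ x hx
        _ ≤ _ := by rw [one_mul]; exact b2
  · have : ∑ l, |a l| * wordNormSum a h 0 (L ++ [l]) τ = wordNormSum a h 1 L τ :=
      (wordNormSum_succ a h 0 L τ).symm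
    simp only [mul_add, Finset.sum_add_distrib, this]
    rw [two_mul]
    rfl

/-- Mean value inequality along the path, from the start where the Lie term vanishes; each rate
integrates in absolute value to at most `|a l|`. -/
theorem norm_covWord_lieTerm_succ_le (hr : ∀ l, Continuous (r l))
    (hh : ∀ l, ContDiff ℝ M (h l))
    (ha : ∀ l, ∀ x ∈ Set.Icc 0 X, ∫ y in (0 : ℝ)..x, |r l y| ≤ |a l|) (n : ℕ)
    (L : List ι) (hM : L.length + n + 2 ≤ M) (τ : ℝ) {C : ι → ℝ}
    (hC : ∀ l, ∀ x ∈ Set.Icc 0 X, ‖covWord (adAct A) h L (lieBracket r h n l x) τ‖ ≤ C l)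
    {x : ℝ} (hx : x ∈ Set.Icc 0 X) :
    ‖covWord (adAct A) h L (lieTerm r h (n + 1) x) τ‖ ≤ ∑ l, |a l| * C l := by
  have hC0 : ∀ l, 0 ≤ C l := fun l => (norm_nonneg _).trans (hC l x hx)
  have hd := fun x => hasDerivAt_covWord_lieTerm_succ (adAct A) hr hh n L hM x τ
  have h0 : covWord (adAct A) h L (lieTerm r h (n + 1) 0) τ = 0 := by
    have := congrFun (covWord_sum (adAct A) hh L (by omega) (∅ : Finset ι) (fun _ => 0)
      (fun _ _ => 0) (by simp)) τ
    simpa [lieTerm_zero_right] using this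
  have := image_norm_le_of_norm_deriv_right_le_deriv_boundary
    (f := fun x => covWord (adAct A) h L (lieTerm r h (n + 1) x) τ) (a := 0) (b := x)
    (B := fun x => ∑ l, (∫ y in (0 : ℝ)..x, |r l y|) * C l) (B' := fun x => ∑ l, |r l x| * C l)
    (fun y hy => (hd y).continuousAt.continuousWithinAt)
    (fun y hy => (hd y).hasDerivWithinAt)
    (by simp [h0])
    (fun y => HasDerivAt.fun_sum fun l _ => (hasDerivAt_primitive (hr l).abs 0 y).mul_const _)
    (fun y hy => (norm_sum_le _ _).trans (Finset.sum_le_sum fun l _ => by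
      rw [norm_smul]
      exact mul_le_mul_of_nonneg_left (hC l y ⟨hy.1, hy.2.le.trans hx.2⟩) (norm_nonneg _)))
    ⟨hx.1, le_rfl⟩
  exact this.trans (Finset.sum_le_sum fun l _ => mul_le_mul_of_nonneg_right (ha l x hx) (hC0 l))

/-- Above the first level there is no time shift, so a bracket is one more operation on a Lie term,
which is an integral of lower brackets. The constant 2 is inherited from the base case. The bound is
uniform in `x` so that it can be integrated again. -/
theorem exists_norm_covWord_lieBracket_le (hr : ∀ l, Continuous (r l))
    (hh : ∀ l, ContDiff ℝ M (h l))
    (ha : ∀ l, ∀ x ∈ Set.Icc 0 X, ∫ y in (0 : ℝ)..x, |r l y| ≤ |a l|)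
    (hρ : ∀ x ∈ Set.Icc 0 X, |pathTime r x| ≤ 1)
    (hown : ∀ l, h l = 0 ∨ ∃ s : Finset ι, (∀ k ∈ s, h k = h l) ∧ 1 ≤ ∑ k ∈ s, |a k|)
    (n : ℕ) (L : List ι) (hM : L.length + n + 2 ≤ M) (τ : ℝ) :
    ∃ C : ι → ℝ, (∀ l, ∀ x ∈ Set.Icc 0 X,
        ‖covWord (adAct A) h L (lieBracket r h n l x) τ‖ ≤ C l) ∧
      ∑ l, |a l| * C l ≤ 2 * wordNormSum a h (n + 1) L τ := by
  induction n generalizing L with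
  | zero => exact exists_norm_covWord_lieBracket_zero_le hh ha hρ hown L hM τ
  | succ n ih =>
    refine ⟨fun l => 2 * wordNormSum a h (n + 1) (L ++ [l]) τ, ?_, ?_⟩
    · intro l x hx
      obtain ⟨C, hC, hsum⟩ := ih (L ++ [l]) (by simp; omega)
      have := norm_covWord_lieTerm_succ_le hr hh ha n (L ++ [l]) (by simp; omega) τ hC hx
      refine le_trans (le_of_eq ?_) (this.trans hsum)
      rw [lieBracket_eq_covAct, covWord_append]
      simp [lieShift, covWord]
    · rw [wordNormSum_succ a h (n + 1), Finset.mul_sum]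
      exact le_of_eq (Finset.sum_congr rfl fun l _ => by ring)

/-- The commutators of the Hamiltonians with a level of the Lie series are bounded, up to a
common function, by the commutator factor of the same Hamiltonian. -/
theorem exists_norm_lieBracket_le (hr : ∀ l, Continuous (r l))
    (hh : ∀ l, ContDiff ℝ M (h l))
    (ha : ∀ l, ∀ x ∈ Set.Icc 0 X, ∫ y in (0 : ℝ)..x, |r l y| ≤ |a l|)
    (hρ : ∀ x ∈ Set.Icc 0 X, |pathTime r x| ≤ 1)
    (hown : ∀ l, h l = 0 ∨ ∃ s : Finset ι, (∀ k ∈ s, h k = h l) ∧ 1 ≤ ∑ k ∈ s, |a k|)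
    (n : ℕ) (hM : n + 2 ≤ M) (τ : ℝ) {x : ℝ} (hx : x ∈ Set.Icc 0 X) :
    (∑ l, |a l|) * ‖deriv (lieTerm r h n x) τ‖ ≤ 3 * wordNormSum a h (n + 1) [] τ ∧
      ∀ l, ‖lieBracket r h n l x τ‖ ≤
        ‖deriv (lieTerm r h n x) τ‖ + wordNorm a h (n + 1) [] l τ := by
  have hw : ∀ l, ‖∑ κ : Fin (n + 1) → ι, lieCoeff r n κ x •
      covWord (adAct A) h (List.ofFn κ) (h l) τ‖ ≤ wordNorm a h (n + 1) [] l τ := by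
    intro l
    refine (norm_sum_le _ _).trans (Finset.sum_le_sum fun κ _ => ?_)
    rw [norm_smul, List.nil_append]
    refine mul_le_mul_of_nonneg_right ?_ (norm_nonneg _)
    refine (abs_lieCoeff_le hr n κ hx.1).trans ?_
    exact Finset.prod_le_prod (fun i _ => integral_abs_nonneg _ hx.1) fun i _ => ha _ x hx
  constructor
  · obtain ⟨C, hC, hsum⟩ := exists_norm_covWord_lieBracket_le hr hh ha hρ hown n []
      (by simpa using hM) τ
    -- The derivative of the Lie term is independent of `l`, so `lieBracket_eq` bounds it once for
    -- each `l`. Averaging with weights `|a l|` gives 3 = 2 + 1: two from the brackets, one from the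
    -- words.
    have h1 : ∀ l, ‖deriv (lieTerm r h n x) τ‖ ≤ C l + wordNorm a h (n + 1) [] l τ := by
      intro l
      have e := lieBracket_eq hr hh n hM l x τ
      have e' : Complex.I • deriv (lieTerm r h n x) τ = -lieBracket r h n l x τ -
          ∑ κ : Fin (n + 1) → ι, lieCoeff r n κ x •
            covWord (adAct A) h (List.ofFn κ) (h l) τ := by
        rw [e]; abel
      have e2 : ‖Complex.I • deriv (lieTerm r h n x) τ‖ = ‖deriv (lieTerm r h n x) τ‖ := by
        rw [norm_smul]; simp
      rw [← e2, e']
      refine (norm_sub_le _ _).trans ?_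
      rw [norm_neg]
      exact add_le_add (hC l x hx) (hw l)
    calc (∑ l, |a l|) * ‖deriv (lieTerm r h n x) τ‖
        = ∑ l, |a l| * ‖deriv (lieTerm r h n x) τ‖ := Finset.sum_mul _ _ _
      _ ≤ ∑ l, |a l| * (C l + wordNorm a h (n + 1) [] l τ) :=
          Finset.sum_le_sum fun l _ => mul_le_mul_of_nonneg_left (h1 l) (abs_nonneg _)
      _ = ∑ l, |a l| * C l + wordNormSum a h (n + 1) [] τ := by
          simp only [mul_add, Finset.sum_add_distrib]; rfl
      _ ≤ _ := by linarith
  · intro l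
    rw [lieBracket_eq hr hh n hM l x τ]
    refine (norm_sub_le _ _).trans (add_le_add (le_of_eq ?_) (hw l))
    rw [norm_neg, norm_smul]; simp

end Bounds

/-! ### Evolution along a path, its generator in the time scale, and the remainder of the Lie
series. -/

section PathEvolution

variable {E : Type*} [NormedAddCommGroup E] [InnerProductSpace ℂ E] {ι : Type*} [Fintype ι]

/-- The Hamiltonian of the path with rates `r`, run through on the time scale `s`. -/
def pathHam (r : ι → ℝ → ℝ) (h : ι → ℝ → Op E) (s x : ℝ) : Op E :=
  ∑ l, r l x • s • h l (s * pathTime r x)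

/-- The derivative of `pathHam` with respect to the time scale. -/
def pathSource (r : ι → ℝ → ℝ) (h : ι → ℝ → Op E) (s x : ℝ) : Op E :=
  ∑ l, r l x • (h l (s * pathTime r x) + (s * pathTime r x) • deriv (h l) (s * pathTime r x))

variable {r : ι → ℝ → ℝ} {h : ι → ℝ → Op E}

theorem hasDerivAt_pathTime (hr : ∀ l, Continuous (r l)) (x : ℝ) :
    HasDerivAt (pathTime r) (∑ l, r l x) x :=
  HasDerivAt.fun_sum fun l _ => hasDerivAt_primitive (hr l) 0 x

theorem continuous_pathTime (hr : ∀ l, Continuous (r l)) : Continuous (pathTime r) :=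
  continuous_iff_continuousAt.2 fun x => (hasDerivAt_pathTime hr x).continuousAt

theorem continuous_pathHam (hr : ∀ l, Continuous (r l)) (hh : ∀ l, Continuous (h l)) (s : ℝ) :
    Continuous (pathHam r h s) := by
  have := continuous_pathTime hr
  unfold pathHam
  fun_prop

theorem continuous_pathSource (hr : ∀ l, Continuous (r l)) (hh : ∀ l, ContDiff ℝ (1 : ℕ) (h l)) :
    Continuous fun q : ℝ × ℝ => pathSource r h q.1 q.2 := by
  have := continuous_pathTime hr
  have h1 : ∀ l, Continuous (h l) := fun l => (hh l).continuous
  have h2 : ∀ l, Continuous (deriv (h l)) := fun l => (hh l).continuous_deriv (by simp)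
  unfold pathSource
  fun_prop

theorem hasDerivAt_pathHam (hh : ∀ l, ContDiff ℝ (1 : ℕ) (h l)) (s x : ℝ) :
    HasDerivAt (fun s => pathHam r h s x) (pathSource r h s x) s := by
  refine HasDerivAt.fun_sum fun l _ => ?_
  have h1 : HasDerivAt (fun s => h l (s * pathTime r x))
      (pathTime r x • deriv (h l) (s * pathTime r x)) s := by
    have := ((hh l).differentiable (by simp) (s * pathTime r x)).hasDerivAt
    refine (this.scomp s ((hasDerivAt_id s).mul_const (pathTime r x))).congr_deriv ?_
    rw [one_mul]
  refine (((hasDerivAt_id s).smul h1).fun_const_smul (r l x)).congr_deriv ?_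
  simp [mul_smul, add_comm]

theorem isSelfAdjoint_pathHam [CompleteSpace E] (hsa : ∀ l τ, IsSelfAdjoint (h l τ)) (s x : ℝ) :
    IsSelfAdjoint (pathHam r h s x) := by
  refine isSelfAdjoint_sum _ fun l _ => ?_
  exact (IsSelfAdjoint.all (r l x)).smul ((IsSelfAdjoint.all s).smul (hsa l _))

/-- This Lipschitz bound in the time scale, uniform along the path, dominates the difference
quotients when the evolution is differentiated in the scale. -/
theorem exists_norm_pathHam_sub_le (hr : ∀ l, Continuous (r l))
    (hh : ∀ l, ContDiff ℝ (1 : ℕ) (h l)) (s X : ℝ) :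
    ∃ C, 0 ≤ C ∧ ∀ s' ∈ Metric.ball s 1, ∀ x ∈ Set.Icc 0 X,
      ‖pathHam r h s' x - pathHam r h s x‖ ≤ C * |s' - s| := by
  obtain ⟨C, hC⟩ := (isCompact_closedBall s 1 |>.prod (isCompact_Icc (a := 0) (b := X))
    ).exists_bound_of_continuousOn (continuous_pathSource hr hh).continuousOn
  refine ⟨max C 0, le_max_right _ _, fun s' hs' x hx => ?_⟩
  exact (convex_ball s 1).norm_image_sub_le_of_norm_hasDerivWithin_le
    (f := fun s => pathHam r h s x) (C := max C 0)
    (fun u _ => (hasDerivAt_pathHam hh u x).hasDerivWithinAt)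
    (fun u hu => (hC (u, x) ⟨Metric.ball_subset_closedBall hu, hx⟩).trans (le_max_left _ _))
    (Metric.mem_ball_self one_pos) hs'

/-- The rate along the path of a level of the Lie series. -/
def lieRate (r : ι → ℝ → ℝ) (h : ι → ℝ → Op E) : ℕ → ℝ → ℝ → Op E
  | 0, x, τ => ∑ l, r l x • h l τ
  | n + 1, x, τ => ∑ l, r l x • lieBracket r h n l x τ

/-- In this form the derivative term can cancel the drift that arises when a Lie term is evaluated
at the moving time `s * pathTime r x`. -/
theorem lieRate_succ (r : ι → ℝ → ℝ) (h : ι → ℝ → Op E) (n : ℕ) (x τ : ℝ) :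
    lieRate r h (n + 1) x τ = (∑ l, r l x • h l τ) * lieTerm r h n x τ -
      lieTerm r h n x τ * (∑ l, r l x • h l τ) -
        (∑ l, r l x) • Complex.I • deriv (lieTerm r h n x) τ +
          lieShift r n x • Complex.I • ∑ l, r l x • deriv (h l) τ := by
  simp only [lieRate, lieBracket, smul_add, smul_sub, Finset.sum_add_distrib,
    Finset.sum_sub_distrib, Finset.sum_mul, Finset.mul_sum, Finset.sum_smul, Finset.smul_sum,
    smul_mul_assoc, mul_smul_comm]
  congr 1
  refine Finset.sum_congr rfl fun l _ => ?_
  rw [smul_comm (r l x), smul_comm (r l x) Complex.I]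

/-- The derivative along the path of a level of the Lie series at the time reached. -/
theorem hasDerivAt_lieTerm_pathTime (hr : ∀ l, Continuous (r l)) {M : ℕ}
    (hh : ∀ l, ContDiff ℝ M (h l)) (n : ℕ) (hM : n + 2 ≤ M) (s x : ℝ) :
    HasDerivAt (fun x => lieTerm r h n x (s * pathTime r x))
      (lieRate r h n x (s * pathTime r x) +
        (s * ∑ l, r l x) • deriv (lieTerm r h n x) (s * pathTime r x)) x := by
  set w : (Fin (n + 1) → ι) → ℝ → Op E := fun κ =>
    covWord (ContinuousLinearMap.mul ℂ (Op E)) h (List.ofFn κ) 1 with hw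
  have hwc : ∀ κ τ, HasDerivAt (w κ) (deriv (w κ) τ) τ := fun κ τ => by
    have : ContDiff ℝ (1 : ℕ) (w κ) := contDiff_covWord _ hh _
      (by rw [List.length_ofFn]; omega) contDiff_const
    exact (this.differentiable (by simp) τ).hasDerivAt
  have hcoeff : ∀ κ : Fin (n + 1) → ι, ∃ e', HasDerivAt (lieCoeff r n κ) e' x := fun κ => by
    cases n with
    | zero => exact ⟨_, hasDerivAt_lieCoeff_zero hr κ x⟩
    | succ n => exact ⟨_, hasDerivAt_lieCoeff_succ hr n κ x⟩
  choose e' he' using hcoeff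
  have hz : HasDerivAt (fun x => s * pathTime r x) (s * ∑ l, r l x) x :=
    (hasDerivAt_pathTime hr x).const_mul s
  have h1 := HasDerivAt.fun_sum (u := Finset.univ) fun (κ : Fin (n + 1) → ι) _ =>
    (he' κ).smul ((hwc κ (s * pathTime r x)).scomp x hz)
  have h2 : ∀ τ, HasDerivAt (lieTerm r h n x) (∑ κ : Fin (n + 1) → ι,
      lieCoeff r n κ x • deriv (w κ) τ) τ := fun τ =>
    HasDerivAt.fun_sum fun κ _ => (hwc κ τ).const_smul (lieCoeff r n κ x)
  have h3 : ∀ τ, ∑ κ : Fin (n + 1) → ι, e' κ • w κ τ = lieRate r h n x τ := fun τ => by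
    have h4 : HasDerivAt (fun x => lieTerm r h n x τ) (∑ κ : Fin (n + 1) → ι, e' κ • w κ τ) x :=
      HasDerivAt.fun_sum fun κ _ => (he' κ).smul_const _
    refine h4.unique ?_
    cases n with
    | zero =>
      simp only [lieTerm_zero]
      exact HasDerivAt.fun_sum fun l _ => (hasDerivAt_primitive (hr l) 0 x).smul_const _
    | succ n => exact hasDerivAt_lieTerm_succ hr hh n (by omega) x τ
  refine h1.congr_deriv ?_
  rw [(h2 _).deriv, ← h3, Finset.smul_sum, ← Finset.sum_add_distrib]
  refine Finset.sum_congr rfl fun κ _ => ?_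
  rw [add_comm, smul_comm]
  rfl

/-- The evolution along the path on the time scale `s`. -/
def pathEvol (r : ι → ℝ → ℝ) (h : ι → ℝ → Op E) (s x : ℝ) : Op E := evol (pathHam r h s) x 0

variable [CompleteSpace E]

/-- The generator of `pathEvol` with respect to the time scale. -/
def pathGen (r : ι → ℝ → ℝ) (h : ι → ℝ → Op E) (s x : ℝ) : Op E :=
  pathEvol r h s x *
    (∫ y in (0 : ℝ)..x, star (pathEvol r h s y) * (pathSource r h s y * pathEvol r h s y)) *
      star (pathEvol r h s x)

theorem continuous_pathEvol (hr : ∀ l, Continuous (r l)) (hh : ∀ l, Continuous (h l)) (s : ℝ) :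
    Continuous (pathEvol r h s) := continuous_evol (continuous_pathHam hr hh s) 0

theorem pathGen_zero (s : ℝ) : pathGen r h s 0 = 0 := by simp [pathGen]

/-- The remainder of the generator after `p` levels of the Lie series. -/
def pathRemainder (r : ι → ℝ → ℝ) (h : ι → ℝ → Op E) (p : ℕ) (s x : ℝ) : Op E :=
  pathGen r h s x - ∑ n ∈ Finset.range p,
    ((-Complex.I) * s) ^ n • lieTerm r h n x (s * pathTime r x)

theorem pathRemainder_zero (p : ℕ) (s : ℝ) : pathRemainder r h p s 0 = 0 := by
  simp [pathRemainder, pathGen_zero, lieTerm_zero_right]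

/-- Duhamel's formula comparing two time scales. -/
theorem star_pathEvol_mul_sub_one (hr : ∀ l, Continuous (r l))
    (hh : ∀ l, ContDiff ℝ (1 : ℕ) (h l))
    (hsa : ∀ l τ, IsSelfAdjoint (h l τ)) (s s' x : ℝ) :
    star (pathEvol r h s x) * pathEvol r h s' x - 1 =
      ∫ y in (0 : ℝ)..x, star (pathEvol r h s y) *
        ((-Complex.I) • ((pathHam r h s' y - pathHam r h s y) * pathEvol r h s' y)) := by
  have hc := fun s => continuous_pathHam hr (fun l => (hh l).continuous) s
  have hWc := fun s => continuous_pathEvol hr (fun l => (hh l).continuous) s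
  have hd : ∀ y, HasDerivAt (fun x => star (pathEvol r h s x) * pathEvol r h s' x)
      (star (pathEvol r h s y) *
        ((-Complex.I) • ((pathHam r h s' y - pathHam r h s y) * pathEvol r h s' y))) y := by
    intro y
    refine hasDerivAt_star_evol_mul (hc s) 0 (isSelfAdjoint_pathHam hsa s y) ?_
    refine (hasDerivAt_evol (hc s') 0 y).congr_deriv ?_
    rw [sub_mul, smul_sub, add_sub_cancel]
    rfl
  rw [intervalIntegral.integral_eq_sub_of_hasDerivAt (fun y _ => hd y)]
  · simp [pathEvol, evol_self]
  · have := hc s; have := hc s'; have := hWc s; have := hWc s'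
    exact Continuous.intervalIntegrable (by fun_prop) _ _

theorem norm_pathEvol_le (hr : ∀ l, Continuous (r l))
    (hh : ∀ l, ContDiff ℝ (1 : ℕ) (h l))
    (hsa : ∀ l τ, IsSelfAdjoint (h l τ)) (s x : ℝ) : ‖pathEvol r h s x‖ ≤ 1 :=
  norm_evol_le (continuous_pathHam hr (fun l => (hh l).continuous) s)
    (isSelfAdjoint_pathHam hsa s) 0 x

theorem norm_star_pathEvol_mul_le (hr : ∀ l, Continuous (r l))
    (hh : ∀ l, ContDiff ℝ (1 : ℕ) (h l))
    (hsa : ∀ l τ, IsSelfAdjoint (h l τ)) (s s' x : ℝ) (B : Op E) :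
    ‖star (pathEvol r h s x) * ((-Complex.I) • (B * pathEvol r h s' x))‖ ≤ ‖B‖ := by
  have h1 := norm_pathEvol_le hr hh hsa s x
  have h2 := norm_pathEvol_le hr hh hsa s' x
  calc _ ≤ ‖star (pathEvol r h s x)‖ * ‖(-Complex.I) • (B * pathEvol r h s' x)‖ :=
        norm_mul_le _ _
    _ = ‖pathEvol r h s x‖ * ‖B * pathEvol r h s' x‖ := by rw [norm_star, norm_smul]; simp
    _ ≤ 1 * (‖B‖ * 1) := by
        gcongr
        exact (norm_mul_le _ _).trans (by gcongr)
    _ = ‖B‖ := by ring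

variable [FiniteDimensional ℂ E]

theorem hasDerivAt_pathGen (hr : ∀ l, Continuous (r l)) (hh : ∀ l, ContDiff ℝ (1 : ℕ) (h l))
    (hsa : ∀ l τ, IsSelfAdjoint (h l τ)) (s x : ℝ) :
    HasDerivAt (pathGen r h s) ((-Complex.I) • (pathHam r h s x * pathGen r h s x -
      pathGen r h s x * pathHam r h s x) + pathSource r h s x) x := by
  have hc := continuous_pathHam hr (fun l => (hh l).continuous) s
  have hW := hasDerivAt_evol hc 0 x
  have hWc := continuous_pathEvol hr (fun l => (hh l).continuous) s
  have hQ : Continuous (pathSource r h s) :=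
    (continuous_pathSource hr hh).comp (continuous_const.prodMk continuous_id)
  have hI := hasDerivAt_primitive (f := fun y => star (pathEvol r h s y) *
    (pathSource r h s y * pathEvol r h s y)) (by fun_prop) 0 x
  have e : pathEvol r h s x * star (pathEvol r h s x) = 1 :=
    evol_mul_star_evol hc (isSelfAdjoint_pathHam hsa s) 0 x
  refine ((hW.mul hI).mul hW.star).congr_deriv ?_
  rw [star_smul, star_mul, (isSelfAdjoint_pathHam hsa s x).star_eq]
  change ((-Complex.I) • (pathHam r h s x * pathEvol r h s x) * _ +
    pathEvol r h s x * (star (pathEvol r h s x) * (pathSource r h s x * pathEvol r h s x))) *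
      star (pathEvol r h s x) + (pathEvol r h s x * _) *
        (star (-Complex.I) • (star (pathEvol r h s x) * pathHam r h s x)) = _
  have e2 : pathEvol r h s x * (star (pathEvol r h s x) * (pathSource r h s x *
      pathEvol r h s x)) * star (pathEvol r h s x) = pathSource r h s x := by
    rw [← mul_assoc, e, one_mul, mul_assoc, e, mul_one]
  rw [add_mul, e2, pathGen]
  simp only [star_neg, Complex.star_def, Complex.conj_I, neg_neg, mul_smul_comm,
    smul_mul_assoc, neg_smul, neg_mul, mul_assoc, smul_sub]
  abel

theorem tendsto_pathEvol (hr : ∀ l, Continuous (r l)) (hh : ∀ l, ContDiff ℝ (1 : ℕ) (h l))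
    (hsa : ∀ l τ, IsSelfAdjoint (h l τ)) (s : ℝ) {x : ℝ} (hx : 0 ≤ x) :
    Filter.Tendsto (fun s' => pathEvol r h s' x) (𝓝 s) (𝓝 (pathEvol r h s x)) := by
  obtain ⟨C, hC0, hC⟩ := exists_norm_pathHam_sub_le hr hh s x
  have h1 : Filter.Tendsto (fun s' => star (pathEvol r h s x) * pathEvol r h s' x - 1) (𝓝 s)
      (𝓝 0) := by
    refine squeeze_zero_norm' (a := fun s' => C * |s' - s| * |x - 0|) ?_ ?_
    · filter_upwards [Metric.ball_mem_nhds s one_pos] with s' hs'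
      rw [star_pathEvol_mul_sub_one hr hh hsa]
      refine intervalIntegral.norm_integral_le_of_norm_le_const fun y hy => ?_
      rw [Set.uIoc_of_le hx] at hy
      exact (norm_star_pathEvol_mul_le hr hh hsa s s' y _).trans (hC s' hs' y ⟨hy.1.le, hy.2⟩)
    · have : Continuous fun s' => C * |s' - s| * |x - 0| := by fun_prop
      simpa using this.tendsto s
  have h2 := ((h1.add_const 1).const_mul (pathEvol r h s x))
  simp only [sub_add_cancel, zero_add, mul_one, ← mul_assoc] at h2
  have e : pathEvol r h s x * star (pathEvol r h s x) = 1 :=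
    evol_mul_star_evol (continuous_pathHam hr (fun l => (hh l).continuous) s)
      (isSelfAdjoint_pathHam hsa s) 0 x
  simpa only [e, one_mul] using h2

/-- The dependence of the evolution along a path on the time scale. -/
theorem hasDerivAt_pathEvol_scale (hr : ∀ l, Continuous (r l))
    (hh : ∀ l, ContDiff ℝ (1 : ℕ) (h l))
    (hsa : ∀ l τ, IsSelfAdjoint (h l τ)) (s : ℝ) {x : ℝ} (hx : 0 ≤ x) :
    HasDerivAt (fun s => pathEvol r h s x)
      ((-Complex.I) • (pathGen r h s x * pathEvol r h s x)) s := by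
  obtain ⟨C, hC0, hC⟩ := exists_norm_pathHam_sub_le hr hh s x
  have hcG := fun s => continuous_pathHam hr (fun l => (hh l).continuous) s
  have hWc := fun s => continuous_pathEvol hr (fun l => (hh l).continuous) s
  have e : pathEvol r h s x * star (pathEvol r h s x) = 1 :=
    evol_mul_star_evol (hcG s) (isSelfAdjoint_pathHam hsa s) 0 x
  have e' : star (pathEvol r h s x) * pathEvol r h s x = 1 :=
    star_evol_mul_evol (hcG s) (isSelfAdjoint_pathHam hsa s) 0 x
  have hsl : HasDerivAt (fun s' => star (pathEvol r h s x) * pathEvol r h s' x)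
      (∫ y in (0 : ℝ)..x, star (pathEvol r h s y) *
        ((-Complex.I) • (pathSource r h s y * pathEvol r h s y))) s := by
    rw [hasDerivAt_iff_tendsto_slope]
    -- By Duhamel's formula the difference quotient is an integral of difference quotients of the
    -- Hamiltonian, to which dominated convergence applies.
    have h1 : ∀ s', slope (fun s' => star (pathEvol r h s x) * pathEvol r h s' x) s s' =
        ∫ y in (0 : ℝ)..x, star (pathEvol r h s y) *
          ((-Complex.I) • (slope (fun s => pathHam r h s y) s s' * pathEvol r h s' y)) := by
      intro s'
      rw [slope_def_module, e', star_pathEvol_mul_sub_one hr hh hsa,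
        ← intervalIntegral.integral_smul]
      refine intervalIntegral.integral_congr fun y _ => ?_
      simp only [slope_def_module, smul_mul_assoc, mul_smul_comm]
      rw [smul_comm]
    refine Filter.Tendsto.congr (fun s' => (h1 s').symm) ?_
    refine intervalIntegral.tendsto_integral_filter_of_dominated_convergence (fun _ => C) ?_ ?_ ?_ ?_
    · refine Filter.Eventually.of_forall fun s' => ?_
      have := hcG s; have := hcG s'; have := hWc s; have := hWc s'
      simp only [slope_def_module]
      exact Continuous.aestronglyMeasurable (by fun_prop)
    · filter_upwards [nhdsWithin_le_nhds (Metric.ball_mem_nhds s one_pos), self_mem_nhdsWithin]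
        with s' hs' hne
      refine Filter.Eventually.of_forall fun y hy => ?_
      rw [Set.uIoc_of_le hx] at hy
      refine (norm_star_pathEvol_mul_le hr hh hsa s s' y _).trans ?_
      have hpos : 0 < |s' - s| := abs_pos.2 (sub_ne_zero.2 hne)
      rw [slope_def_module, norm_smul, norm_inv, Real.norm_eq_abs, inv_mul_le_iff₀ hpos, mul_comm]
      exact hC s' hs' y ⟨hy.1.le, hy.2⟩
    · exact intervalIntegrable_const
    · refine Filter.Eventually.of_forall fun y hy => ?_
      rw [Set.uIoc_of_le hx] at hy
      have t1 := hasDerivAt_iff_tendsto_slope.1 (hasDerivAt_pathHam (r := r) hh s y)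
      have t2 := (tendsto_pathEvol hr hh hsa s hy.1.le).mono_left
        (nhdsWithin_le_nhds (s := {s}ᶜ))
      exact ((t1.mul t2).const_smul (-Complex.I)).const_mul _
  have h2 := hsl.const_mul (pathEvol r h s x)
  simp only [← mul_assoc, e, one_mul] at h2
  refine h2.congr_deriv ?_
  rw [pathGen]
  simp only [mul_assoc, e', mul_one, mul_smul_comm, intervalIntegral.integral_smul]

/-- The Lie series solves the equation of the generator level by level, so truncation leaves only
the first omitted rate as a source. -/
theorem hasDerivAt_pathRemainder (hr : ∀ l, Continuous (r l)) {M : ℕ}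
    (hh : ∀ l, ContDiff ℝ M (h l)) (hsa : ∀ l τ, IsSelfAdjoint (h l τ)) (p : ℕ)
    (hM : p + 2 ≤ M) (s x : ℝ) :
    HasDerivAt (pathRemainder r h (p + 1) s)
      ((-Complex.I) • (pathHam r h s x * pathRemainder r h (p + 1) s x -
        pathRemainder r h (p + 1) s x * pathHam r h s x) +
          ((-Complex.I) * s) ^ (p + 1) • lieRate r h (p + 1) x (s * pathTime r x)) x := by
  have hh1 : ∀ l, ContDiff ℝ (1 : ℕ) (h l) := fun l =>
    (hh l).of_le (by exact_mod_cast (by omega))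
  have hz : ∀ n ∈ Finset.range (p + 1), HasDerivAt
      (fun x => ((-Complex.I) * s) ^ n • lieTerm r h n x (s * pathTime r x))
      (((-Complex.I) * s) ^ n • (lieRate r h n x (s * pathTime r x) +
        (s * ∑ l, r l x) • deriv (lieTerm r h n x) (s * pathTime r x))) x := fun n hn =>
    (hasDerivAt_lieTerm_pathTime hr hh n (by simp at hn; omega) s x).fun_const_smul _
  refine ((hasDerivAt_pathGen hr hh1 hsa s x).sub (HasDerivAt.fun_sum hz)).congr_deriv ?_
  set z := s * pathTime r x with hzdef
  set K := ∑ l, r l x • h l z with hK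
  have hG : pathHam r h s x = (s : ℂ) • K := by
    rw [pathHam, hK, Complex.coe_smul, Finset.smul_sum]
    exact Finset.sum_congr rfl fun l _ => smul_comm _ _ _
  have hQ : pathSource r h s x = lieRate r h 0 x z + (z : ℂ) • ∑ l, r l x • deriv (h l) z := by
    rw [pathSource, lieRate, Complex.coe_smul, Finset.smul_sum, ← Finset.sum_add_distrib]
    refine Finset.sum_congr rfl fun l _ => ?_
    rw [smul_add, smul_comm z]
  set c := (-Complex.I) * (s : ℂ) with hc
  -- Since `c * I = s`, the drift of the moving time cancels the derivative term in the next rate.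
  -- What remains telescopes over `n`, apart from the commutator and, at level 0, the part of the
  -- source containing derivatives of the Hamiltonians.
  have hterm : ∀ n, c ^ n • (lieRate r h n x z +
      (s * ∑ l, r l x) • deriv (lieTerm r h n x) z) =
      c ^ n • lieRate r h n x z - c ^ (n + 1) • lieRate r h (n + 1) x z +
        c • (K * (c ^ n • lieTerm r h n x z) - (c ^ n • lieTerm r h n x z) * K) +
          (if n = 0 then (z : ℂ) • ∑ l, r l x • deriv (h l) z else 0) := by
    intro n
    rw [lieRate_succ, ← hK, pow_succ]
    have e1 : ∀ B : Op E, c • (∑ l, r l x) • Complex.I • B = ((s * ∑ l, r l x : ℝ) : ℂ) • B := by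
      intro B
      rw [← Complex.coe_smul, smul_smul, smul_smul]
      congr 1
      rw [hc]; push_cast
      linear_combination (-(s : ℂ) * ∑ l, (r l x : ℂ)) * Complex.I_mul_I
    have e2 : c ^ n • c • lieShift r n x • Complex.I • (∑ l, r l x • deriv (h l) z) =
        if n = 0 then (z : ℂ) • ∑ l, r l x • deriv (h l) z else 0 := by
      by_cases hn : n = 0
      · subst hn
        rw [lieShift, if_pos rfl, if_pos rfl, pow_zero, one_smul, ← Complex.coe_smul (pathTime r x),
          smul_smul, smul_smul]
        congr 1
        rw [hc, hzdef]; push_cast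
        linear_combination (-(s : ℂ) * pathTime r x) * Complex.I_mul_I
      · simp [lieShift, hn]
    rw [← e2, ← Complex.coe_smul, ← e1]
    simp only [mul_smul, smul_add, smul_sub, mul_smul_comm, smul_mul_assoc]
    simp only [smul_comm c (c ^ n)]
    abel
  rw [Finset.sum_congr rfl fun n _ => hterm n]
  simp only [Finset.sum_add_distrib, Finset.sum_range_sub', pow_zero, one_smul]
  rw [Finset.sum_ite_eq' (Finset.range (p + 1)) 0, if_pos (by simp), ← Finset.smul_sum,
    Finset.sum_sub_distrib, ← Finset.mul_sum, ← Finset.sum_mul, hQ, hG, pathRemainder]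
  have e3 : ∀ B : Op E, c • B = (-Complex.I) • (s : ℂ) • B := fun B => by rw [hc, mul_smul]
  rw [e3, ← hzdef]
  simp only [smul_mul_assoc, mul_smul_comm, smul_sub, mul_sub, sub_mul]
  abel

theorem norm_pathRemainder_le (hr : ∀ l, Continuous (r l)) {M : ℕ}
    (hh : ∀ l, ContDiff ℝ M (h l)) (hsa : ∀ l τ, IsSelfAdjoint (h l τ)) (p : ℕ)
    (hM : p + 2 ≤ M) {s X : ℝ} (hs : 0 ≤ s) (hX : 0 ≤ X) {φ : ℝ → ℝ} (hφ : Continuous φ)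
    (hle : ∀ x ∈ Set.Icc 0 X, ∑ l, |r l x| * ‖lieBracket r h p l x (s * pathTime r x)‖ ≤ φ x) :
    ‖pathRemainder r h (p + 1) s X‖ ≤ s ^ (p + 1) * ∫ x in (0 : ℝ)..X, φ x := by
  rw [← intervalIntegral.integral_const_mul]
  refine norm_le_integral_of_commutator_ode
    (continuous_pathHam hr (fun l => (hh l).continuous) s) (isSelfAdjoint_pathHam hsa s) hX
    (hφ.const_mul _) ?_ (pathRemainder_zero _ _) (hasDerivAt_pathRemainder hr hh hsa p hM s)
  intro x hx
  rw [norm_smul, norm_pow, norm_mul, norm_neg, Complex.norm_I, one_mul, Complex.norm_real,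
    Real.norm_of_nonneg hs]
  refine mul_le_mul_of_nonneg_left (le_trans ?_ (hle x hx)) (by positivity)
  refine (norm_sum_le _ _).trans (le_of_eq (Finset.sum_congr rfl fun l _ => ?_))
  rw [norm_smul, Real.norm_eq_abs]

end PathEvolution

/-! ### Small time scales: the order condition for constant Hamiltonians. -/

section SmallTimes

/-- Integrating `D' ~ s^m C` from 0 gives `D ~ s^(m+1) C / (m+1)`, which is compatible with `D =
O(s^(m+2))` only if `C = 0`. -/
theorem eq_zero_of_tendsto_of_isBigO {F : Type*} [NormedAddCommGroup F] [NormedSpace ℝ F]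
    {D D' : ℝ → F} {m : ℕ} {C : F} (hD : ∀ s, HasDerivAt D (D' s) s) (h0 : D 0 = 0)
    (hC : Filter.Tendsto (fun s : ℝ => (s ^ m)⁻¹ • D' s) (𝓝[>] 0) (𝓝 C))
    (hO : D =O[𝓝[>] 0] fun s : ℝ => s ^ (m + 2)) : C = 0 := by
  obtain ⟨K, hK⟩ := hO.bound
  have key : ∀ ε > 0, ‖C‖ ≤ ε := by
    intro ε hε
    have h1 : ∀ᶠ s in 𝓝[>] (0 : ℝ), ‖(s ^ m)⁻¹ • D' s - C‖ ≤ ε / 2 := by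
      filter_upwards [Metric.tendsto_nhds.1 hC (ε / 2) (by positivity)] with s hs
      rw [dist_eq_norm] at hs; exact hs.le
    obtain ⟨δ, hδ, hδ'⟩ := mem_nhdsGT_iff_exists_Ioc_subset.1 h1
    have hδ0 : (0 : ℝ) < δ := hδ
    have h2 : ∀ᶠ s in 𝓝[>] (0 : ℝ), s ≤ δ := by
      filter_upwards [Ioc_mem_nhdsGT hδ0] with s hs using hs.2
    have h3 : ∀ᶠ s in 𝓝[>] (0 : ℝ), K * s * (m + 1) ≤ ε / 2 := by
      have : Filter.Tendsto (fun s : ℝ => K * s * (m + 1)) (𝓝 0) (𝓝 0) := by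
        have h : Continuous fun s : ℝ => K * s * (m + 1) := by fun_prop
        simpa using h.tendsto 0
      filter_upwards [(this.mono_left nhdsWithin_le_nhds).eventually_lt_const
        (by positivity : (0 : ℝ) < ε / 2)] with s hs using hs.le
    obtain ⟨s, hsK, hsδ, hs3, hs0⟩ :=
      (hK.and (h2.and (h3.and self_mem_nhdsWithin))).exists
    have hs0 : (0 : ℝ) < s := hs0
    have hp : ∀ u : ℝ, HasDerivAt (fun u : ℝ => u ^ (m + 1) / (m + 1)) (u ^ m) u := by
      intro u
      refine ((hasDerivAt_pow (m + 1) u).div_const _).congr_deriv ?_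
      have : (m : ℝ) + 1 ≠ 0 := by positivity
      rw [Nat.add_sub_cancel]
      push_cast
      field_simp
    have hg : ∀ u, HasDerivAt (fun u : ℝ => D u - (u ^ (m + 1) / (m + 1)) • C)
        (D' u - u ^ m • C) u := fun u => (hD u).sub ((hp u).smul_const C)
    have hle : ∀ u ∈ Set.Ioc 0 s, ‖D' u - u ^ m • C‖ ≤ ε / 2 * u ^ m := by
      intro u hu
      have hum : 0 < u ^ m := pow_pos hu.1 m
      have h4 : ‖(u ^ m)⁻¹ • D' u - C‖ ≤ ε / 2 := hδ' ⟨hu.1, hu.2.trans hsδ⟩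
      have e : D' u - u ^ m • C = u ^ m • ((u ^ m)⁻¹ • D' u - C) := by
        rw [smul_sub, smul_smul, mul_inv_cancel₀ hum.ne', one_smul]
      rw [e, norm_smul, Real.norm_of_nonneg hum.le, mul_comm]
      gcongr
    have hB : ∀ u : ℝ, HasDerivAt (fun u : ℝ => ε / 2 * (u ^ (m + 1) / (m + 1)))
        (ε / 2 * u ^ m) u := fun u => (hp u).const_mul _
    have hbound : ∀ a ∈ Set.Ioc 0 s,
        ‖(D s - (s ^ (m + 1) / (m + 1)) • C) - (D a - (a ^ (m + 1) / (m + 1)) • C)‖ ≤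
          ε / 2 * (s ^ (m + 1) / (m + 1)) - ε / 2 * (a ^ (m + 1) / (m + 1)) := by
      intro a ha
      exact image_norm_le_of_norm_deriv_right_le_deriv_boundary
        (f := fun u => (D u - (u ^ (m + 1) / (m + 1)) • C) - (D a - (a ^ (m + 1) / (m + 1)) • C))
        (a := a) (b := s)
        (B := fun u => ε / 2 * (u ^ (m + 1) / (m + 1)) - ε / 2 * (a ^ (m + 1) / (m + 1)))
        (fun u _ => ((hg u).sub_const _).continuousAt.continuousWithinAt)
        (fun u _ => ((hg u).sub_const _).hasDerivWithinAt) (by simp)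
        (fun u => (hB u).sub_const _)
        (fun u hu => hle u ⟨ha.1.trans_le hu.1, hu.2.le⟩) ⟨ha.2, le_rfl⟩
    have hlim : ‖D s - (s ^ (m + 1) / (m + 1)) • C‖ ≤ ε / 2 * (s ^ (m + 1) / (m + 1)) := by
      have t1 : Filter.Tendsto (fun a => ‖(D s - (s ^ (m + 1) / (m + 1)) • C) -
          (D a - (a ^ (m + 1) / (m + 1)) • C)‖) (𝓝[>] 0)
          (𝓝 ‖D s - (s ^ (m + 1) / (m + 1)) • C‖) := by
        have := ((hg 0).continuousAt.tendsto.const_sub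
          (D s - (s ^ (m + 1) / (m + 1)) • C)).norm.mono_left
            (nhdsWithin_le_nhds (s := Set.Ioi (0 : ℝ)))
        simpa [h0] using this
      have t2 : Filter.Tendsto (fun a : ℝ => ε / 2 * (s ^ (m + 1) / (m + 1)) -
          ε / 2 * (a ^ (m + 1) / (m + 1))) (𝓝[>] 0) (𝓝 (ε / 2 * (s ^ (m + 1) / (m + 1)))) := by
        have := ((hB 0).continuousAt.tendsto.const_sub
          (ε / 2 * (s ^ (m + 1) / (m + 1)))).mono_left
            (nhdsWithin_le_nhds (s := Set.Ioi (0 : ℝ)))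
        simpa using this
      refine le_of_tendsto_of_tendsto t1 t2 ?_
      filter_upwards [Ioc_mem_nhdsGT hs0] with a ha using hbound a ha
    have hsm : 0 < s ^ (m + 1) / (m + 1) := by positivity
    have h5 : s ^ (m + 1) / (m + 1) * ‖C‖ ≤ s ^ (m + 1) / (m + 1) * ε := by
      calc s ^ (m + 1) / (m + 1) * ‖C‖ = ‖(s ^ (m + 1) / (m + 1)) • C‖ := by
            rw [norm_smul, Real.norm_of_nonneg hsm.le]
        _ ≤ ‖D s - (D s - (s ^ (m + 1) / (m + 1)) • C)‖ := by rw [sub_sub_cancel]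
        _ ≤ ‖D s‖ + ‖D s - (s ^ (m + 1) / (m + 1)) • C‖ := norm_sub_le _ _
        _ ≤ K * s ^ (m + 2) + ε / 2 * (s ^ (m + 1) / (m + 1)) := by
            rw [Real.norm_of_nonneg (by positivity : (0 : ℝ) ≤ s ^ (m + 2))] at hsK
            gcongr
        _ = s ^ (m + 1) / (m + 1) * (K * s * (m + 1) + ε / 2) := by
            have : (m : ℝ) + 1 ≠ 0 := by positivity
            field_simp
            ring
        _ ≤ s ^ (m + 1) / (m + 1) * ε := by
            refine mul_le_mul_of_nonneg_left ?_ hsm.le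
            linarith
    exact le_of_mul_le_mul_left h5 hsm
  have h := le_of_forall_pos_le_add (a := ‖C‖) (b := 0) (by simpa using key)
  exact norm_le_zero_iff.1 h

variable {E : Type*} [NormedAddCommGroup E] [InnerProductSpace ℂ E]

theorem continuous_lieBracket {ι : Type*} [Fintype ι] {r : ι → ℝ → ℝ}
    (hr : ∀ l, Continuous (r l)) {h : ι → ℝ → Op E} {M : ℕ} (hh : ∀ l, ContDiff ℝ M (h l)) (n : ℕ)
    (hM : n + 2 ≤ M) (l : ι) :
    Continuous fun q : ℝ × ℝ => lieBracket r h n l q.1 q.2 := by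
  set w : (Fin (n + 1) → ι) → ℝ → Op E := fun κ =>
    covWord (ContinuousLinearMap.mul ℂ (Op E)) h (List.ofFn κ) 1 with hw
  have hwc : ∀ κ, ContDiff ℝ (1 : ℕ) (w κ) := fun κ => contDiff_covWord _ hh _
    (by rw [List.length_ofFn]; omega) contDiff_const
  have hd : ∀ x τ, deriv (lieTerm r h n x) τ = ∑ κ, lieCoeff r n κ x • deriv (w κ) τ :=
    fun x τ => (HasDerivAt.fun_sum fun κ _ => (((hwc κ).differentiable
      (by simp) τ).hasDerivAt.const_smul (lieCoeff r n κ x))).deriv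
  have hY : ∀ x τ, lieTerm r h n x τ = ∑ κ, lieCoeff r n κ x • w κ τ := fun _ _ => rfl
  have c1 := fun κ => (hwc κ).continuous
  have c2 : ∀ κ, Continuous (deriv (w κ)) := fun κ => (hwc κ).continuous_deriv (by simp)
  have c3 := fun κ => continuous_lieCoeff hr n κ
  have c4 : Continuous (lieShift r n) := by
    unfold lieShift
    split_ifs
    · exact continuous_pathTime hr
    · exact continuous_const
  have c5 := (hh l).continuous
  have c6 : Continuous (deriv (h l)) := ((hh l).of_le
    (by exact_mod_cast (by omega) : ((1 : ℕ) : WithTop ℕ∞) ≤ M)).continuous_deriv (by simp)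
  simp only [lieBracket, hd, hY]
  fun_prop

theorem expEvol_zero (A : Op E) : expEvol A 0 = 1 := by simp [expEvol]

variable [CompleteSpace E]

theorem hasDerivAt_expEvol (A : Op E) (s : ℝ) :
    HasDerivAt (expEvol A) ((-Complex.I) • (A * expEvol A s)) s := by
  have h := hasDerivAt_exp_smul_const' (𝕂 := ℝ) ((-Complex.I) • A) s
  have e : expEvol A = fun u : ℝ => NormedSpace.exp (u • (-Complex.I) • A) := by
    funext u
    rw [expEvol, ← Complex.coe_smul, smul_smul]
    congr 2
    ring
  rw [e]
  simpa using h

variable [FiniteDimensional ℂ E]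

theorem evol_const {A : Op E} (hA : IsSelfAdjoint A) (b a : ℝ) :
    evol (fun _ => A) b a = expEvol A (b - a) := by
  have h : ∀ x, HasDerivAt (fun x => star (evol (fun _ => A) x a) * expEvol A (x - a)) 0 x :=
    fun x => by
      have := hasDerivAt_star_evol_mul (G := fun _ => A) continuous_const a (b := x) hA (F := 0)
        (Z := fun x => expEvol A (x - a))
        (by simpa using (hasDerivAt_expEvol A (x - a)).comp_sub_const x a)
      simpa using this
  have := is_const_of_deriv_eq_zero (fun x => (h x).differentiableAt) (fun x => (h x).deriv) b a
  simp only [evol_self, star_one, one_mul, sub_self, expEvol_zero] at this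
  calc evol (fun _ => A) b a = evol (fun _ => A) b a *
        (star (evol (fun _ => A) b a) * expEvol A (b - a)) := by rw [this, mul_one]
    _ = expEvol A (b - a) := by
        rw [← mul_assoc, evol_mul_star_evol continuous_const (fun _ => hA), one_mul]

variable {ι : Type*} [Fintype ι] {r : ι → ℝ → ℝ} {X : ℝ}

theorem exists_norm_pathRemainder_le (hr : ∀ l, Continuous (r l)) (hX : 0 ≤ X)
    {h : ι → ℝ → Op E} {M : ℕ} (hh : ∀ l, ContDiff ℝ M (h l))
    (hsa : ∀ l τ, IsSelfAdjoint (h l τ)) (p : ℕ) (hM : p + 2 ≤ M) :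
    ∃ C, ∀ s ∈ Set.Icc (0 : ℝ) 1, ‖pathRemainder r h (p + 1) s X‖ ≤ s ^ (p + 1) * C := by
  have hc : Continuous fun q : ℝ × ℝ =>
      ∑ l, |r l q.2| * ‖lieBracket r h p l q.2 (q.1 * pathTime r q.2)‖ := by
    have h1 := fun l => continuous_lieBracket hr hh p hM l
    have h2 := continuous_pathTime hr
    have h3 : ∀ l, Continuous fun q : ℝ × ℝ =>
        lieBracket r h p l q.2 (q.1 * pathTime r q.2) := fun l =>
      Continuous.comp (g := fun q : ℝ × ℝ => lieBracket r h p l q.1 q.2)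
        (f := fun q : ℝ × ℝ => (q.2, q.1 * pathTime r q.2)) (h1 l) (by fun_prop)
    exact continuous_finsetSum _ fun l _ =>
      ((hr l).abs.comp continuous_snd).mul (h3 l).norm
  obtain ⟨C, hC⟩ := (isCompact_Icc (a := (0 : ℝ)) (b := 1) |>.prod
    (isCompact_Icc (a := 0) (b := X))).exists_bound_of_continuousOn hc.continuousOn
  refine ⟨∫ x in (0 : ℝ)..X, C, fun s hs => ?_⟩
  exact norm_pathRemainder_le hr hh hsa p hM hs.1 hX continuous_const
    fun x hx => (le_abs_self _).trans (hC (s, x) ⟨hs, hx⟩)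

theorem pathEvol_scale_zero (r : ι → ℝ → ℝ) (h : ι → ℝ → Op E) {x : ℝ} (hx : 0 ≤ x) :
    pathEvol r h 0 x = 1 := by
  have e : pathHam r h 0 = fun _ => 0 := by funext x; simp [pathHam]
  have := eq_evol_mul (G := pathHam r h 0) (Z := fun _ => 1) (by rw [e]; exact continuous_const)
    (fun s => by rw [e]; exact IsSelfAdjoint.zero _) hx
    (fun y _ => by simpa [e] using hasDerivAt_const y (1 : Op E))
  rw [mul_one] at this
  exact this.symm

/-- If the evolution along the path with constant Hamiltonians agrees with the exponential up to
order `p`, then the levels `2, …, p` of the Lie series vanish. -/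
theorem lieTerm_eq_zero_of_isBigO (hr : ∀ l, Continuous (r l)) (hX : 0 ≤ X)
    {A : ι → Op E} (hA : ∀ l, IsSelfAdjoint (A l)) {p : ℕ}
    (hO : (fun s : ℝ => pathEvol r (fun l _ => A l) s X -
      expEvol (∑ l, (∫ y in (0 : ℝ)..X, r l y) • A l) s) =O[𝓝 0] fun s : ℝ => s ^ (p + 1))
    (n : ℕ) (hn0 : 1 ≤ n) (hn : n < p) : lieTerm r (fun l _ => A l) n X = fun _ => 0 := by
  set h : ι → ℝ → Op E := fun l _ => A l with hdef
  set B : Op E := ∑ l, (∫ y in (0 : ℝ)..X, r l y) • A l with hB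
  have hBsa : IsSelfAdjoint B := isSelfAdjoint_sum _ fun l _ => (IsSelfAdjoint.all _).smul (hA l)
  have hsa : ∀ l τ, IsSelfAdjoint (h l τ) := fun l _ => hA l
  have hh : ∀ (M : ℕ) l, ContDiff ℝ M (h l) := fun M l => contDiff_const
  have hword : ∀ L : List ι, ∃ D, covWord (ContinuousLinearMap.mul ℂ (Op E)) h L 1 =
      fun _ => D := by
    intro L
    induction L with
    | nil => exact ⟨1, rfl⟩
    | cons l L ih =>
      obtain ⟨D, hD⟩ := ih
      exact ⟨A l * D, by rw [covWord_cons, hD]; funext τ; simp [covAct, hdef]⟩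
  have hconst : ∀ n, ∃ D, lieTerm r h n X = fun _ => D := by
    intro n
    choose D hD using hword
    exact ⟨∑ κ : Fin (n + 1) → ι, lieCoeff r n κ X • D (List.ofFn κ), by
      funext τ; simp only [lieTerm, hD]⟩
  induction n using Nat.strong_induction_on with
  | _ m ih =>
  obtain ⟨D, hD⟩ := hconst m
  suffices hD0 : D = 0 by rw [hD, hD0]
  obtain ⟨K, hK⟩ := exists_norm_pathRemainder_le hr hX (hh (m + 2)) hsa m le_rfl
  -- Levels strictly between 0 and `m` vanish by the induction hypothesis, so `D` is the first
  -- coefficient by which the generator can differ from `B`.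
  have hrem : ∀ s, pathRemainder r h (m + 1) s X =
      pathGen r h s X - B - ((-Complex.I) * s) ^ m • D := by
    intro s
    obtain ⟨q, rfl⟩ : ∃ q, m = q + 1 := ⟨m - 1, by omega⟩
    rw [pathRemainder, Finset.sum_range_succ, Finset.sum_range_succ', Finset.sum_eq_zero, hD,
      lieTerm_zero]
    · simp only [zero_add, pow_zero, one_smul]; rw [sub_sub]
    · intro j hj
      rw [ih (j + 1) (by simp at hj; omega) (by omega) (by simp at hj; omega)]
      simp
  set P : ℝ → Op E := fun s => pathEvol r h s X with hP
  set U : ℝ → Op E := fun s => evol (fun _ => B) s 0 with hU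
  have hP0 : P 0 = 1 := pathEvol_scale_zero r h hX
  have hPd : ∀ s, HasDerivAt P ((-Complex.I) • (pathGen r h s X * P s)) s := fun s =>
    hasDerivAt_pathEvol_scale hr (hh 1) hsa s hX
  have hUd : ∀ s, HasDerivAt U ((-Complex.I) • (B * U s)) s := fun s =>
    hasDerivAt_evol continuous_const 0 s
  -- Pairing with the exact exponential turns the difference of generators into the derivative of a
  -- quantity that the hypothesis makes `O(s^(p+1))`, hence `O(s^(m+2))` because `m < p`.
  have hd : ∀ s, HasDerivAt (fun s => star (U s) * P s - 1)
      (star (U s) * ((-Complex.I) • ((pathGen r h s X - B) * P s))) s := by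
    intro s
    refine (hasDerivAt_star_evol_mul (G := fun _ => B) continuous_const 0 hBsa
      ((hPd s).congr_deriv ?_)).sub_const 1
    rw [sub_mul, smul_sub, add_sub_cancel]
  have hlim : Filter.Tendsto (fun s : ℝ => (s ^ m)⁻¹ •
      (star (U s) * ((-Complex.I) • ((pathGen r h s X - B) * P s)))) (𝓝[>] 0)
      (𝓝 ((-Complex.I) ^ (m + 1) • D)) := by
    have t1 : Filter.Tendsto (fun s : ℝ => (s ^ m)⁻¹ • (pathGen r h s X - B)) (𝓝[>] 0)
        (𝓝 ((-Complex.I) ^ m • D)) := by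
      rw [tendsto_iff_norm_sub_tendsto_zero]
      refine squeeze_zero' (g := fun s : ℝ => s * K) (Filter.Eventually.of_forall
        fun _ => norm_nonneg _) ?_ ?_
      · filter_upwards [Ioc_mem_nhdsGT (zero_lt_one' ℝ)] with s hs
        have hsm : 0 < s ^ m := pow_pos hs.1 m
        have h1 := hK s ⟨hs.1.le, hs.2⟩
        have e : (s ^ m)⁻¹ • (pathGen r h s X - B) - (-Complex.I) ^ m • D =
            (s ^ m)⁻¹ • pathRemainder r h (m + 1) s X := by
          rw [hrem, smul_sub _ _ (((-Complex.I) * s) ^ m • D)]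
          congr 1
          rw [mul_pow, ← Complex.coe_smul, smul_smul]
          congr 1
          have : (s : ℂ) ≠ 0 := by exact_mod_cast hs.1.ne'
          push_cast
          field_simp
        rw [e, norm_smul, norm_inv, Real.norm_of_nonneg hsm.le, inv_mul_le_iff₀ hsm]
        calc _ ≤ _ := h1
          _ = _ := by ring
      · have : Continuous fun s : ℝ => s * K := by fun_prop
        have := (this.tendsto 0).mono_left (nhdsWithin_le_nhds (s := Set.Ioi 0))
        simpa using this
    have t2 : Filter.Tendsto P (𝓝[>] 0) (𝓝 1) := by
      rw [← hP0]; exact (hPd 0).continuousAt.tendsto.mono_left nhdsWithin_le_nhds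
    have t3 : Filter.Tendsto (fun s => star (U s)) (𝓝[>] 0) (𝓝 1) := by
      have : Filter.Tendsto (fun s => star (U s)) (𝓝[>] 0) (𝓝 (star (U 0))) :=
        (hUd 0).star.continuousAt.tendsto.mono_left nhdsWithin_le_nhds
      simpa [hU, evol_self] using this
    have t4 := t3.mul ((t1.mul t2).const_smul (-Complex.I))
    simp only [mul_one, one_mul, smul_smul] at t4
    rw [pow_succ, mul_comm]
    refine t4.congr fun s => ?_
    simp only [smul_mul_assoc, mul_smul_comm]
    rw [smul_comm]
  have hbig : (fun s => star (U s) * P s - 1) =O[𝓝[>] 0] fun s : ℝ => s ^ (m + 2) := by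
    have h1 : (fun s => star (U s) * P s - 1) =O[𝓝[>] 0] fun s : ℝ => s ^ (p + 1) := by
      refine Asymptotics.IsBigO.trans ?_ (hO.mono nhdsWithin_le_nhds)
      refine Asymptotics.IsBigO.of_bound 1 (Filter.Eventually.of_forall fun s => ?_)
      have e : star (U s) * P s - 1 = star (U s) * (P s - U s) := by
        rw [mul_sub, star_evol_mul_evol continuous_const fun _ => hBsa]
      have e2 : expEvol B s = U s := by
        have := evol_const hBsa s 0
        rw [sub_zero] at this
        exact this.symm
      rw [e, one_mul, e2]
      refine (norm_mul_le _ _).trans ?_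
      rw [norm_star]
      have := norm_evol_le (G := fun _ => B) continuous_const (fun _ => hBsa) 0 s
      exact mul_le_of_le_one_left (norm_nonneg _) this
    refine h1.trans (Asymptotics.IsBigO.of_bound 1 ?_)
    filter_upwards [Ioc_mem_nhdsGT (zero_lt_one' ℝ)] with s hs
    rw [one_mul, norm_pow, norm_pow]
    refine pow_le_pow_of_le_one (norm_nonneg _) ?_ (by omega)
    rw [Real.norm_of_nonneg hs.1.le]; exact hs.2
  have := eq_zero_of_tendsto_of_isBigO hd (by simp [hU, evol_self, hP0]) hlim hbig
  exact (smul_eq_zero.1 this).resolve_left (pow_ne_zero _ (neg_ne_zero.2 Complex.I_ne_zero))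

end SmallTimes

/-! ### Separating words by matrices. -/

section Letters

/-- The symmetric matrix whose entry between `i` and `i + 1` is the indicator of `u i = g`. -/
def letterMatrix {Λ : Type*} [DecidableEq Λ] (u : ℕ → Λ) (N : ℕ) (g : Λ) :
    Matrix (Fin N) (Fin N) ℂ := fun i j =>
  if ((j : ℕ) = i + 1 ∧ u i = g) ∨ ((i : ℕ) = j + 1 ∧ u j = g) then 1 else 0

theorem letterMatrix_isHermitian {Λ : Type*} [DecidableEq Λ] (u : ℕ → Λ) (N : ℕ) (g : Λ) :
    (letterMatrix u N g).IsHermitian := by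
  ext i j
  simp only [Matrix.conjTranspose_apply, letterMatrix]
  split_ifs with h1 h2 h2
  · simp
  · exact absurd h1.symm h2
  · exact absurd h2.symm h1
  · simp

/-- Entries far from the diagonal detect words. -/
theorem letterMatrix_prod_apply {Λ : Type*} [DecidableEq Λ] (u : ℕ → Λ) (N : ℕ) (L : List Λ)
    (i j : Fin N) (hij : (i : ℕ) + L.length ≤ j) :
    (L.map (letterMatrix u N)).prod i j =
      if (i : ℕ) + L.length = j ∧ L = (List.range' i L.length).map u then 1 else 0 := by
  induction L generalizing i with
  | nil => simp [Matrix.one_apply, Fin.ext_iff]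
  | cons g L ih =>
    simp only [List.length_cons] at hij
    have hi : (i : ℕ) + 1 < N := by omega
    -- Each letter moves the index by one. To climb as far as the length of the word, every letter
    -- must move up, so the only surviving intermediate index is `i + 1`.
    rw [List.map_cons, List.prod_cons, Matrix.mul_apply,
      Finset.sum_eq_single (⟨i + 1, hi⟩ : Fin N)]
    · have hM : letterMatrix u N g i ⟨i + 1, hi⟩ = if u i = g then 1 else 0 := by
        have : ¬ ((i : ℕ) = i + 1 + 1) := by omega
        simp [letterMatrix, this]
      rw [ih _ (by simp; omega), hM]
      simp only [List.length_cons, List.range'_succ, List.map_cons, List.cons.injEq]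
      rw [show (i : ℕ) + 1 + L.length = i + (L.length + 1) by omega]
      by_cases hg : u i = g
      · simp [hg]
      · have hg' : g ≠ u i := fun e => hg e.symm
        simp [hg, hg']
    · intro k _ hk
      have hk' : (k : ℕ) ≠ i + 1 := fun e => hk (Fin.ext e)
      by_cases hlt : (k : ℕ) < i
      · rw [ih k (by omega), if_neg (by omega), mul_zero]
      · rw [letterMatrix, if_neg (by omega), zero_mul]
    · simp

variable {ι Λ : Type*} [Fintype ι] [Fintype Λ] [DecidableEq Λ]

/-- Several steps may use the same Hamiltonian, so only the sum of the coefficients over all step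
sequences spelling a given word can be recovered from the operators. -/
theorem lieTerm_letters {A : Type*} [NormedRing A] [NormedAlgebra ℂ A] (r : ι → ℝ → ℝ)
    (lam : ι → Λ) (g : Λ → ℝ → A) (n : ℕ) (x τ : ℝ) :
    lieTerm r (fun l => g (lam l)) n x τ = ∑ u : Fin (n + 1) → Λ,
      (∑ κ with lam ∘ κ = u, lieCoeff r n κ x) •
        covWord (ContinuousLinearMap.mul ℂ A) g (List.ofFn u) 1 τ := by
  have hw : ∀ L : List ι, covWord (ContinuousLinearMap.mul ℂ A) (fun l => g (lam l)) L 1 =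
      covWord (ContinuousLinearMap.mul ℂ A) g (L.map lam) 1 := by
    intro L
    rw [covWord, covWord, List.foldr_map]
  rw [lieTerm, ← Finset.sum_fiberwise Finset.univ (fun κ : Fin (n + 1) → ι => lam ∘ κ)]
  refine Finset.sum_congr rfl fun u _ => ?_
  rw [Finset.sum_smul]
  refine Finset.sum_congr rfl fun κ hκ => ?_
  rw [hw, List.map_ofFn, (Finset.mem_filter.1 hκ).2]

/-- If a level of the Lie series vanishes for all Hermitian matrices, then it vanishes for all
time-dependent Hamiltonians. -/
theorem sum_lieCoeff_eq_zero (r : ι → ℝ → ℝ) (lam : ι → Λ) (n : ℕ) (x : ℝ)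
    (h0 : ∀ (d : ℕ) (A : Λ → Op (EuclideanSpace ℂ (Fin d))), (∀ g, IsSelfAdjoint (A g)) →
      lieTerm r (fun l _ => A (lam l)) n x = fun _ => 0) (u : Fin (n + 1) → Λ) :
    ∑ κ with lam ∘ κ = u, lieCoeff r n κ x = 0 := by
  -- The default `u 0` only makes the sequence total; the corner entry examined below reads
  -- positions `0` to `n`.
  set u' : ℕ → Λ := fun t => if ht : t < n + 1 then u ⟨t, ht⟩ else u 0 with hu'
  have hlist : (List.range' 0 (n + 1)).map u' = List.ofFn u := by
    refine List.ext_getElem (by simp) fun t h1 h2 => ?_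
    have ht : t < n + 1 := by simpa using h2
    rw [List.getElem_map, List.getElem_range', List.getElem_ofFn, zero_add, one_mul]
    exact dif_pos ht
  set T := Matrix.toEuclideanCLM (n := Fin (n + 2)) (𝕜 := ℂ) with hT
  set A : Λ → Op (EuclideanSpace ℂ (Fin (n + 2))) := fun g => T (letterMatrix u' (n + 2) g) with hA
  have hAsa : ∀ g, IsSelfAdjoint (A g) := fun g => by
    have : IsSelfAdjoint (letterMatrix u' (n + 2) g) := letterMatrix_isHermitian u' _ g
    exact this.map T
  have h1 := congrFun (h0 (n + 2) A hAsa) 0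
  rw [lieTerm_letters r lam (fun g _ => A g)] at h1
  have hw : ∀ L : List Λ, covWord (ContinuousLinearMap.mul ℂ _) (fun g (_ : ℝ) => A g) L 1 =
      fun _ => T (L.map (letterMatrix u' (n + 2))).prod := by
    intro L
    induction L with
    | nil => funext τ; simp [covWord]
    | cons l L ih =>
      rw [covWord_cons, ih]; funext τ; simp [covAct, hA]
  simp only [hw] at h1
  have h2 : T (∑ v : Fin (n + 1) → Λ, ((∑ κ with lam ∘ κ = v, lieCoeff r n κ x : ℝ) : ℂ) •
      ((List.ofFn v).map (letterMatrix u' (n + 2))).prod) = 0 := by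
    rw [map_sum, ← h1]
    refine Finset.sum_congr rfl fun v _ => ?_
    rw [map_smul]
    exact Complex.coe_smul (E := Op (EuclideanSpace ℂ (Fin (n + 2)))) _ _
  have h3 := (map_eq_zero_iff T T.injective).1 h2
  -- A word of `n + 1` letters climbs from index 0 to index `n + 1`, hence dimension `n + 2`. The
  -- corner entry is 1 for the word `u` and 0 for every other word of this length.
  have h4 := congrFun (congrFun h3 0) (Fin.last (n + 1))
  rw [Matrix.sum_apply, Finset.sum_eq_single u] at h4
  · rw [Matrix.smul_apply, letterMatrix_prod_apply _ _ _ _ _ (by simp), if_pos] at h4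
    · simp only [smul_eq_mul, mul_one, Matrix.zero_apply] at h4
      exact_mod_cast h4
    · refine ⟨by simp, ?_⟩
      rw [List.length_ofFn]
      exact hlist.symm
  · intro v _ hv
    rw [Matrix.smul_apply, letterMatrix_prod_apply _ _ _ _ _ (by simp), if_neg, smul_zero]
    rintro ⟨-, e⟩
    apply hv
    apply List.ofFn_injective
    rw [e, List.length_ofFn]
    exact hlist
  · simp

end Letters

/-! ### The concrete path through the steps of a product formula. -/

section Path

/-- A continuous bump on the unit interval with integral one. -/
def bump (y : ℝ) : ℝ := max 0 (6 * y * (1 - y))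

/-- The bump vanishes at both ends of the unit interval, so consecutive steps join to a continuous
Hamiltonian along the path. -/
theorem continuous_bump : Continuous bump := by unfold bump; fun_prop

theorem bump_nonneg (y : ℝ) : 0 ≤ bump y := le_max_left _ _

theorem bump_eq_zero_of_nonpos {y : ℝ} (hy : y ≤ 0) : bump y = 0 :=
  max_eq_left (by nlinarith)

theorem bump_eq_zero_of_one_le {y : ℝ} (hy : 1 ≤ y) : bump y = 0 :=
  max_eq_left (by nlinarith)

/-- The primitive of the bump. -/
def ramp (u : ℝ) : ℝ := ∫ y in (0 : ℝ)..u, bump y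

theorem hasDerivAt_ramp (u : ℝ) : HasDerivAt ramp (bump u) u :=
  hasDerivAt_primitive continuous_bump 0 u

theorem ramp_mono : Monotone ramp :=
  monotone_of_hasDerivAt_nonneg hasDerivAt_ramp bump_nonneg

theorem ramp_of_nonpos {u : ℝ} (hu : u ≤ 0) : ramp u = 0 := by
  rw [ramp, intervalIntegral.integral_congr (g := fun _ => 0), intervalIntegral.integral_zero]
  intro y hy
  rw [Set.uIcc_of_ge hu] at hy
  exact bump_eq_zero_of_nonpos hy.2

theorem ramp_one : ramp 1 = 1 := by
  have h : ∀ y ∈ Set.uIcc (0 : ℝ) 1, HasDerivAt (fun y : ℝ => 3 * y ^ 2 - 2 * y ^ 3) (bump y) y := by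
    intro y hy
    rw [Set.uIcc_of_le zero_le_one] at hy
    rw [bump, max_eq_right (by nlinarith [hy.1, hy.2])]
    refine (((hasDerivAt_pow 2 y).const_mul 3).sub ((hasDerivAt_pow 3 y).const_mul 2)).congr_deriv ?_
    norm_num
    ring
  rw [ramp, intervalIntegral.integral_eq_sub_of_hasDerivAt h
    (continuous_bump.intervalIntegrable _ _)]
  norm_num

theorem ramp_of_one_le {u : ℝ} (hu : 1 ≤ u) : ramp u = 1 := by
  have h : ∫ y in (1 : ℝ)..u, bump y = 0 := by
    rw [intervalIntegral.integral_congr (g := fun _ => 0), intervalIntegral.integral_zero]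
    intro y hy
    rw [Set.uIcc_of_le hu] at hy
    exact bump_eq_zero_of_one_le hy.1
  have := intervalIntegral.integral_add_adjacent_intervals
    (continuous_bump.intervalIntegrable (μ := MeasureTheory.volume) 0 1)
    (continuous_bump.intervalIntegrable 1 u)
  rw [h, add_zero] at this
  rw [ramp, ← this]
  exact ramp_one

theorem ramp_mem (u : ℝ) : ramp u ∈ Set.Icc (0 : ℝ) 1 := by
  constructor
  · rcases le_total u 0 with h | h
    · rw [ramp_of_nonpos h]
    · exact (ramp_of_nonpos le_rfl).symm.le.trans (ramp_mono h)
  · rcases le_total u 1 with h | h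
    · exact (ramp_mono h).trans ramp_one.le
    · rw [ramp_of_one_le h]

theorem integral_bump_sub (m : ℕ) (x : ℝ) : ∫ y in (0 : ℝ)..x, bump (y - m) = ramp (x - m) := by
  rw [intervalIntegral.integral_eq_sub_of_hasDerivAt (f := fun y => ramp (y - m))
    (fun y _ => (hasDerivAt_ramp (y - m)).comp_sub_const y m)]
  · rw [ramp_of_nonpos (u := 0 - (m : ℝ)) (by simp), sub_zero]
  · exact (continuous_bump.comp (continuous_sub_right _)).intervalIntegrable _ _

variable {Γ : ℕ} (c : Coeffs Γ)

/-- The position of a step in the sequence of all steps. -/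
def Coeffs.pos : c.Step → ℕ
  | Sum.inl k => 2 * k
  | Sum.inr k => 2 * k + 1

/-- The rate at which a step is run through along the path. -/
def Coeffs.rate (l : c.Step) (x : ℝ) : ℝ := c.stepCoeff l * bump (x - c.pos l)

theorem Coeffs.pos_injective : Function.Injective c.pos := by
  rintro (k | k) (k' | k') h <;> simp only [Coeffs.pos] at h
  · rw [Fin.ext (by omega : (k : ℕ) = k')]
  · omega
  · omega
  · rw [Fin.ext (by omega : (k : ℕ) = k')]

theorem Coeffs.pos_le (l : c.Step) : c.pos l ≤ 2 * c.n := by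
  rcases l with k | k <;> simp only [Coeffs.pos] <;> omega

theorem Coeffs.exists_pos_eq {m : ℕ} (hm : m ≤ 2 * c.n) : ∃ l, c.pos l = m := by
  rcases Nat.even_or_odd' m with ⟨k, rfl | rfl⟩
  · exact ⟨Sum.inl ⟨k, by omega⟩, rfl⟩
  · exact ⟨Sum.inr ⟨k, by omega⟩, rfl⟩

theorem Coeffs.continuous_rate (l : c.Step) : Continuous (c.rate l) :=
  continuous_const.mul (continuous_bump.comp (continuous_sub_right _))

theorem Coeffs.integral_rate (l : c.Step) (x : ℝ) :
    ∫ y in (0 : ℝ)..x, c.rate l y = c.stepCoeff l * ramp (x - c.pos l) := by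
  simp only [Coeffs.rate, intervalIntegral.integral_const_mul, integral_bump_sub]

theorem Coeffs.integral_abs_rate (l : c.Step) (x : ℝ) :
    ∫ y in (0 : ℝ)..x, |c.rate l y| = |c.stepCoeff l| * ramp (x - c.pos l) := by
  simp only [Coeffs.rate, abs_mul, abs_of_nonneg (bump_nonneg _),
    intervalIntegral.integral_const_mul, integral_bump_sub]

theorem Coeffs.integral_abs_rate_le (l : c.Step) (x : ℝ) :
    ∫ y in (0 : ℝ)..x, |c.rate l y| ≤ |c.stepCoeff l| := by
  rw [c.integral_abs_rate]
  exact mul_le_of_le_one_right (abs_nonneg _) (ramp_mem _).2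

theorem Coeffs.ramp_length (l : c.Step) : ramp ((2 * c.n + 1 : ℕ) - c.pos l : ℝ) = 1 := by
  refine ramp_of_one_le ?_
  have : (c.pos l : ℝ) ≤ (2 * c.n : ℕ) := by exact_mod_cast c.pos_le l
  push_cast at this ⊢
  linarith

theorem Coeffs.pathTime_eq (x : ℝ) :
    pathTime c.rate x = ∑ l, c.stepCoeff l * ramp (x - c.pos l) :=
  Finset.sum_congr rfl fun l _ => c.integral_rate l x

theorem Coeffs.rate_eq_zero {l l' : c.Step} (hl : l' ≠ l) {x : ℝ}
    (hx : x ∈ Set.Icc (c.pos l : ℝ) (c.pos l + 1)) : c.rate l' x = 0 := by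
  rcases lt_or_gt_of_ne (fun e => hl (c.pos_injective e) : c.pos l' ≠ c.pos l) with h | h
  · have : (c.pos l' : ℝ) + 1 ≤ c.pos l := by exact_mod_cast h
    rw [Coeffs.rate, bump_eq_zero_of_one_le (by linarith [hx.1]), mul_zero]
  · have : (c.pos l : ℝ) + 1 ≤ c.pos l' := by exact_mod_cast h
    rw [Coeffs.rate, bump_eq_zero_of_nonpos (by linarith [hx.2]), mul_zero]

theorem Coeffs.sum_rate_smul {F : Type*} [AddCommGroup F] [Module ℝ F] (l : c.Step) {x : ℝ}
    (hx : x ∈ Set.Icc (c.pos l : ℝ) (c.pos l + 1)) (f : c.Step → F) :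
    ∑ l', c.rate l' x • f l' = c.rate l x • f l :=
  Finset.sum_eq_single l (fun l' _ h => by rw [c.rate_eq_zero h hx, zero_smul]) (by simp)

theorem Coeffs.sum_rate (l : c.Step) {x : ℝ}
    (hx : x ∈ Set.Icc (c.pos l : ℝ) (c.pos l + 1)) : ∑ l', c.rate l' x = c.rate l x :=
  Finset.sum_eq_single l (fun _ _ h => c.rate_eq_zero h hx) (by simp)

theorem Coeffs.pathTime_step (l : c.Step) {x : ℝ}
    (hx : x ∈ Set.Icc (c.pos l : ℝ) (c.pos l + 1)) :
    pathTime c.rate x = pathTime c.rate (c.pos l) + c.stepCoeff l * ramp (x - c.pos l) := by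
  rw [c.pathTime_eq, c.pathTime_eq, ← Finset.add_sum_erase _ _ (Finset.mem_univ l),
    ← Finset.add_sum_erase _ _ (Finset.mem_univ l)]
  rw [sub_self, ramp_of_nonpos le_rfl, mul_zero, zero_add, add_comm]
  congr 1
  refine Finset.sum_congr rfl fun l' hl' => ?_
  have hne : l' ≠ l := (Finset.mem_erase.1 hl').1
  rcases lt_or_gt_of_ne (fun e => hne (c.pos_injective e) : c.pos l' ≠ c.pos l) with h | h
  · have : (c.pos l' : ℝ) + 1 ≤ c.pos l := by exact_mod_cast h
    rw [ramp_of_one_le (by linarith [hx.1]), ramp_of_one_le (by linarith)]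
  · have : (c.pos l : ℝ) + 1 ≤ c.pos l' := by exact_mod_cast h
    rw [ramp_of_nonpos (by linarith [hx.2]), ramp_of_nonpos (by linarith)]

theorem Coeffs.pathTime_pos_add_one (l : c.Step) :
    pathTime c.rate (c.pos l + 1) = pathTime c.rate (c.pos l) + c.stepCoeff l := by
  rw [c.pathTime_step l ⟨by linarith, le_rfl⟩, add_sub_cancel_left, ramp_one, mul_one]

theorem Coeffs.pathTime_inl_aux (k : ℕ) (hk : k < c.n + 1) :
    pathTime c.rate (c.pos (Sum.inl ⟨k, hk⟩)) = c.β ⟨k, hk⟩ := by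
  induction k with
  | zero =>
    have : (⟨0, hk⟩ : Fin (c.n + 1)) = 0 := rfl
    rw [this, c.β_zero]
    simp [Coeffs.pos, pathTime]
  | succ k ih =>
    have h1 := c.pathTime_pos_add_one (Sum.inl ⟨k, by omega⟩)
    have h2 := c.pathTime_pos_add_one (Sum.inr ⟨k, by omega⟩)
    rw [ih (by omega)] at h1
    have e1 : ((c.pos (Sum.inr ⟨k, by omega⟩ : c.Step) : ℕ) : ℝ) =
        c.pos (Sum.inl ⟨k, by omega⟩ : c.Step) + 1 := by simp [Coeffs.pos]
    have e2 : ((c.pos (Sum.inl ⟨k + 1, hk⟩ : c.Step) : ℕ) : ℝ) =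
        c.pos (Sum.inr ⟨k, by omega⟩ : c.Step) + 1 := by
      simp only [Coeffs.pos]; push_cast; ring
    rw [e2, h2, e1, h1]
    simp only [Coeffs.stepCoeff, Fin.succ_mk, Fin.castSucc_mk]
    ring

theorem Coeffs.pathTime_inl (k : Fin (c.n + 1)) :
    pathTime c.rate (c.pos (Sum.inl k)) = c.β k := c.pathTime_inl_aux k k.2

theorem Coeffs.pathTime_inl_add_one (k : Fin (c.n + 1)) :
    pathTime c.rate (c.pos (Sum.inl k) + 1) = c.β k + c.α k := by
  rw [c.pathTime_pos_add_one, c.pathTime_inl]; rfl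

theorem Coeffs.pathTime_inr (k : Fin c.n) :
    pathTime c.rate (c.pos (Sum.inr k)) = c.β k.castSucc + c.α k.castSucc := by
  rw [← c.pathTime_inl_add_one]
  simp [Coeffs.pos]

theorem Coeffs.pathTime_inr_add_one (k : Fin c.n) :
    pathTime c.rate (c.pos (Sum.inr k) + 1) = c.β k.succ := by
  rw [c.pathTime_pos_add_one, c.pathTime_inr]; simp only [Coeffs.stepCoeff]; ring

theorem Coeffs.pathTime_pos_mem (l : c.Step) :
    pathTime c.rate (c.pos l) ∈ Set.Icc (0 : ℝ) 1 := by
  rcases l with k | k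
  · rw [c.pathTime_inl]; exact c.β_mem k
  · rw [c.pathTime_inr]; exact c.β_add_α_mem _

theorem Coeffs.pathTime_pos_add_one_mem (l : c.Step) :
    pathTime c.rate (c.pos l + 1) ∈ Set.Icc (0 : ℝ) 1 := by
  rcases l with k | k
  · rw [c.pathTime_inl_add_one]; exact c.β_add_α_mem k
  · rw [c.pathTime_inr_add_one]; exact c.β_mem _

/-- A step coefficient is the difference of two path times in [0, 1]. -/
theorem Coeffs.abs_stepCoeff_le (l : c.Step) : |c.stepCoeff l| ≤ 1 := by
  have h := c.pathTime_pos_add_one l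
  have h1 := c.pathTime_pos_mem l
  have h2 := c.pathTime_pos_add_one_mem l
  rw [abs_le]
  constructor <;> linarith [h1.1, h1.2, h2.1, h2.2]

theorem Coeffs.exists_step_mem {x : ℝ} (hx : x ∈ Set.Icc (0 : ℝ) (2 * c.n + 1 : ℕ)) :
    ∃ l, x ∈ Set.Icc (c.pos l : ℝ) (c.pos l + 1) := by
  rcases eq_or_lt_of_le hx.2 with h | h
  · obtain ⟨l, hl⟩ := c.exists_pos_eq (m := 2 * c.n) le_rfl
    refine ⟨l, ?_⟩
    rw [hl, h]; push_cast
    exact ⟨by linarith, le_rfl⟩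
  · have hf : ⌊x⌋₊ < 2 * c.n + 1 := (Nat.floor_lt hx.1).2 h
    obtain ⟨l, hl⟩ := c.exists_pos_eq (m := ⌊x⌋₊) (by omega)
    refine ⟨l, ?_⟩
    rw [hl]
    exact ⟨Nat.floor_le hx.1, (Nat.lt_floor_add_one x).le⟩

theorem Coeffs.pathTime_mem {x : ℝ} (hx : x ∈ Set.Icc (0 : ℝ) (2 * c.n + 1 : ℕ)) :
    pathTime c.rate x ∈ Set.Icc (0 : ℝ) 1 := by
  obtain ⟨l, hl⟩ := c.exists_step_mem hx
  have h := c.pathTime_pos_add_one l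
  have h1 := c.pathTime_pos_mem l
  have h2 := c.pathTime_pos_add_one_mem l
  have h3 := ramp_mem (x - c.pos l)
  rw [h] at h2
  rw [c.pathTime_step l hl]
  constructor <;> nlinarith [h1.1, h1.2, h2.1, h2.2, h3.1, h3.2]

theorem Coeffs.pathTime_length : pathTime c.rate (2 * c.n + 1 : ℕ) = 1 := by
  rw [← c.β_add_α_last, ← c.pathTime_inl_add_one]
  simp [Coeffs.pos]

theorem Coeffs.integral_rate_length (l : c.Step) :
    ∫ y in (0 : ℝ)..(2 * c.n + 1 : ℕ), c.rate l y = c.stepCoeff l := by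
  rw [c.integral_rate, c.ramp_length, mul_one]

theorem Coeffs.sum_stepCoeff : ∑ l, c.stepCoeff l = 1 := by
  rw [← c.pathTime_length, pathTime]
  exact Finset.sum_congr rfl fun l _ => (c.integral_rate_length l).symm

theorem Coeffs.one_le_sum_abs_stepCoeff : 1 ≤ ∑ l, |c.stepCoeff l| := by
  rw [← c.sum_stepCoeff]
  exact Finset.sum_le_sum fun l _ => le_abs_self _

theorem Coeffs.sum_α_smul {F : Type*} [AddCommGroup F] [Module ℝ F] (f : Fin Γ → F) :
    ∑ k, c.α k • f (c.γ k) = ∑ g, f g := by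
  rw [← Finset.sum_fiberwise Finset.univ c.γ]
  refine Finset.sum_congr rfl fun g _ => ?_
  calc _ = ∑ k with c.γ k = g, c.α k • f g :=
        Finset.sum_congr rfl fun k hk => by rw [(Finset.mem_filter.1 hk).2]
    _ = f g := by rw [← Finset.sum_smul, c.sum_α, one_smul]

theorem Coeffs.sum_α_all : ∑ k, c.α k = Γ := by
  simpa using c.sum_α_smul (fun _ => (1 : ℝ))

/-- The portion of the path integral belonging to a step is at most the integral over all times. -/
theorem Coeffs.integral_abs_rate_mul_le (l : c.Step) {w : ℝ → ℝ} (hw : Continuous w)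
    (hw0 : ∀ u, 0 ≤ w u) :
    ∫ x in (0 : ℝ)..(2 * c.n + 1 : ℕ), |c.rate l x| * w (pathTime c.rate x) ≤
      ∫ u in (0 : ℝ)..1, w u := by
  have hρ := continuous_pathTime c.continuous_rate
  have hf : Continuous fun x => |c.rate l x| * w (pathTime c.rate x) :=
    (c.continuous_rate l).abs.mul (hw.comp hρ)
  have hle : (c.pos l : ℝ) + 1 ≤ (2 * c.n + 1 : ℕ) := by
    have := c.pos_le l
    exact_mod_cast Nat.succ_le_succ this
  rw [← intervalIntegral.integral_add_adjacent_intervals (hf.intervalIntegrable 0 (c.pos l))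
    (hf.intervalIntegrable _ _), ← intervalIntegral.integral_add_adjacent_intervals
      (hf.intervalIntegrable (c.pos l) (c.pos l + 1)) (hf.intervalIntegrable _ _)]
  have z1 : ∫ x in (0 : ℝ)..c.pos l, |c.rate l x| * w (pathTime c.rate x) = 0 := by
    rw [intervalIntegral.integral_congr (g := fun _ => 0), intervalIntegral.integral_zero]
    intro x hx
    rw [Set.uIcc_of_le (by positivity)] at hx
    simp [Coeffs.rate, bump_eq_zero_of_nonpos (sub_nonpos.2 hx.2)]
  have z2 : ∫ x in (c.pos l + 1 : ℝ)..(2 * c.n + 1 : ℕ),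
      |c.rate l x| * w (pathTime c.rate x) = 0 := by
    rw [intervalIntegral.integral_congr (g := fun _ => 0), intervalIntegral.integral_zero]
    intro x hx
    rw [Set.uIcc_of_le hle] at hx
    simp [Coeffs.rate, bump_eq_zero_of_one_le (by linarith [hx.1] : 1 ≤ x - c.pos l)]
  rw [z1, z2, zero_add, add_zero]
  have hsub : ∫ x in (c.pos l : ℝ)..(c.pos l + 1), (w ∘ pathTime c.rate) x * (∑ l', c.rate l' x) =
      ∫ u in (pathTime c.rate (c.pos l))..(pathTime c.rate (c.pos l + 1)), w u :=
    intervalIntegral.integral_comp_mul_deriv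
      (fun x _ => hasDerivAt_pathTime c.continuous_rate x)
      (continuous_finsetSum _ fun l' _ => c.continuous_rate l').continuousOn hw
  have h1 := c.pathTime_pos_mem l
  have h2 := c.pathTime_pos_add_one_mem l
  have h3 := c.pathTime_pos_add_one l
  have hnn : 0 ≤ᵐ[MeasureTheory.volume.restrict (Set.Ioc 0 1)] w :=
    Filter.Eventually.of_forall hw0
  -- Within one step the path time is monotone, in the direction given by the sign of the
  -- coefficient, so substituting it as the variable gives an integral over a subinterval of [0, 1].
  rcases le_total 0 (c.stepCoeff l) with ha | ha
  · calc _ = ∫ x in (c.pos l : ℝ)..(c.pos l + 1),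
          (w ∘ pathTime c.rate) x * (∑ l', c.rate l' x) := by
          refine intervalIntegral.integral_congr fun x hx => ?_
          rw [Set.uIcc_of_le (by linarith)] at hx
          simp only [Function.comp_apply]
          have hx0 : 0 ≤ c.rate l x := mul_nonneg ha (bump_nonneg _)
          rw [c.sum_rate l hx, abs_of_nonneg hx0, mul_comm]
      _ ≤ _ := by
          rw [hsub]
          exact intervalIntegral.integral_mono_interval h1.1 (by linarith) h2.2 hnn
            (hw.intervalIntegrable _ _)
  · calc _ = -∫ x in (c.pos l : ℝ)..(c.pos l + 1),
          (w ∘ pathTime c.rate) x * (∑ l', c.rate l' x) := by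
          rw [← intervalIntegral.integral_neg]
          refine intervalIntegral.integral_congr fun x hx => ?_
          rw [Set.uIcc_of_le (by linarith)] at hx
          simp only [Function.comp_apply]
          have hx0 : c.rate l x ≤ 0 := mul_nonpos_of_nonpos_of_nonneg ha (bump_nonneg _)
          rw [c.sum_rate l hx, abs_of_nonpos hx0]
          ring
      _ ≤ _ := by
          rw [hsub, ← intervalIntegral.integral_symm]
          exact intervalIntegral.integral_mono_interval h2.1 (by linarith) h1.2 hnn
            (hw.intervalIntegrable _ _)

end Path

/-! ### The path evolution as a product formula. -/

section StepEvolution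

variable {E : Type*} [NormedAddCommGroup E] [InnerProductSpace ℂ E] {Γ : ℕ} (c : Coeffs Γ)

theorem leftProd_succ {M : Type*} [Monoid M] {m : ℕ} (f : Fin (m + 1) → M) :
    leftProd f = f (Fin.last m) * leftProd fun k : Fin m => f k.castSucc := by
  rw [leftProd, leftProd, List.ofFn_succ', List.concat_eq_append, List.reverse_append]
  simp

theorem evol_zero (b a : ℝ) : evol (fun _ => (0 : Op E)) b a = 1 := by
  unfold evol
  rw [tsum_eq_single 0]
  · rfl
  · intro m hm
    obtain ⟨k, rfl⟩ := Nat.exists_eq_succ_of_ne_zero hm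
    simp [dyson]

/-- The letter of a step: the number of its Hamiltonian, or none for the steps in between. -/
def Coeffs.letter : c.Step → Option (Fin Γ)
  | Sum.inl k => some (c.γ k)
  | Sum.inr _ => none

/-- All steps together advance the clock by 1 and the factors alone by Γ, so the intermediate steps
add up to 1 - Γ. The sign of `A none` is reversed because `Coeffs.timeIndep` uses the negatives of
their coefficients. -/
theorem Coeffs.sum_integral_rate_letter (A : Option (Fin Γ) → Op E) :
    ∑ l, (∫ y in (0 : ℝ)..(2 * c.n + 1 : ℕ), c.rate l y) • A (c.letter l) =
      ((Γ : ℂ) - 1) • (-A none) + ∑ g, A (some g) := by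
  simp only [c.integral_rate_length]
  rw [Fintype.sum_sum_type]
  simp only [Coeffs.letter, Coeffs.stepCoeff]
  rw [c.sum_α_smul (fun g => A (some g)), ← Finset.sum_smul, add_comm]
  congr 1
  have h1 := c.sum_stepCoeff
  rw [Fintype.sum_sum_type] at h1
  simp only [Coeffs.stepCoeff, c.sum_α_all] at h1
  have h2 : ∑ k : Fin c.n, (c.β k.succ - c.β k.castSucc - c.α k.castSucc) = 1 - Γ := by linarith
  rw [h2, ← Complex.coe_smul, smul_neg, ← neg_smul]
  congr 1
  push_cast
  ring

variable [CompleteSpace E] [FiniteDimensional ℂ E] {h : c.Step → ℝ → Op E}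

/-- Only one rate is nonzero during a step, so the evolution of that Hamiltonian, reparametrised by
the path time, solves the same equation by the chain rule. Uniqueness then also covers steps that
run backwards in time. -/
theorem Coeffs.pathEvol_step (hh : ∀ l, Continuous (h l)) (hsa : ∀ l τ, IsSelfAdjoint (h l τ))
    (s : ℝ) (l : c.Step) :
    pathEvol c.rate h s (c.pos l + 1) =
      evol (h l) (s * pathTime c.rate (c.pos l + 1)) (s * pathTime c.rate (c.pos l)) *
        pathEvol c.rate h s (c.pos l) := by
  have hG := continuous_pathHam c.continuous_rate hh s
  have hGsa := isSelfAdjoint_pathHam (r := c.rate) hsa s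
  have h1 := eq_evol_mul hG hGsa (a := c.pos l) (b := c.pos l + 1) (by linarith)
    (Z := fun x => evol (h l) (s * pathTime c.rate x) (s * pathTime c.rate (c.pos l)))
    (fun x hx => by
      have h2 := (hasDerivAt_evol (hh l) (s * pathTime c.rate (c.pos l))
        (s * pathTime c.rate x)).scomp x
          ((hasDerivAt_pathTime c.continuous_rate x).const_mul s)
      refine h2.congr_deriv ?_
      rw [pathHam, c.sum_rate_smul l hx, c.sum_rate l hx]
      simp only [smul_mul_assoc, mul_smul]
      rw [smul_comm (-Complex.I), smul_comm (-Complex.I), smul_comm s])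
  rw [evol_self, mul_one] at h1
  rw [h1, pathEvol, pathEvol, evol_mul_evol hG hGsa]

theorem Coeffs.pathEvol_even (hh : ∀ l, Continuous (h l)) (hsa : ∀ l τ, IsSelfAdjoint (h l τ))
    (s : ℝ) (k : ℕ) (hk : k ≤ c.n) :
    pathEvol c.rate h s (2 * k : ℕ) = leftProd fun j : Fin k =>
      evol (h (Sum.inr (Fin.castLE hk j))) (s * c.β (Fin.castLE hk j).succ)
          (s * (c.β (Fin.castLE hk j).castSucc + c.α (Fin.castLE hk j).castSucc)) *
        evol (h (Sum.inl (Fin.castLE hk j).castSucc))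
          (s * (c.β (Fin.castLE hk j).castSucc + c.α (Fin.castLE hk j).castSucc))
          (s * c.β (Fin.castLE hk j).castSucc) := by
  induction k with
  | zero => simp [leftProd, pathEvol, evol_self]
  | succ k ih =>
    rw [leftProd_succ]
    have hk' : k < c.n := by omega
    have e0 : Fin.castLE hk (Fin.last k) = ⟨k, hk'⟩ := rfl
    have h1 := c.pathEvol_step hh hsa s (Sum.inl (Fin.castSucc ⟨k, hk'⟩))
    have h2 := c.pathEvol_step hh hsa s (Sum.inr ⟨k, hk'⟩)
    rw [c.pathTime_inl_add_one, c.pathTime_inl] at h1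
    rw [c.pathTime_inr_add_one, c.pathTime_inr] at h2
    have e1 : ((c.pos (Sum.inr ⟨k, hk'⟩ : c.Step) : ℕ) : ℝ) =
        c.pos (Sum.inl (Fin.castSucc ⟨k, hk'⟩) : c.Step) + 1 := by simp [Coeffs.pos]
    have e2 : ((2 * (k + 1) : ℕ) : ℝ) = c.pos (Sum.inr ⟨k, hk'⟩ : c.Step) + 1 := by
      simp only [Coeffs.pos]; push_cast; ring
    have e3 : ((c.pos (Sum.inl (Fin.castSucc ⟨k, hk'⟩) : c.Step) : ℕ) : ℝ) = (2 * k : ℕ) := by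
      simp [Coeffs.pos]
    rw [e2, h2, e1, h1, e3, ih (by omega), e0, mul_assoc]
    rfl

theorem Coeffs.pathEvol_length (hh : ∀ l, Continuous (h l))
    (hsa : ∀ l τ, IsSelfAdjoint (h l τ)) (s : ℝ) :
    pathEvol c.rate h s (2 * c.n + 1 : ℕ) =
      evol (h (Sum.inl (Fin.last c.n))) (s * (c.β (Fin.last c.n) + c.α (Fin.last c.n)))
        (s * c.β (Fin.last c.n)) * leftProd fun j : Fin c.n =>
          evol (h (Sum.inr j)) (s * c.β j.succ) (s * (c.β j.castSucc + c.α j.castSucc)) *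
            evol (h (Sum.inl j.castSucc)) (s * (c.β j.castSucc + c.α j.castSucc))
              (s * c.β j.castSucc) := by
  have h1 := c.pathEvol_step hh hsa s (Sum.inl (Fin.last c.n))
  rw [c.pathTime_inl_add_one, c.pathTime_inl] at h1
  have e : ((c.pos (Sum.inl (Fin.last c.n)) : ℕ) : ℝ) = (2 * c.n : ℕ) := by simp [Coeffs.pos]
  rw [e, c.pathEvol_even hh hsa s c.n le_rfl] at h1
  rw [Nat.cast_succ, h1]
  rfl

theorem Coeffs.pathEvol_stepHam {H : Fin Γ → ℝ → Op E} (hH : ∀ g, Continuous (H g))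
    (hsa : ∀ g τ, IsSelfAdjoint (H g τ)) (t : ℝ) :
    pathEvol c.rate (c.stepHam H) t (2 * c.n + 1 : ℕ) = c.timeDep H t := by
  rw [c.pathEvol_length, Coeffs.timeDep, leftProd_succ]
  · simp only [Coeffs.stepHam, evol_zero, one_mul, mul_comm t, add_mul]
  · rintro (k | k)
    · exact hH _
    · exact continuous_const
  · rintro (k | k) τ
    · exact hsa _ _
    · exact IsSelfAdjoint.zero _

theorem Coeffs.pathEvol_letter {A : Option (Fin Γ) → Op E} (hA : ∀ o, IsSelfAdjoint (A o))
    (s : ℝ) :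
    pathEvol c.rate (fun l _ => A (c.letter l)) s (2 * c.n + 1 : ℕ) =
      c.timeIndep (-A none) (fun g => A (some g)) s := by
  rw [c.pathEvol_length (fun _ => continuous_const) (fun _ _ => hA _), Coeffs.timeIndep]
  simp only [evol_const (hA _), Coeffs.letter]
  congr 2
  · ring
  · funext j
    congr 1
    · rw [expEvol, expEvol, smul_neg, ← neg_smul]
      congr 2
      push_cast
      ring
    · congr 1; ring

end StepEvolution

/-! ### From the order condition to vanishing levels of the Lie series. -/

section OrderCondition

variable {E : Type*} [NormedAddCommGroup E] [InnerProductSpace ℂ E] {Γ : ℕ} (c : Coeffs Γ)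

/-- Under the order condition, the levels `2, …, p` of the Lie series vanish. -/
theorem Coeffs.lieTerm_eq_zero {p : ℕ} (hc : c.OrderCondition p) (H : Fin Γ → ℝ → Op E) (n : ℕ)
    (hn0 : 1 ≤ n) (hn : n < p) (τ : ℝ) :
    lieTerm c.rate (c.stepHam H) n (2 * c.n + 1 : ℕ) τ = 0 := by
  have e : c.stepHam H = fun l => Option.elim (c.letter l) (fun _ => 0) H := by
    funext l; rcases l with k | k <;> rfl
  rw [e, lieTerm_letters c.rate c.letter fun o => Option.elim o (fun _ => 0) H]
  refine Finset.sum_eq_zero fun u _ => ?_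
  -- The coefficients of words do not depend on the Hamiltonians, so testing on constant matrices
  -- suffices. The letter `none` must be independent of the others here, although its Hamiltonian is
  -- 0: its operation is still -i d/dτ.
  rw [sum_lieCoeff_eq_zero c.rate c.letter n _ _ u, zero_smul]
  intro d A hA
  refine lieTerm_eq_zero_of_isBigO c.continuous_rate (by positivity) (fun l => hA _)
    (p := p) ?_ n hn0 hn
  simp only [c.pathEvol_letter hA, c.sum_integral_rate_letter]
  exact hc d (-A none) (fun g => A (some g)) (hA none).neg fun g => hA _

end OrderCondition

/-! ### The error estimate for Hamiltonians smooth on the whole line. -/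

section Estimate

variable {E : Type*} [NormedAddCommGroup E] [InnerProductSpace ℂ E] {Γ : ℕ} (c : Coeffs Γ)

theorem Coeffs.sum_integral_abs_rate_mul_le {w : c.Step → ℝ → ℝ} (hw : ∀ l, Continuous (w l))
    (hw0 : ∀ l u, 0 ≤ w l u) {t B s : ℝ} (hB : ∀ τ ∈ Set.Icc 0 t, ∑ l, w l τ ≤ B)
    (hs : s ∈ Set.Icc 0 t) :
    ∑ l, ∫ x in (0 : ℝ)..(2 * c.n + 1 : ℕ), |c.rate l x| * w l (s * pathTime c.rate x) ≤ B := by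
  have hc : ∀ l, Continuous fun u => w l (s * u) := fun l =>
    (hw l).comp (continuous_const.mul continuous_id)
  calc _ ≤ ∑ l, ∫ u in (0 : ℝ)..1, w l (s * u) := Finset.sum_le_sum fun l _ =>
        c.integral_abs_rate_mul_le l (w := fun u => w l (s * u)) (hc l) fun u => hw0 l _
    _ = ∫ u in (0 : ℝ)..1, ∑ l, w l (s * u) :=
        (intervalIntegral.integral_finsetSum fun l _ => (hc l).intervalIntegrable _ _).symm
    _ ≤ ∫ u in (0 : ℝ)..1, B := by
        refine intervalIntegral.integral_mono_on zero_le_one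
          ((continuous_finsetSum _ fun l _ => hc l).intervalIntegrable _ _)
          intervalIntegrable_const fun u hu => hB _ ⟨mul_nonneg hs.1 hu.1, ?_⟩
        exact (mul_le_of_le_one_right hs.1 hu.2).trans hs.2
    _ = B := by simp

/-- The coefficients of the factors sharing one Hamiltonian add up to 1, hence their absolute values
add up to at least 1. -/
theorem Coeffs.own_stepHam (H : Fin Γ → ℝ → Op E) (l : c.Step) :
    c.stepHam H l = 0 ∨ ∃ s : Finset c.Step, (∀ k ∈ s, c.stepHam H k = c.stepHam H l) ∧
      1 ≤ ∑ k ∈ s, |c.stepCoeff k| := by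
  rcases l with k | k
  · refine Or.inr ⟨({k' | c.γ k' = c.γ k} : Finset (Fin (c.n + 1))).map
      ⟨Sum.inl, Sum.inl_injective⟩, ?_, ?_⟩
    · intro j hj
      obtain ⟨k', hk', rfl⟩ := Finset.mem_map.1 hj
      simp only [Function.Embedding.coeFn_mk, Coeffs.stepHam, (Finset.mem_filter.1 hk').2]
    · rw [Finset.sum_map, ← c.sum_α (c.γ k)]
      exact Finset.sum_le_sum fun _ _ => le_abs_self _
  · exact Or.inl rfl

theorem Coeffs.sum_stepCoeff_smul (H : Fin Γ → ℝ → Op E) (τ : ℝ) :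
    ∑ l, c.stepCoeff l • c.stepHam H l τ = ∑ g, H g τ := by
  rw [Fintype.sum_sum_type]
  simp only [Coeffs.stepCoeff, Coeffs.stepHam, smul_zero, Finset.sum_const_zero, add_zero]
  exact c.sum_α_smul fun g => H g τ

theorem Coeffs.contDiff_stepHam {H : Fin Γ → ℝ → Op E} {M : ℕ} (hH : ∀ g, ContDiff ℝ M (H g))
    (l : c.Step) : ContDiff ℝ M (c.stepHam H l) := by
  rcases l with k | k
  · exact hH _
  · exact contDiff_const

theorem continuous_wordNorm {A ι : Type*} [NormedRing A] [NormedAlgebra ℂ A] [Fintype ι]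
    (a : ι → ℝ) {h : ι → ℝ → A} {M n : ℕ}
    (hh : ∀ l, ContDiff ℝ M (h l)) (hM : n ≤ M) (l : ι) : Continuous (wordNorm a h n [] l) := by
  refine continuous_finsetSum _ fun κ _ => continuous_const.mul (Continuous.norm ?_)
  exact (contDiff_covWord (adAct A) hh _ (k := 0) (by simpa using hM)
    ((hh l).of_le (by simpa using hM))).continuous

variable [CompleteSpace E]

theorem Coeffs.isSelfAdjoint_stepHam {H : Fin Γ → ℝ → Op E}
    (hsa : ∀ g τ, IsSelfAdjoint (H g τ)) (l : c.Step) (τ : ℝ) :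
    IsSelfAdjoint (c.stepHam H l τ) := by
  rcases l with k | k
  · exact hsa _ _
  · exact IsSelfAdjoint.zero _

variable {H : Fin Γ → ℝ → Op E} {t B : ℝ}

theorem continuous_sum_ham {M : ℕ} (hH : ∀ g, ContDiff ℝ M (H g)) :
    Continuous fun s => ∑ g, H g s :=
  continuous_finsetSum _ fun g _ => (hH g).continuous

theorem isSelfAdjoint_sum_ham (hsa : ∀ g τ, IsSelfAdjoint (H g τ)) (s : ℝ) :
    IsSelfAdjoint (∑ g, H g s) := isSelfAdjoint_sum _ fun g _ => hsa g s

/-- The distance of an evolution to the identity. -/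
theorem norm_evol_sub_one_le {G : ℝ → Op E} (hG : Continuous G)
    (hGsa : ∀ s, IsSelfAdjoint (G s)) {b : ℝ} (hb : 0 ≤ b) {φ : ℝ → ℝ} (hφ : Continuous φ)
    (hle : ∀ x ∈ Set.Icc 0 b, ‖G x‖ ≤ φ x) : ‖evol G b 0 - 1‖ ≤ ∫ x in (0 : ℝ)..b, φ x := by
  refine image_norm_le_of_norm_deriv_right_le_deriv_boundary
    (f := fun x => evol G x 0 - 1) (a := 0) (b := b)
    (B := fun x => ∫ y in (0 : ℝ)..x, φ y) (B' := φ)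
    (fun x _ => ((hasDerivAt_evol hG 0 x).sub_const 1).continuousAt.continuousWithinAt)
    (fun x _ => ((hasDerivAt_evol hG 0 x).sub_const 1).hasDerivWithinAt)
    (by simp [evol_self]) (fun x => hasDerivAt_primitive hφ 0 x) ?_ ⟨hb, le_rfl⟩
  intro x hx
  rw [norm_smul, norm_neg, Complex.norm_I, one_mul]
  refine (norm_mul_le _ _).trans ?_
  exact (mul_le_of_le_one_right (norm_nonneg _) (norm_evol_le hG hGsa 0 x)).trans
    (hle x ⟨hx.1, hx.2.le⟩)

variable [FiniteDimensional ℂ E]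

/-- The generator of the product formula differs from the sum of the Hamiltonians by a term of
order `p`. -/
theorem Coeffs.norm_pathGen_sub_le {n : ℕ} (hc : c.OrderCondition (n + 1))
    (hH : ∀ g, ContDiff ℝ (n + 3 : ℕ) (H g)) (hsa : ∀ g τ, IsSelfAdjoint (H g τ))
    (hB : ∀ τ ∈ Set.Icc 0 t,
      ∑ l, wordNorm c.stepCoeff (c.stepHam H) (n + 1) [] l τ ≤ B)
    {s : ℝ} (hs : s ∈ Set.Icc 0 t) :
    ‖pathGen c.rate (c.stepHam H) s (2 * c.n + 1 : ℕ) - ∑ g, H g s‖ ≤ s ^ (n + 1) * (4 * B) := by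
  set h := c.stepHam H with hh_def
  set w : c.Step → ℝ → ℝ := fun l => wordNorm c.stepCoeff h (n + 1) [] l with hw
  have hh := c.contDiff_stepHam hH
  have hhsa := c.isSelfAdjoint_stepHam hsa
  have hwc : ∀ l, Continuous (w l) := fun l => continuous_wordNorm _ hh (by omega) l
  have hw0 : ∀ l u, 0 ≤ w l u := fun l u => wordNorm_nonneg _ _ _ _ _ _
  have hρ := continuous_pathTime c.continuous_rate
  have hX : (0 : ℝ) ≤ (2 * c.n + 1 : ℕ) := by positivity
  set S : ℝ := ∑ l, |c.stepCoeff l| with hS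
  have hS1 : 1 ≤ S := c.one_le_sum_abs_stepCoeff
  have hS0 : 0 < S := by linarith
  -- At the end of the path only level 0 survives, and it is the sum of the Hamiltonians at time
  -- `s`, since the path time there is 1.
  have hrem : pathRemainder c.rate h (n + 1) s (2 * c.n + 1 : ℕ) =
      pathGen c.rate h s (2 * c.n + 1 : ℕ) - ∑ g, H g s := by
    rw [pathRemainder, Finset.sum_range_succ', Finset.sum_eq_zero]
    · rw [zero_add, pow_zero, one_smul, c.pathTime_length, mul_one, lieTerm_zero]
      simp only [c.integral_rate_length]
      rw [c.sum_stepCoeff_smul]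
    · intro j hj
      rw [c.lieTerm_eq_zero hc H (j + 1) (by omega) (by simp at hj; omega), smul_zero]
  rw [← hrem]
  have hφ : ∀ l, Continuous fun x => |c.rate l x| * (3 * B / S) +
      |c.rate l x| * w l (s * pathTime c.rate x) := fun l =>
    ((c.continuous_rate l).abs.mul continuous_const).add
      ((c.continuous_rate l).abs.mul ((hwc l).comp (continuous_const.mul hρ)))
  refine (norm_pathRemainder_le c.continuous_rate hh hhsa n (by omega) hs.1 hX
    (φ := fun x => ∑ l, (|c.rate l x| * (3 * B / S) +
      |c.rate l x| * w l (s * pathTime c.rate x)))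
    (continuous_finsetSum _ fun l _ => hφ l) ?_).trans ?_
  · intro x hx
    have hxρ := c.pathTime_mem hx
    have hz : s * pathTime c.rate x ∈ Set.Icc 0 t :=
      ⟨mul_nonneg hs.1 hxρ.1, (mul_le_of_le_one_right hs.1 hxρ.2).trans hs.2⟩
    obtain ⟨h1, h2⟩ := exists_norm_lieBracket_le c.continuous_rate hh
      (fun l x _ => c.integral_abs_rate_le l x)
      (fun x hx => abs_le.2 ⟨by linarith [(c.pathTime_mem hx).1], (c.pathTime_mem hx).2⟩)
      (c.own_stepHam H) n (by omega) (s * pathTime c.rate x) hx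
    have h3 : wordNormSum c.stepCoeff h (n + 1) [] (s * pathTime c.rate x) ≤ B :=
      (Finset.sum_le_sum fun l _ => mul_le_of_le_one_left (hw0 l _)
        (c.abs_stepCoeff_le l)).trans (hB _ hz)
    -- The division by `S` is undone after integration, since the absolute rates of all steps
    -- integrate to `S`: this part contributes 3B and the words contribute B.
    have h4 : ‖deriv (lieTerm c.rate h n x) (s * pathTime c.rate x)‖ ≤ 3 * B / S := by
      rw [le_div_iff₀ hS0, mul_comm]
      linarith
    refine Finset.sum_le_sum fun l _ => ?_
    rw [← mul_add]
    exact mul_le_mul_of_nonneg_left ((h2 l).trans (by linarith [hw0 l (s * pathTime c.rate x)]))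
      (abs_nonneg _)
  · refine mul_le_mul_of_nonneg_left ?_ (pow_nonneg hs.1 _)
    have hi1 : ∀ l, IntervalIntegrable (fun x => |c.rate l x| * (3 * B / S))
        MeasureTheory.volume 0 (2 * c.n + 1 : ℕ) := fun l =>
      ((c.continuous_rate l).abs.mul continuous_const).intervalIntegrable _ _
    have hi2 : ∀ l, IntervalIntegrable (fun x => |c.rate l x| * w l (s * pathTime c.rate x))
        MeasureTheory.volume 0 (2 * c.n + 1 : ℕ) := fun l =>
      ((c.continuous_rate l).abs.mul
        ((hwc l).comp (continuous_const.mul hρ))).intervalIntegrable _ _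
    rw [intervalIntegral.integral_finsetSum fun l _ => (hφ l).intervalIntegrable _ _]
    simp only [fun l => intervalIntegral.integral_add (hi1 l) (hi2 l), Finset.sum_add_distrib]
    have e1 : ∑ l, ∫ x in (0 : ℝ)..(2 * c.n + 1 : ℕ), |c.rate l x| * (3 * B / S) = 3 * B := by
      simp only [intervalIntegral.integral_mul_const, c.integral_abs_rate, c.ramp_length, mul_one]
      rw [← Finset.sum_mul, ← hS, mul_comm, div_mul_cancel₀ _ hS0.ne']
    rw [e1]
    have := c.sum_integral_abs_rate_mul_le hwc hw0 hB hs
    linarith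

theorem Coeffs.norm_evol_sub_timeDep_le_succ {n : ℕ} (hc : c.OrderCondition (n + 1)) (ht : 0 ≤ t)
    (hH : ∀ g, ContDiff ℝ (n + 3 : ℕ) (H g)) (hsa : ∀ g τ, IsSelfAdjoint (H g τ))
    (hB : ∀ τ ∈ Set.Icc 0 t,
      ∑ l, wordNorm c.stepCoeff (c.stepHam H) (n + 1) [] l τ ≤ B) :
    ‖evol (fun s => ∑ g, H g s) t 0 - c.timeDep H t‖ ≤ 3 * t ^ (n + 2) * B := by
  have hB0 : 0 ≤ B := (Finset.sum_nonneg fun l _ => wordNorm_nonneg _ _ _ _ _ _).trans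
    (hB 0 ⟨le_rfl, ht⟩)
  set X : ℝ := ((2 * c.n + 1 : ℕ) : ℝ) with hXdef
  have hX : 0 ≤ X := by positivity
  have hG := continuous_sum_ham hH
  have hGsa := isSelfAdjoint_sum_ham hsa
  have hh := c.contDiff_stepHam hH
  have hhsa := c.isSelfAdjoint_stepHam hsa
  have hh1 : ∀ l, ContDiff ℝ (1 : ℕ) (c.stepHam H l) := fun l =>
    (hh l).of_le (by exact_mod_cast (by omega))
  set U : ℝ → Op E := fun s => evol (fun s => ∑ g, H g s) s 0 with hU
  set P : ℝ → Op E := fun s => pathEvol c.rate (c.stepHam H) s X with hP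
  have hd : ∀ s, HasDerivAt (fun s => star (U s) * P s - 1) (star (U s) * ((-Complex.I) •
      ((pathGen c.rate (c.stepHam H) s X - ∑ g, H g s) * P s))) s := by
    intro s
    refine (hasDerivAt_star_evol_mul hG 0 (hGsa s) ((hasDerivAt_pathEvol_scale c.continuous_rate
      hh1 hhsa s hX).congr_deriv ?_)).sub_const 1
    rw [sub_mul, smul_sub, add_sub_cancel]
  have hbound : ∀ s ∈ Set.Ico 0 t, ‖star (U s) * ((-Complex.I) •
      ((pathGen c.rate (c.stepHam H) s X - ∑ g, H g s) * P s))‖ ≤ 4 * B * s ^ (n + 1) := by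
    intro s hs
    have h1 : ‖U s‖ ≤ 1 := norm_evol_le hG hGsa 0 s
    have h2 : ‖P s‖ ≤ 1 := norm_pathEvol_le c.continuous_rate hh1 hhsa s X
    have h3 := c.norm_pathGen_sub_le hc hH hsa hB ⟨hs.1, hs.2.le⟩
    refine (norm_mul_le _ _).trans ?_
    rw [norm_star, norm_smul, norm_neg, Complex.norm_I, one_mul]
    calc _ ≤ 1 * (s ^ (n + 1) * (4 * B) * 1) := by
          have : 0 ≤ s ^ (n + 1) * (4 * B) := mul_nonneg (pow_nonneg hs.1 _) (by positivity)
          gcongr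
          exact (norm_mul_le _ _).trans (by gcongr)
      _ = _ := by ring
  have hmain := image_norm_le_of_norm_deriv_right_le_deriv_boundary
    (f := fun s => star (U s) * P s - 1) (a := 0) (b := t)
    (B := fun s => 4 * B * (s ^ (n + 2) / (n + 2))) (B' := fun s => 4 * B * s ^ (n + 1))
    (fun s _ => (hd s).continuousAt.continuousWithinAt)
    (fun s _ => (hd s).hasDerivWithinAt)
    (by simp [hU, hP, evol_self, pathEvol_scale_zero c.rate (c.stepHam H) hX])
    (fun s => by
      refine (((hasDerivAt_pow (n + 2) s).div_const _).const_mul _).congr_deriv ?_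
      have : (n : ℝ) + 2 ≠ 0 := by positivity
      rw [show n + 2 - 1 = n + 1 by omega]
      push_cast
      field_simp)
    hbound ⟨ht, le_rfl⟩
  have hPt : P t = c.timeDep H t := c.pathEvol_stepHam (fun g => (hH g).continuous) hsa t
  have e : U t - P t = -(U t * (star (U t) * P t - 1)) := by
    have : U t * star (U t) = 1 := evol_mul_star_evol hG hGsa 0 t
    rw [mul_sub, ← mul_assoc, this]
    simp
  rw [← hPt]
  change ‖U t - P t‖ ≤ _
  rw [e, norm_neg]
  have h1 : ‖U t‖ ≤ 1 := norm_evol_le hG hGsa 0 t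
  calc _ ≤ ‖U t‖ * ‖star (U t) * P t - 1‖ := norm_mul_le _ _
    _ ≤ 1 * (4 * B * (t ^ (n + 2) / (n + 2))) := by gcongr
    -- Here p = n + 1 ≥ 1, so the denominator p + 1 is at least 2 and the constant is at most 2.
    _ ≤ 1 * (4 * B * (t ^ (n + 2) / 2)) := by
        gcongr
        linarith [(Nat.cast_nonneg n : (0 : ℝ) ≤ n)]
    _ ≤ 3 * t ^ (n + 2) * B := by
        have : 0 ≤ t ^ (n + 2) * B := by positivity
        linarith

/-- For p = 0 no cancellation is needed: both evolutions lie within `t * B` of the identity. -/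
theorem Coeffs.norm_evol_sub_timeDep_le_zero (ht : 0 ≤ t)
    (hH : ∀ g, Continuous (H g)) (hsa : ∀ g τ, IsSelfAdjoint (H g τ))
    (hB : ∀ τ ∈ Set.Icc 0 t,
      ∑ l, wordNorm c.stepCoeff (c.stepHam H) 0 [] l τ ≤ B) :
    ‖evol (fun s => ∑ g, H g s) t 0 - c.timeDep H t‖ ≤ 3 * t * B := by
  have hB0 : 0 ≤ B := (Finset.sum_nonneg fun l _ => wordNorm_nonneg _ _ _ _ _ _).trans
    (hB 0 ⟨le_rfl, ht⟩)
  have hwn : ∀ l τ, wordNorm c.stepCoeff (c.stepHam H) 0 [] l τ = ‖c.stepHam H l τ‖ := by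
    intro l τ; simp [wordNorm, covWord]
  simp only [hwn] at hB
  have hh : ∀ l, Continuous (c.stepHam H l) := by
    rintro (k | k)
    · exact hH _
    · exact continuous_const
  have hhsa := c.isSelfAdjoint_stepHam hsa
  have hX : (0 : ℝ) ≤ (2 * c.n + 1 : ℕ) := by positivity
  have h1 : ‖evol (fun s => ∑ g, H g s) t 0 - 1‖ ≤ ∫ _ in (0 : ℝ)..t, B := by
    refine norm_evol_sub_one_le (continuous_finsetSum _ fun g _ => hH g)
      (isSelfAdjoint_sum_ham hsa) ht continuous_const fun x hx => ?_
    rw [← c.sum_stepCoeff_smul]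
    refine (norm_sum_le _ _).trans ((Finset.sum_le_sum fun l _ => ?_).trans (hB x hx))
    rw [norm_smul]
    exact mul_le_of_le_one_left (norm_nonneg _) (c.abs_stepCoeff_le l)
  have hφ : ∀ l, Continuous fun x => |c.rate l x| * ‖c.stepHam H l (t * pathTime c.rate x)‖ :=
    fun l => (c.continuous_rate l).abs.mul
      ((hh l).comp (continuous_const.mul (continuous_pathTime c.continuous_rate))).norm
  have h2 : ‖pathEvol c.rate (c.stepHam H) t (2 * c.n + 1 : ℕ) - 1‖ ≤
      ∫ x in (0 : ℝ)..(2 * c.n + 1 : ℕ),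
        t * ∑ l, |c.rate l x| * ‖c.stepHam H l (t * pathTime c.rate x)‖ := by
    refine norm_evol_sub_one_le (continuous_pathHam c.continuous_rate hh t)
      (isSelfAdjoint_pathHam hhsa t) hX
      (continuous_const.mul (continuous_finsetSum _ fun l _ => hφ l)) fun x _ => ?_
    rw [pathHam, Finset.mul_sum]
    refine (norm_sum_le _ _).trans (le_of_eq (Finset.sum_congr rfl fun l _ => ?_))
    rw [norm_smul, norm_smul, Real.norm_eq_abs, Real.norm_of_nonneg ht]
    ring
  have h3 := c.sum_integral_abs_rate_mul_le (w := fun l τ => ‖c.stepHam H l τ‖)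
    (fun l => (hh l).norm) (fun _ _ => norm_nonneg _) hB ⟨ht, le_rfl⟩
  rw [intervalIntegral.integral_const_mul,
    intervalIntegral.integral_finsetSum fun l _ => (hφ l).intervalIntegrable _ _] at h2
  rw [c.pathEvol_stepHam hH hsa] at h2
  simp only [intervalIntegral.integral_const, smul_eq_mul, sub_zero] at h1
  calc _ = ‖(evol (fun s => ∑ g, H g s) t 0 - 1) - (c.timeDep H t - 1)‖ := by
        rw [sub_sub_sub_cancel_right]
    _ ≤ t * B + t * B := (norm_sub_le _ _).trans (add_le_add h1 (h2.trans (by gcongr)))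
    _ ≤ 3 * t * B := by
        have : 0 ≤ t * B := by positivity
        linarith

theorem Coeffs.norm_evol_sub_timeDep_le {p : ℕ} (hc : c.OrderCondition p) (ht : 0 ≤ t)
    (hH : ∀ g, ContDiff ℝ (p + 2 : ℕ) (H g)) (hsa : ∀ g τ, IsSelfAdjoint (H g τ))
    (hB : ∀ τ ∈ Set.Icc 0 t,
      ∑ l, wordNorm c.stepCoeff (c.stepHam H) p [] l τ ≤ B) :
    ‖evol (fun s => ∑ g, H g s) t 0 - c.timeDep H t‖ ≤ 3 * t ^ (p + 1) * B := by
  cases p with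
  | zero =>
    simpa using c.norm_evol_sub_timeDep_le_zero ht (fun g => (hH g).continuous) hsa hB
  | succ n => exact c.norm_evol_sub_timeDep_le_succ hc ht hH hsa hB

end Estimate

/-! ### Passage from the interval [0, t] to the whole line. -/

section Interval

/-- A function of class `C^k` on a compact interval extends to the real line. -/
theorem exists_contDiff_extension {F : Type*} [NormedAddCommGroup F] [NormedSpace ℝ F]
    [CompleteSpace F] {t : ℝ} (ht : 0 < t) (k : ℕ) {f : ℝ → F}
    (hf : ContDiffOn ℝ k f (Set.Icc 0 t)) :
    ∃ g : ℝ → F, ContDiff ℝ k g ∧ Set.EqOn g f (Set.Icc 0 t) := by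
  induction k generalizing f with
  | zero =>
    refine ⟨Set.IccExtend ht.le ((Set.Icc 0 t).domRestrict f), ?_, ?_⟩
    · rw [Nat.cast_zero, contDiff_zero]
      exact (continuousOn_iff_continuous_domRestrict.1 hf.continuousOn).Icc_extend'
    · intro x hx
      rw [Set.IccExtend_of_mem _ _ hx]; rfl
  | succ k ih =>
    have hf' : ContDiffOn ℝ ((k : WithTop ℕ∞) + 1) f (Set.Icc 0 t) := by exact_mod_cast hf
    have hu := uniqueDiffOn_Icc ht
    obtain ⟨hd, -, hd'⟩ := (contDiffOn_succ_iff_derivWithin hu).1 hf'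
    -- The one-sided derivative is extended first and then integrated from the value at 0.
    obtain ⟨g, hg, hgf⟩ := ih hd'
    have hG : ∀ x, HasDerivAt (fun x => f 0 + ∫ y in (0 : ℝ)..x, g y) (g x) x := fun x =>
      (hasDerivAt_primitive hg.continuous 0 x).const_add _
    refine ⟨fun x => f 0 + ∫ y in (0 : ℝ)..x, g y, ?_, ?_⟩
    · have hder : deriv (fun x => f 0 + ∫ y in (0 : ℝ)..x, g y) = g := funext fun x => (hG x).deriv
      have : ContDiff ℝ ((k : WithTop ℕ∞) + 1) fun x => f 0 + ∫ y in (0 : ℝ)..x, g y := by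
        rw [contDiff_succ_iff_deriv]
        exact ⟨fun x => (hG x).differentiableAt, by simp, by rw [hder]; exact hg⟩
      exact_mod_cast this
    · refine eq_of_derivWithin_eq (fun x _ => (hG x).differentiableAt.differentiableWithinAt) hd
        ?_ (by simp)
      intro x hx
      have hx' : x ∈ Set.Icc 0 t := ⟨hx.1, hx.2.le⟩
      rw [(hG x).hasDerivWithinAt.derivWithin (hu x hx'), hgf hx']

variable {E : Type*} [NormedAddCommGroup E] [InnerProductSpace ℂ E]

theorem dyson_congr {G G' : ℝ → Op E} {t : ℝ} (h : Set.EqOn G G' (Set.Icc 0 t)) {a : ℝ}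
    (ha : a ∈ Set.Icc 0 t) (m : ℕ) : Set.EqOn (dyson G a m) (dyson G' a m) (Set.Icc 0 t) := by
  induction m with
  | zero => intro b _; rfl
  | succ m ih =>
    intro b hb
    refine intervalIntegral.integral_congr fun s hs => ?_
    have hs' : s ∈ Set.Icc 0 t := Set.uIcc_subset_Icc ha hb hs
    simp only [h hs', ih hs']

theorem evol_congr {G G' : ℝ → Op E} {t : ℝ} (h : Set.EqOn G G' (Set.Icc 0 t)) {a b : ℝ}
    (ha : a ∈ Set.Icc 0 t) (hb : b ∈ Set.Icc 0 t) : evol G b a = evol G' b a :=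
  tsum_congr fun m => dyson_congr h ha m hb

variable {Γ : ℕ} (c : Coeffs Γ) {H H' : Fin Γ → ℝ → Op E} {t : ℝ}

theorem Coeffs.timeDep_congr (ht : 0 ≤ t) (h : ∀ g, Set.EqOn (H g) (H' g) (Set.Icc 0 t)) :
    c.timeDep H t = c.timeDep H' t := by
  unfold Coeffs.timeDep
  congr 1
  funext k
  have h1 := c.β_mem k
  have h2 := c.β_add_α_mem k
  refine evol_congr (h _) ⟨mul_nonneg h1.1 ht, mul_le_of_le_one_left ht h1.2⟩ ?_
  rw [← add_mul]
  exact ⟨mul_nonneg h2.1 ht, mul_le_of_le_one_left ht h2.2⟩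

/-- The weights are constants and come out of the operations. On an interval of positive length the
one-sided derivatives are determined by the restriction, so they agree with the derivatives of the
extension. -/
theorem Coeffs.nested_eq_covWord {M : ℕ} (ht : 0 < t)
    (h : ∀ g, Set.EqOn (H g) (H' g) (Set.Icc 0 t)) (hH' : ∀ g, ContDiff ℝ M (H' g))
    (L : List c.Step) (hL : L.length ≤ M) (g : Fin Γ) :
    Set.EqOn (L.foldr (fun j f τ => ((|c.stepCoeff j| : ℝ) : ℂ) •
        covDeriv t (c.stepHam H j) f τ) (H g))
      (fun τ => (L.map fun j => |c.stepCoeff j|).prod •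
        covWord (adAct (Op E)) (c.stepHam H') L (H' g) τ) (Set.Icc 0 t) := by
  induction L with
  | nil => intro τ hτ; simpa [covWord] using h g hτ
  | cons j L ih =>
    intro τ hτ
    simp only [List.length_cons] at hL
    have ih := ih (by omega)
    have hs : c.stepHam H j τ = c.stepHam H' j τ := by
      rcases j with k | k
      · exact h _ hτ
      · rfl
    have hd : DifferentiableAt ℝ (covWord (adAct (Op E)) (c.stepHam H') L (H' g)) τ := by
      have : ContDiff ℝ (1 : ℕ) (covWord (adAct (Op E)) (c.stepHam H') L (H' g)) :=
        contDiff_covWord _ (c.contDiff_stepHam hH') L hL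
          ((hH' g).of_le (by exact_mod_cast hL))
      exact this.differentiable (by simp) τ
    have hd2 := (hd.hasDerivAt.fun_const_smul (L.map fun j => |c.stepCoeff j|).prod).hasDerivWithinAt
      (s := Set.Icc 0 t)
    rw [List.foldr_cons, covDeriv, derivWithin_congr ih (ih hτ),
      hd2.derivWithin (uniqueDiffOn_Icc ht τ hτ), ih hτ, hs, Complex.coe_smul]
    simp only [covWord_cons, covAct, adAct_apply, List.map_cons, List.prod_cons, mul_smul]
    congr 1
    simp only [smul_sub, smul_mul_assoc, mul_smul_comm]
    rw [smul_comm Complex.I]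

theorem covWord_zero {A ι : Type*} [NormedRing A] [NormedAlgebra ℂ A] (π : A →L[ℂ] A →L[ℂ] A)
    (h : ι → ℝ → A) (L : List ι) : covWord π h L (fun _ => 0) = fun _ => 0 := by
  induction L with
  | nil => rfl
  | cons l L ih => rw [covWord_cons, ih]; funext τ; simp [covAct]

/-- The sum over all steps reduces to the sum over factors, because a word acting on the zero
Hamiltonian of an intermediate step gives 0. -/
theorem Coeffs.commFactor_eq {p : ℕ} (ht : 0 < t)
    (h : ∀ g, Set.EqOn (H g) (H' g) (Set.Icc 0 t)) (hH' : ∀ g, ContDiff ℝ p (H' g)) :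
    Set.EqOn (c.commFactor H t p)
      (fun τ => ∑ l, wordNorm c.stepCoeff (c.stepHam H') p [] l τ) (Set.Icc 0 t) := by
  intro τ hτ
  have h0 : ∀ k, wordNorm c.stepCoeff (c.stepHam H') p [] (Sum.inr k) τ = 0 := by
    intro k
    refine Finset.sum_eq_zero fun κ _ => ?_
    simp only [Coeffs.stepHam, covWord_zero, norm_zero, mul_zero]
  simp only [Fintype.sum_sum_type, h0, Finset.sum_const_zero, add_zero]
  refine Finset.sum_congr rfl fun k _ => Finset.sum_congr rfl fun κ _ => ?_
  rw [Coeffs.nested, c.nested_eq_covWord ht h hH' _ (by simp) (c.γ k) hτ, norm_smul,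
    List.map_ofFn, List.prod_ofFn, List.nil_append]
  congr 1
  exact Real.norm_of_nonneg (Finset.prod_nonneg fun _ _ => abs_nonneg _)

end Interval

end ProductFormula

end

theorem mainTheorem1 {E : Type*} [NormedAddCommGroup E] [InnerProductSpace ℂ E]
    [FiniteDimensional ℂ E] [CompleteSpace E]
    (Γ p : ℕ) (c : ProductFormula.Coeffs Γ) (hc : c.OrderCondition p)
    (t : ℝ) (ht : 0 < t) (H : Fin Γ → ℝ → ProductFormula.Op E)
    (hH_adj : ∀ g, ∀ s ∈ Set.Icc (0 : ℝ) t, IsSelfAdjoint (H g s))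
    (hH_smooth : ∀ g, ContDiffOn ℝ ((p + 2 : ℕ) : WithTop ℕ∞) (H g) (Set.Icc 0 t)) :
    ∃ τ ∈ Set.Icc (0 : ℝ) t,
      IsMaxOn (c.commFactor H t p) (Set.Icc 0 t) τ ∧
        ‖ProductFormula.evol (fun s => ∑ g, H g s) t 0 - c.timeDep H t‖ ≤
          3 * t ^ (p + 1) * c.commFactor H t p τ := by
  open ProductFormula in
  choose G hG hGH using fun g => exists_contDiff_extension ht (p + 2) (hH_smooth g)
  -- The smooth extension need not be Hermitian outside the interval; its Hermitian part is smooth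
  -- as well and still agrees with `H g` on [0, t].
  set H' : Fin Γ → ℝ → ProductFormula.Op E := fun g τ => (1 / 2 : ℝ) • (G g τ + star (G g τ))
    with hH'
  have hsmooth : ∀ g, ContDiff ℝ (p + 2 : ℕ) (H' g) := fun g =>
    ((hG g).add ((starL' ℝ : ProductFormula.Op E ≃L[ℝ] ProductFormula.Op E).contDiff.comp
      (hG g))).const_smul _
  have hsa : ∀ g τ, IsSelfAdjoint (H' g τ) := fun g τ =>
    (IsSelfAdjoint.all _).smul (IsSelfAdjoint.add_star_self _)
  have heq : ∀ g, Set.EqOn (H g) (H' g) (Set.Icc 0 t) := fun g τ hτ => by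
    simp only [hH', hGH g hτ, (hH_adj g τ hτ).star_eq]
    rw [← two_smul ℝ, smul_smul]
    norm_num
  have hfac := c.commFactor_eq (p := p) ht heq
    fun g => (hsmooth g).of_le (by exact_mod_cast (by omega))
  have hcont : ContinuousOn (c.commFactor H t p) (Set.Icc 0 t) := by
    refine ContinuousOn.congr (Continuous.continuousOn ?_) hfac
    exact continuous_finsetSum _ fun l _ => ProductFormula.continuous_wordNorm _
      (c.contDiff_stepHam hsmooth) (by omega) l
  obtain ⟨τ, hτ, hmax⟩ := isCompact_Icc.exists_isMaxOn (Set.nonempty_Icc.2 ht.le) hcont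
  refine ⟨τ, hτ, hmax, ?_⟩
  have h0 : (0 : ℝ) ∈ Set.Icc 0 t := ⟨le_rfl, ht.le⟩
  have h1 : t ∈ Set.Icc 0 t := ⟨ht.le, le_rfl⟩
  rw [c.timeDep_congr ht.le heq, ProductFormula.evol_congr
    (G' := fun s => ∑ g, H' g s) (fun s hs => Finset.sum_congr rfl fun g _ => heq g hs) h0 h1]
  refine c.norm_evol_sub_timeDep_le hc ht.le hsmooth hsa fun σ hσ => ?_
  have h2 : c.commFactor H t p σ ≤ c.commFactor H t p τ := hmax hσ
  rwa [hfac hσ] at h2
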